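/- **Setting.** Let $n\in\{2,3\}$ and $k\ge 0$. Let $\mathcal T_E,\mathcal T_A$ be finite disjoint sets of nondegenerate closed $n$-simplices in $\mathbb R^n$ such that $\mathcal T_E\cup\mathcal T_A$ is conforming (any two simplices meet exactly in the simplex, possibly empty, spanned by their common vertices). They triangulate the closures of an elastic region $\Omega_E$ and an acoustic region $\Omega_A$. Let $\mathcal E_\dagger$ be the set of faces of the elements of $\mathcal T_\dagger$, $\dagger\in\{A,E\}$. The interface $\Gamma$ consists of the faces in $\mathcal E_E\cap\mathcal E_A$; assume $\partial\Omega_E=\Gamma$, i.e. each face of an elastic element is shared with another (elastic or acoustic) element. The faces of exactly one acoustic element and of no elastic element form the outer boundary $\Gamma_A$, and are divided into a set of Dirichlet faces $\Gamma_A^D$ and the set $\Gamma_A^N$ of the remaining (Neumann) faces; either may be empty. $\boldsymbol n$ is the outward unit normal of an element, and $\boldsymbol n_E=-\boldsymbol n_A$ on $\Gamma$ are the outward normals of the elastic and the acoustic region. Let $s\in\mathbb C$ with $\operatorname{Re}s>0$, $\rho_E,\rho_f,c>0$, and Lamé constants $\mu,\lambda\in\mathbb R$ with $\mu>0$, $n\lambda+2\mu>0$;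 put $\mathbf C^{-1}M=\frac1{2\mu}M-\frac{\lambda}{2\mu(n\lambda+2\mu)}\operatorname{tr}(M)I$. The data are $\boldsymbol f\in \boldsymbol L^2(\Omega_E)$, $f\in L^2(\Omega_A)$, $g_D\in L^2(\Gamma_A^D)$, $g_N\in L^2(\Gamma_A^N)$, and the values on $\Gamma$ of an incident field and of its gradient, $v^{\rm inc}\in L^2(\Gamma)$, $\nabla v^{\rm inc}\in \boldsymbol L^2(\Gamma)$ (any such pair is allowed). The stabilization parameters $\tau_E,\tau_A$ are complex functions on the boundaries of the elements of $\mathcal T_E,\mathcal T_A$ (possibly different on the two sides of a face), integrable on every face. **Spaces.** $\mathcal P_k$ denotes complex polynomials of degree $\le k$, and $A(K)$ the skew-symmetric $n\times n$ matrices with entries in $\mathcal P_k(K)$. With $\eta_F$ the barycentric coordinate of $K$ vanishing on the face $F$, let $b_K=\prod_F\eta_F$ if $n=2$ and $b_K=\sum_F\big(\prod_{F'\ne F}\eta_{F'}\big)\nabla\eta_F\otimes\nabla\eta_F$ if $n=3$, and $V(K)=\mathcal P_k(K)^{n\times n}+\nabla\times\big((\nabla\times A(K))\,b_K\big)$. For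 $n=3$ the curl acts row-wise; for $n=2$, $(\nabla\times M)_i=\partial_1M_{i2}-\partial_2M_{i1}$ for a matrix $M$, and $\nabla\times m$ has the rows $(-\partial_2m_i,\ \partial_1m_i)$ for a vector $m$. Let $\underline{\boldsymbol V}_h,\boldsymbol W_h^E,\underline{\boldsymbol A}_h$ be the spaces of functions on $\mathcal T_E$ that lie on each $K$ in $V(K)$, $\mathcal P_k(K)^n$, $A(K)$ respectively; $\boldsymbol W_h^A,W_h$ those on $\mathcal T_A$ that lie on each $K$ in $\mathcal P_k(K)^n$, $\mathcal P_k(K)$; and $\boldsymbol M_h$, $M_h$ the functions on the faces of $\mathcal E_E$, $\mathcal E_A$ that lie on each face $F$ in $\mathcal P_k(F)^n$, $\mathcal P_k(F)$. **Scheme.** Write $(\cdot,\cdot)_{\mathcal T_\dagger}=\sum_{K\in\mathcal T_\dagger}(\cdot,\cdot)_{K}$ and $\langle\cdot,\cdot\rangle_{\partial\mathcal T_\dagger}=\sum_{K\in\mathcal T_\dagger}\langle\cdot,\cdot\rangle_{\partial K}$ for the complex $L^2$ inner products, conjugate-linear in the second argument. Find $(\sigma_h,\boldsymbol u_h,\gamma_h,\widehat{\boldsymbol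 u}_h,\boldsymbol q_h,v_h,\widehat v_h)\in\underline{\boldsymbol V}_h\times\boldsymbol W_h^E\times\underline{\boldsymbol A}_h\times\boldsymbol M_h\times\boldsymbol W_h^A\times W_h\times M_h$ such that, for all $(\tau,\boldsymbol t,\eta,\boldsymbol\mu,\boldsymbol r,w,\xi)$ in the same product space, $$\begin{aligned} (\mathbf C^{-1}\sigma_h,\tau)_{\mathcal T_E}+(\boldsymbol u_h,\nabla\cdot\tau)_{\mathcal T_E}+(\gamma_h,\tau)_{\mathcal T_E}-\langle\widehat{\boldsymbol u}_h,\tau\boldsymbol n\rangle_{\partial\mathcal T_E}&=0,\\ (\sigma_h,\nabla\boldsymbol t)_{\mathcal T_E}-\langle\widehat\sigma_h\boldsymbol n,\boldsymbol t\rangle_{\partial\mathcal T_E}+\rho_Es^2(\boldsymbol u_h,\boldsymbol t)_{\mathcal T_E}&=(\boldsymbol f,\boldsymbol t)_{\mathcal T_E},\\ (\sigma_h,\eta)_{\mathcal T_E}&=0,\\ \langle\widehat\sigma_h\boldsymbol n,\boldsymbol\mu\rangle_{\partial\mathcal T_E\setminus\Gamma}&=0,\\ (\boldsymbol q_h,\boldsymbol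 r)_{\mathcal T_A}+(v_h,\nabla\cdot\boldsymbol r)_{\mathcal T_A}-\langle\widehat v_h,\boldsymbol r\cdot\boldsymbol n\rangle_{\partial\mathcal T_A}&=0,\\ (\boldsymbol q_h,\nabla w)_{\mathcal T_A}-\langle\widehat{\boldsymbol q}_h\cdot\boldsymbol n,w\rangle_{\partial\mathcal T_A}+(s/c)^2(v_h,w)_{\mathcal T_A}&=(f,w)_{\mathcal T_A},\\ \langle\widehat{\boldsymbol q}_h\cdot\boldsymbol n,\xi\rangle_{\partial\mathcal T_A\setminus(\Gamma\cup\Gamma_A^D)}&=\langle g_N,\xi\rangle_{\Gamma_A^N},\\ \langle\widehat v_h,\xi\rangle_{\Gamma_A^D}&=\langle g_D,\xi\rangle_{\Gamma_A^D},\\ \langle\widehat{\boldsymbol q}_h\cdot\boldsymbol n_A-s\,\widehat{\boldsymbol u}_h\cdot\boldsymbol n_E,\xi\rangle_\Gamma&=-\langle\nabla v^{\rm inc}\cdot\boldsymbol n_A,\xi\rangle_\Gamma,\\ \langle-\widehat\sigma_h\boldsymbol n_E+\rho_fs\,\widehat v_h\boldsymbol n_A,\boldsymbol\mu\rangle_\Gamma&=-\rho_fs\langle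 v^{\rm inc}\boldsymbol n_A,\boldsymbol\mu\rangle_\Gamma, \end{aligned}$$ where $\widehat\sigma_h\boldsymbol n:=\sigma_h\boldsymbol n-\tau_E(\boldsymbol u_h-\widehat{\boldsymbol u}_h)$ on $\partial\mathcal T_E$ and $\widehat{\boldsymbol q}_h\cdot\boldsymbol n:=\boldsymbol q_h\cdot\boldsymbol n-\tau_A(v_h-\widehat v_h)$ on $\partial\mathcal T_A$. **Theorem.** If $\operatorname{Re}(s\,\overline{\tau_A})>0$ and $\operatorname{Re}(s\,\overline{\tau_E})>0$ almost everywhere on the boundaries of the elements (for real-valued parameters: $\operatorname{Re}(s\tau_A)>0$ and $\operatorname{Re}(s\tau_E)>0$), then for all data as above the scheme has exactly one solution. -/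

import Mathlib

noncomputable section

open scoped Classical
open MeasureTheory MvPolynomial

namespace HDG

/-- The space `ℝⁿ` with its Euclidean norm. -/
abbrev E (n : ℕ) := EuclideanSpace ℝ (Fin n)

/-- Polynomials in `n` variables with complex coefficients. An element has interior points, so a
polynomial function on an element is the same thing as a polynomial. -/
abbrev Poly (n : ℕ) := MvPolynomial (Fin n) ℂ

/-- Matrices with polynomial entries. -/
abbrev MatPoly (n : ℕ) := Matrix (Fin n) (Fin n) (Poly n)

/-- Value of a polynomial at a point of `ℝⁿ`. -/
def ev {n : ℕ} (p : Poly n) (x : E n) : ℂ := MvPolynomial.eval (fun j => (x j : ℂ)) p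

/-- Value of a vector of polynomials. -/
def evV {n : ℕ} (p : Fin n → Poly n) (x : E n) : Fin n → ℂ := fun i => ev (p i) x

/-- Value of a matrix of polynomials. -/
def evM {n : ℕ} (p : MatPoly n) (x : E n) : Matrix (Fin n) (Fin n) ℂ := fun i j => ev (p i j) x

/-! ### Simplices, faces, normals -/

/-- A (nondegenerate) `n`-simplex of `ℝⁿ`, given by its set of vertices. -/
@[ext]
structure Cell (n : ℕ) where
  verts : Finset (E n)
  card_verts : verts.card = n + 1
  indep : AffineIndependent ℝ ((↑) : verts → E n)

namespace Cell

variable {n : ℕ} (K : Cell n)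

/-- The closed simplex as a subset of `ℝⁿ`. -/
def body : Set (E n) := convexHull ℝ (K.verts : Set (E n))

/-- The vertices form an affine basis of `ℝⁿ`. -/
def basis : AffineBasis K.verts ℝ (E n) :=
  ⟨(↑), K.indep, by
    rw [K.indep.affineSpan_eq_top_iff_card_eq_finrank_add_one]
    simp [K.card_verts]⟩

/-- The set of vertices of the face opposite to the vertex `v`. -/
def face (v : K.verts) : Finset (E n) := K.verts.erase v

/-- The barycentric coordinate that belongs to the face opposite to `v`: it vanishes on that face
and is `1` at `v`. -/
def bary (v : K.verts) : E n →ᵃ[ℝ] ℝ := K.basis.coord v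

/-- The (constant) gradient of the barycentric coordinate. -/
def gradBary (v : K.verts) : Fin n → ℝ :=
  fun j => (K.bary v).linear (EuclideanSpace.single j 1)

/-- The barycentric coordinate as a polynomial. -/
def baryPoly (v : K.verts) : Poly n :=
  C ((K.bary v 0 : ℝ) : ℂ) + ∑ j, C ((K.gradBary v j : ℝ) : ℂ) * X j

/-- The outward unit normal `n_K` on the face opposite to `v`. -/
def normal (v : K.verts) : Fin n → ℝ :=
  fun j => -(K.gradBary v j) / Real.sqrt (∑ i, K.gradBary v i ^ 2)

end Cell

/-- The set of all faces (given by their vertices) of the elements of `T`. -/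
def faces {n : ℕ} (T : Finset (Cell n)) : Set (Finset (E n)) :=
  {F | ∃ K ∈ T, ∃ v : K.verts, F = K.face v}

/-- A pair of conforming simplicial meshes of the (closures of the) elastic region `Ω_E` and of the
acoustic region `Ω_A`, compatible along their common interface, such that the whole boundary of the
elastic region is the interface, and with the outer boundary of the acoustic region split, face by
face, into a Dirichlet and a Neumann part. -/
structure CoupledMesh (n : ℕ) where
  /-- the elements of the elastic region -/
  TE : Finset (Cell n)
  /-- the elements of the acoustic region -/
  TA : Finset (Cell n)
  disj : Disjoint TE TA
  /-- two simplices meet in the common (possibly empty) face spanned by their common vertices -/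
  conforming : ∀ K ∈ TE ∪ TA, ∀ L ∈ TE ∪ TA,
    K.body ∩ L.body ⊆ convexHull ℝ ((K.verts ∩ L.verts : Finset (E n)) : Set (E n))
  /-- behind every face of an elastic element there is another element, elastic or acoustic -/
  enclosed : ∀ K ∈ TE, ∀ v : K.verts, ∃ L ∈ TE ∪ TA, L ≠ K ∧ K.face v ⊆ L.verts
  /-- the faces on `Γ_A^D` -/
  dirichlet : Set (Finset (E n))
  /-- they are faces of exactly one acoustic element and of no elastic one -/
  dirichlet_outer : ∀ F ∈ dirichlet, F ∈ faces TA ∧ F ∉ faces TE ∧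
    ∀ K ∈ TA, ∀ L ∈ TA, F ⊆ K.verts → F ⊆ L.verts → K = L

namespace CoupledMesh

variable {n : ℕ} (M : CoupledMesh n)

/-- The faces on the interface `Γ`. -/
def interface : Set (Finset (E n)) := faces M.TE ∩ faces M.TA

/-- The faces on the artificial boundary `Γ_A`: faces of exactly one acoustic element and of no
elastic one. -/
def outer : Set (Finset (E n)) :=
  {F | F ∈ faces M.TA ∧ F ∉ faces M.TE ∧
    ∀ K ∈ M.TA, ∀ L ∈ M.TA, F ⊆ K.verts → F ⊆ L.verts → K = L}

/-- The faces on `Γ_A^N`. -/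
def neumann : Set (Finset (E n)) := M.outer \ M.dirichlet

end CoupledMesh

/-- The closed region covered by a mesh. -/
def region {n : ℕ} (T : Finset (Cell n)) : Set (E n) := ⋃ K ∈ T, K.body

/-- The hypersurface covered by a set of faces. -/
def surface {n : ℕ} (P : Set (Finset (E n))) : Set (E n) :=
  ⋃ F ∈ P, convexHull ℝ (F : Set (E n))

/-! ### Integrals over the elements and over their boundaries -/

/-- `∑_{K ∈ T} ∫_K g`. -/
def volInt {n : ℕ} (T : Finset (Cell n)) (g : Cell n → E n → ℂ) : ℂ :=
  ∑ K ∈ T, ∫ x in K.body, g K x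

/-- `∑_{K ∈ T} ∑_F ∫_F g`, where `F` runs through the faces of `K` that belong to `P`; the surface
measure is the Euclidean `(n-1)`-dimensional Hausdorff measure. The integrand may depend on the
element and, through the opposite vertex, on its face. -/
def bdryInt {n : ℕ} (T : Finset (Cell n)) (P : Set (Finset (E n)))
    (g : (K : Cell n) → K.verts → E n → ℂ) : ℂ :=
  ∑ K ∈ T, ∑ v : K.verts,
    if K.face v ∈ P then
      ∫ x in convexHull ℝ (K.face v : Set (E n)), g K v x ∂(Measure.euclideanHausdorffMeasure (n - 1))
    else 0

/-- `a · b̄` for vectors. -/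
def dotC {n : ℕ} (a b : Fin n → ℂ) : ℂ := ∑ i, a i * (starRingEnd ℂ) (b i)

/-- `A : B̄` for matrices. -/
def frobC {n : ℕ} (A B : Matrix (Fin n) (Fin n) ℂ) : ℂ :=
  ∑ i, ∑ j, A i j * (starRingEnd ℂ) (B i j)

/-- The bilinear product of a complex vector and a real one (a normal vector). -/
def dotN {n : ℕ} (a : Fin n → ℂ) (ν : Fin n → ℝ) : ℂ := ∑ i, a i * (ν i : ℂ)

/-- A complex matrix applied to a real vector (a normal vector). -/
def mulN {n : ℕ} (A : Matrix (Fin n) (Fin n) ℂ) (ν : Fin n → ℝ) : Fin n → ℂ :=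
  fun i => ∑ j, A i j * (ν j : ℂ)

/-! ### Differential operators -/

/-- Gradient of a scalar. -/
def grad {n : ℕ} (w : Poly n) : Fin n → Poly n := fun j => pderiv j w

/-- Gradient of a vector, `(∇ t)_{ij} = ∂_j t_i`. -/
def gradV {n : ℕ} (t : Fin n → Poly n) : MatPoly n := fun i j => pderiv j (t i)

/-- Divergence of a vector. -/
def divV {n : ℕ} (r : Fin n → Poly n) : Poly n := ∑ j, pderiv j (r j)

/-- Row-wise divergence of a matrix. -/
def divM {n : ℕ} (τ : MatPoly n) : Fin n → Poly n := fun i => ∑ j, pderiv j (τ i j)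

/-- The curl of a 2×2 matrix, a vector. -/
def curlMat2 (A : MatPoly 2) : Fin 2 → Poly 2 :=
  fun i => pderiv 0 (A i 1) - pderiv 1 (A i 0)

/-- The curl of a vector in two dimensions, a matrix. -/
def curlVec2 (m : Fin 2 → Poly 2) : MatPoly 2 :=
  fun i => ![-pderiv 1 (m i), pderiv 0 (m i)]

/-- The row-wise curl of a 3×3 matrix. -/
def curlMat3 (A : MatPoly 3) : MatPoly 3 :=
  fun i => ![pderiv 1 (A i 2) - pderiv 2 (A i 1),
             pderiv 2 (A i 0) - pderiv 0 (A i 2),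
             pderiv 0 (A i 1) - pderiv 1 (A i 0)]

/-! ### Local spaces -/

/-- Polynomials of degree at most `k`. -/
def polyK (n k : ℕ) : Submodule ℂ (Poly n) := restrictTotalDegree (Fin n) ℂ k

/-- Vectors of polynomials of degree at most `k`. -/
def polyVK (n k : ℕ) : Submodule ℂ (Fin n → Poly n) where
  carrier := {t | ∀ i, t i ∈ polyK n k}
  add_mem' ha hb i := add_mem (ha i) (hb i)
  zero_mem' _ := zero_mem _
  smul_mem' c _ h i := Submodule.smul_mem _ c (h i)

/-- Matrices of polynomials of degree at most `k`. -/
def polyMK (n k : ℕ) : Submodule ℂ (MatPoly n) where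
  carrier := {τ | ∀ i j, τ i j ∈ polyK n k}
  add_mem' ha hb i j := add_mem (ha i j) (hb i j)
  zero_mem' _ _ := zero_mem _
  smul_mem' c _ h i j := Submodule.smul_mem _ c (h i j)

/-- Skew-symmetric matrices of polynomials of degree at most `k`. -/
def skewK (n k : ℕ) : Submodule ℂ (MatPoly n) where
  carrier := {η | (∀ i j, η i j ∈ polyK n k) ∧ ∀ i j, η i j = -η j i}
  add_mem' ha hb := ⟨fun i j => add_mem (ha.1 i j) (hb.1 i j), fun i j => by
    simp only [Matrix.add_apply]
    rw [ha.2 i j, hb.2 i j]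
    ring⟩
  zero_mem' := ⟨fun _ _ => zero_mem _, fun _ _ => by simp⟩
  smul_mem' c _ h := ⟨fun i j => Submodule.smul_mem _ c (h.1 i j), fun i j => by
    simp only [Matrix.smul_apply]
    rw [h.2 i j, smul_neg]⟩

/-- The scalar bubble of a triangle: the product of the barycentric coordinates. -/
def bubble2 (K : Cell 2) : Poly 2 := ∏ v : K.verts, K.baryPoly v

/-- The matrix bubble of a tetrahedron,
`∑_F (∏_{F' ≠ F} η_{F'}) ∇η_F ⊗ ∇η_F`. -/
def bubble3 (K : Cell 3) : MatPoly 3 := fun i j =>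
  ∑ v : K.verts, (∏ w ∈ Finset.univ.erase v, K.baryPoly w) *
    (C ((K.gradBary v i : ℝ) : ℂ) * C ((K.gradBary v j : ℝ) : ℂ))

/-- `A ↦ ∇ × ((∇ × A) b_K)` for `n = 2`. -/
def bubbleMap2 (K : Cell 2) : MatPoly 2 →ₗ[ℂ] MatPoly 2 where
  toFun A := curlVec2 (fun i => curlMat2 A i * bubble2 K)
  map_add' A B := by
    refine Matrix.ext fun i j => ?_
    fin_cases j <;> simp [curlVec2, curlMat2] <;> ring
  map_smul' c A := by
    refine Matrix.ext fun i j => ?_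
    fin_cases j <;> simp [curlVec2, curlMat2, MvPolynomial.smul_eq_C_mul] <;> ring

/-- `A ↦ ∇ × ((∇ × A) b_K)` for `n = 3`. -/
def bubbleMap3 (K : Cell 3) : MatPoly 3 →ₗ[ℂ] MatPoly 3 where
  toFun A := curlMat3 (curlMat3 A * bubble3 K)
  map_add' A B := by
    have h1 : ∀ A B : MatPoly 3, curlMat3 (A + B) = curlMat3 A + curlMat3 B := by
      intro A B
      refine Matrix.ext fun i j => ?_
      fin_cases j <;> simp [curlMat3] <;> ring
    rw [h1, Matrix.add_mul, h1]
  map_smul' c A := by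
    have h1 : ∀ (c : ℂ) (A : MatPoly 3), curlMat3 (c • A) = c • curlMat3 A := by
      intro c A
      refine Matrix.ext fun i j => ?_
      fin_cases j <;> simp [curlMat3, smul_sub]
    rw [h1, Matrix.smul_mul, h1]
    rfl

/-- The bubble space `∇ × ((∇ × A(K)) b_K)`; it is used for `n = 2` and `n = 3` only. -/
def bubbleSpace : (n k : ℕ) → Cell n → Submodule ℂ (MatPoly n)
  | 2, k, K => (skewK 2 k).map (bubbleMap2 K)
  | 3, k, K => (skewK 3 k).map (bubbleMap3 K)
  | _, _, _ => ⊥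

/-- The local stress space: matrices of polynomials of degree at most `k` plus bubbles. -/
def stressK (n k : ℕ) (K : Cell n) : Submodule ℂ (MatPoly n) := polyMK n k ⊔ bubbleSpace n k K

/-- A function on the face spanned by `F`, extended by zero to `ℝⁿ`, that is a polynomial of degree
at most `k` on the face. -/
def IsFacePoly {n : ℕ} (k : ℕ) (F : Finset (E n)) (ξ : E n → ℂ) : Prop :=
  ∃ p ∈ polyK n k, ξ = (convexHull ℝ (F : Set (E n))).indicator (ev p)

/-! ### The discrete scheme -/

/-- Candidates for the discrete solution, and tuples of test functions. Piecewise polynomials are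
families of polynomials indexed by elements; traces are families of functions indexed by faces. -/
@[ext]
structure Fields (n : ℕ) where
  /-- stress `σ_h` -/
  stress : Cell n → MatPoly n
  /-- displacement `u_h` -/
  disp : Cell n → Fin n → Poly n
  /-- rotation `γ_h` -/
  rot : Cell n → MatPoly n
  /-- trace `û_h` of the displacement -/
  dispTrace : Finset (E n) → Fin n → E n → ℂ
  /-- acoustic velocity `q_h` -/
  vel : Cell n → Fin n → Poly n
  /-- acoustic potential `v_h` -/
  pot : Cell n → Poly n
  /-- trace `v̂_h` of the potential -/
  potTrace : Finset (E n) → E n → ℂ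

/-- Membership in the product of the seven discrete spaces of degree `k` on the mesh `M`. Families
are extended by zero to the simplices and faces that do not belong to the mesh. -/
structure InSpace {n : ℕ} (M : CoupledMesh n) (k : ℕ) (U : Fields n) : Prop where
  stress_mem : ∀ K ∈ M.TE, U.stress K ∈ stressK n k K
  stress_zero : ∀ K ∉ M.TE, U.stress K = 0
  disp_mem : ∀ K ∈ M.TE, U.disp K ∈ polyVK n k
  disp_zero : ∀ K ∉ M.TE, U.disp K = 0
  rot_mem : ∀ K ∈ M.TE, U.rot K ∈ skewK n k
  rot_zero : ∀ K ∉ M.TE, U.rot K = 0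
  dispTrace_mem : ∀ F ∈ faces M.TE, ∀ i, IsFacePoly k F (U.dispTrace F i)
  dispTrace_zero : ∀ F ∉ faces M.TE, U.dispTrace F = 0
  vel_mem : ∀ K ∈ M.TA, U.vel K ∈ polyVK n k
  vel_zero : ∀ K ∉ M.TA, U.vel K = 0
  pot_mem : ∀ K ∈ M.TA, U.pot K ∈ polyK n k
  pot_zero : ∀ K ∉ M.TA, U.pot K = 0
  potTrace_mem : ∀ F ∈ faces M.TA, IsFacePoly k F (U.potTrace F)
  potTrace_zero : ∀ F ∉ faces M.TA, U.potTrace F = 0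

/-- Physical constants, the Laplace parameter and the stabilization functions; `tauE K` and `tauA K`
are functions on the boundary of the element `K`. -/
structure Params (n : ℕ) where
  lam : ℝ
  mu : ℝ
  rhoE : ℝ
  rhoF : ℝ
  c : ℝ
  s : ℂ
  tauE : Cell n → E n → ℂ
  tauA : Cell n → E n → ℂ

/-- The data: sources, boundary data on the artificial boundary, and the values on the interface of
the incident field and of its gradient. -/
structure Data (n : ℕ) where
  /-- elastic source -/
  fE : E n → Fin n → ℂ
  /-- acoustic source -/
  fA : E n → ℂ
  gD : E n → ℂ
  gN : E n → ℂ
  vinc : E n → ℂ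
  gradVinc : E n → Fin n → ℂ

/-- The action of the inverse of Hooke's tensor. -/
def hookeInv {n : ℕ} (P : Params n) (A : Matrix (Fin n) (Fin n) ℂ) : Matrix (Fin n) (Fin n) ℂ :=
  ((1 / (2 * P.mu) : ℝ) : ℂ) • A -
    (((P.lam / (2 * P.mu * (n * P.lam + 2 * P.mu)) : ℝ) : ℂ) * A.trace) •
      (1 : Matrix (Fin n) (Fin n) ℂ)

/-- The numerical flux `σ̂_h n = σ_h n - τ_E (u_h - û_h)` on the face of `K` opposite to `v`. -/
def elFlux {n : ℕ} (P : Params n) (U : Fields n) (K : Cell n) (v : K.verts) (x : E n) :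
    Fin n → ℂ := fun i =>
  mulN (evM (U.stress K) x) (K.normal v) i
    - P.tauE K x * (ev (U.disp K i) x - U.dispTrace (K.face v) i x)

/-- The numerical flux `q̂_h · n = q_h · n - τ_A (v_h - v̂_h)` on the face of `K` opposite to `v`. -/
def acFlux {n : ℕ} (P : Params n) (U : Fields n) (K : Cell n) (v : K.verts) (x : E n) : ℂ :=
  dotN (evV (U.vel K) x) (K.normal v) - P.tauA K x * (ev (U.pot K) x - U.potTrace (K.face v) x)

/-- `U` solves the HDG scheme of degree `k`: the ten groups of equations hold for all test
functions `T`. On `Γ`, the normals `n_E` and `n_A` are the outward normals of the adjacent elastic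
and acoustic elements. -/
structure IsSolution {n : ℕ} (M : CoupledMesh n) (k : ℕ) (P : Params n) (d : Data n)
    (U : Fields n) : Prop where
  mem : InSpace M k U
  hooke : ∀ T, InSpace M k T →
    volInt M.TE (fun K x => frobC (hookeInv P (evM (U.stress K) x)) (evM (T.stress K) x))
    + volInt M.TE (fun K x => dotC (evV (U.disp K) x) (evV (divM (T.stress K)) x))
    + volInt M.TE (fun K x => frobC (evM (U.rot K) x) (evM (T.stress K) x))
    - bdryInt M.TE Set.univ (fun K v x => dotC (fun i => U.dispTrace (K.face v) i x)
        (mulN (evM (T.stress K) x) (K.normal v))) = 0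
  momentum : ∀ T, InSpace M k T →
    volInt M.TE (fun K x => frobC (evM (U.stress K) x) (evM (gradV (T.disp K)) x))
    - bdryInt M.TE Set.univ (fun K v x => dotC (elFlux P U K v x) (evV (T.disp K) x))
    + P.rhoE * P.s ^ 2 * volInt M.TE (fun K x => dotC (evV (U.disp K) x) (evV (T.disp K) x))
      = volInt M.TE (fun K x => dotC (d.fE x) (evV (T.disp K) x))
  symmetry : ∀ T, InSpace M k T →
    volInt M.TE (fun K x => frobC (evM (U.stress K) x) (evM (T.rot K) x)) = 0
  elContinuity : ∀ T, InSpace M k T →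
    bdryInt M.TE M.interfaceᶜ (fun K v x => dotC (elFlux P U K v x)
      (fun i => T.dispTrace (K.face v) i x)) = 0
  velocity : ∀ T, InSpace M k T →
    volInt M.TA (fun K x => dotC (evV (U.vel K) x) (evV (T.vel K) x))
    + volInt M.TA (fun K x => ev (U.pot K) x * (starRingEnd ℂ) (ev (divV (T.vel K)) x))
    - bdryInt M.TA Set.univ (fun K v x => U.potTrace (K.face v) x *
        (starRingEnd ℂ) (dotN (evV (T.vel K) x) (K.normal v))) = 0
  wave : ∀ T, InSpace M k T →
    volInt M.TA (fun K x => dotC (evV (U.vel K) x) (evV (grad (T.pot K)) x))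
    - bdryInt M.TA Set.univ (fun K v x => acFlux P U K v x * (starRingEnd ℂ) (ev (T.pot K) x))
    + (P.s / P.c) ^ 2 * volInt M.TA (fun K x => ev (U.pot K) x * (starRingEnd ℂ) (ev (T.pot K) x))
      = volInt M.TA (fun K x => d.fA x * (starRingEnd ℂ) (ev (T.pot K) x))
  acContinuity : ∀ T, InSpace M k T →
    bdryInt M.TA (M.interface ∪ M.dirichlet)ᶜ (fun K v x => acFlux P U K v x *
      (starRingEnd ℂ) (T.potTrace (K.face v) x))
      = bdryInt M.TA M.neumann (fun K v x => d.gN x * (starRingEnd ℂ) (T.potTrace (K.face v) x))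
  dirichletBC : ∀ T, InSpace M k T →
    bdryInt M.TA M.dirichlet (fun K v x => U.potTrace (K.face v) x *
      (starRingEnd ℂ) (T.potTrace (K.face v) x))
      = bdryInt M.TA M.dirichlet (fun K v x => d.gD x * (starRingEnd ℂ) (T.potTrace (K.face v) x))
  kinematic : ∀ T, InSpace M k T →
    bdryInt M.TA M.interface (fun K v x => acFlux P U K v x *
      (starRingEnd ℂ) (T.potTrace (K.face v) x))
    - bdryInt M.TE M.interface (fun K v x =>
        P.s * dotN (fun i => U.dispTrace (K.face v) i x) (K.normal v) *
          (starRingEnd ℂ) (T.potTrace (K.face v) x))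
      = - bdryInt M.TA M.interface (fun K v x => dotN (d.gradVinc x) (K.normal v) *
          (starRingEnd ℂ) (T.potTrace (K.face v) x))
  dynamic : ∀ T, InSpace M k T →
    - bdryInt M.TE M.interface (fun K v x => dotC (elFlux P U K v x)
        (fun i => T.dispTrace (K.face v) i x))
    + bdryInt M.TA M.interface (fun K v x => dotC
        (fun i => P.rhoF * P.s * U.potTrace (K.face v) x * (K.normal v i : ℂ))
        (fun i => T.dispTrace (K.face v) i x))
      = - (P.rhoF * P.s) * bdryInt M.TA M.interface (fun K v x => dotC
        (fun i => d.vinc x * (K.normal v i : ℂ)) (fun i => T.dispTrace (K.face v) i x))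

/-- All data are square integrable on the sets where the scheme uses them. -/
structure Data.SquareIntegrable {n : ℕ} (M : CoupledMesh n) (d : Data n) : Prop where
  fE : MemLp d.fE 2 (volume.restrict (region M.TE))
  fA : MemLp d.fA 2 (volume.restrict (region M.TA))
  gD : MemLp d.gD 2 ((Measure.euclideanHausdorffMeasure (n - 1)).restrict (surface M.dirichlet))
  gN : MemLp d.gN 2 ((Measure.euclideanHausdorffMeasure (n - 1)).restrict (surface M.neumann))
  vinc : MemLp d.vinc 2
    ((Measure.euclideanHausdorffMeasure (n - 1)).restrict (surface M.interface))
  gradVinc : MemLp d.gradVinc 2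
    ((Measure.euclideanHausdorffMeasure (n - 1)).restrict (surface M.interface))

/-- A stabilization function `tau` on the boundaries of the elements of `T` is integrable on every
face and satisfies `Re (s · conj tau) > 0` almost everywhere there. If `tau` is real valued, the
latter says `Re (s tau) > 0`. -/
def StabAdmissible {n : ℕ} (T : Finset (Cell n)) (s : ℂ) (tau : Cell n → E n → ℂ) : Prop :=
  ∀ K ∈ T, ∀ v : K.verts,
    IntegrableOn (tau K) (convexHull ℝ (K.face v : Set (E n)))
      (Measure.euclideanHausdorffMeasure (n - 1)) ∧
    ∀ᵐ x ∂((Measure.euclideanHausdorffMeasure (n - 1)).restrict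
      (convexHull ℝ (K.face v : Set (E n)))), 0 < (s * (starRingEnd ℂ) (tau K x)).re

end HDG

end

/-! Trial and test space coincide and are finite-dimensional, so the equations form a square linear
system and it suffices that zero data force the zero solution. To make this precise the ten groups
of equations are added to a single sesquilinear form `schemeForm`. Nothing is lost: a test tuple
with one nonzero component, a trace being cut down to one class of faces, isolates one equation
(`isSolution_iff`). The rank argument is `IsSesq.exists_solution`.

Uniqueness is an energy argument (`eq_zero_of_homogeneous`). Testing with the solution itself and
integrating by parts (`energy_identity`) leaves, with Y = ⟨û·n_E, v̂⟩_Γ, the two balances (C⁻¹σ, σ)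
+ ∫ τ_E |u - û|² + ρ_E s² ‖u‖² + ρ_f s Ȳ = 0 and ‖q‖² + ∫ τ_A |v - v̂|² + (s/c)² ‖v‖² - s Y = 0. In
s̄ times the first plus ρ_f s times the conjugate of the second the interface terms cancel, and the
real part is a sum of nonnegative terms because Re s > 0 and Re(s τ̄) > 0. Hence every term
vanishes. Positive definiteness of C⁻¹ kills σ; u, q and v vanish as well; the stabilization forces
the traces to agree with the vanishing interior values. The rotation is then killed by testing the
constitutive equation with τ = γ, which is allowed because A(K) ⊂ V(K). The bubbles enter only
through finite dimension.

Two geometric facts carry the argument. The divergence theorem for polynomials on a simplex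
(`Cell.setIntegral_pderiv`) is proved for edge directions, by Fubini and the fundamental theorem of
calculus along chords, and extended by linearity. The change of sides on the interface
(`CoupledMesh.bdryInt_interface_swap`) rests on conformity, which puts two elements with a common
face on opposite sides of it. -/

noncomputable section

open scoped Classical
open MeasureTheory MvPolynomial

namespace HDG

/-! ### Barycentric coordinates, facets and gradients of a simplex -/

namespace Cell

variable {n : ℕ} (K : Cell n)

/-- The gradient of a barycentric coordinate as a vector of `ℝⁿ`. -/
def gradVec (v : K.verts) : E n := WithLp.toLp 2 (K.gradBary v)

@[simp] lemma basis_apply (v : K.verts) : K.basis v = (v : E n) := rfl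

lemma bary_self (v : K.verts) : K.bary v v = 1 := K.basis.coord_apply_eq v

lemma bary_ne {v w : K.verts} (h : v ≠ w) : K.bary v w = 0 := K.basis.coord_apply_ne h

lemma bary_linear (v : K.verts) (y : E n) : (K.bary v).linear y = inner ℝ (K.gradVec v) y := by
  have hy : y = ∑ j, y j • EuclideanSpace.single j (1 : ℝ) := by
    ext i
    simp [Finset.sum_apply, Pi.single_apply]
  conv_lhs => rw [hy]
  rw [map_sum, PiLp.inner_apply]
  refine Finset.sum_congr rfl fun j _ => ?_
  simp [gradVec, gradBary]

lemma bary_add (v : K.verts) (x y : E n) :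
    K.bary v (x + y) = K.bary v x + inner ℝ (K.gradVec v) y := by
  rw [← bary_linear, add_comm x y, ← vadd_eq_add, AffineMap.map_vadd, vadd_eq_add, add_comm]

lemma bary_add_smul (v : K.verts) (x y : E n) (t : ℝ) :
    K.bary v (x + t • y) = K.bary v x + t * inner ℝ (K.gradVec v) y := by
  rw [bary_add, inner_smul_right]

lemma inner_gradVec_sub (v : K.verts) (x y : E n) :
    inner ℝ (K.gradVec v) (x - y) = K.bary v x - K.bary v y := by
  have := K.bary_add v y (x - y)
  rw [add_sub_cancel] at this
  linarith

lemma continuous_bary (v : K.verts) : Continuous (K.bary v) :=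
  continuous_barycentric_coord K.basis v

lemma sum_bary (x : E n) : ∑ v, K.bary v x = 1 := K.basis.sum_coord_apply_eq_one x

lemma sum_bary_smul (x : E n) : ∑ v, K.bary v x • (v : E n) = x :=
  K.basis.linear_combination_coord_eq_self x

lemma mem_body {x : E n} : x ∈ K.body ↔ ∀ v, 0 ≤ K.bary v x := by
  have h := K.basis.convexHull_eq_nonneg_coord
  have hr : Set.range K.basis = (K.verts : Set (E n)) := Subtype.range_coe
  rw [hr] at h
  rw [body, h]
  rfl

lemma isCompact_body : IsCompact K.body :=
  (K.verts.finite_toSet).isCompact_convexHull ℝ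

/-- The closed face opposite to `v`. -/
def facet (v : K.verts) : Set (E n) := convexHull ℝ (K.face v : Set (E n))

lemma isCompact_facet (v : K.verts) : IsCompact (K.facet v) :=
  ((K.face v).finite_toSet).isCompact_convexHull ℝ

lemma facet_subset_body (v : K.verts) : K.facet v ⊆ K.body :=
  convexHull_mono (Finset.coe_subset.2 (Finset.erase_subset _ _))

lemma mem_face {v w : K.verts} : (w : E n) ∈ K.face v ↔ w ≠ v := by
  rw [face, Finset.mem_erase, ne_eq, ne_eq, Subtype.ext_iff]
  exact and_iff_left w.2

/-- The zero set of the opposite coordinate is convex and contains the vertices of the face;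
conversely, once that coordinate vanishes, the others are convex weights on these vertices. -/
lemma mem_facet {v : K.verts} {x : E n} :
    x ∈ K.facet v ↔ K.bary v x = 0 ∧ ∀ w, 0 ≤ K.bary w x := by
  constructor
  · intro hx
    refine ⟨?_, K.mem_body.1 (K.facet_subset_body v hx)⟩
    have hc : Convex ℝ {y : E n | K.bary v y = 0} := by
      have : {y : E n | K.bary v y = 0} = (K.bary v) ⁻¹' {0} := rfl
      rw [this]
      exact (convex_singleton (0 : ℝ)).affine_preimage (K.bary v)
    refine convexHull_min ?_ hc hx
    intro y hy
    have hy' : y ∈ K.verts ∧ y ≠ v := by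
      have := Finset.mem_coe.1 hy
      rw [face, Finset.mem_erase] at this
      exact ⟨this.2, this.1⟩
    exact K.bary_ne (v := v) (w := ⟨y, hy'.1⟩) (fun h => hy'.2 (by rw [h]))
  · rintro ⟨h0, h⟩
    have hs : ∑ w ∈ Finset.univ.erase v, K.bary w x = 1 := by
      rw [← K.sum_bary x, ← Finset.add_sum_erase _ _ (Finset.mem_univ v), h0, zero_add]
    have hx : x = ∑ w ∈ Finset.univ.erase v, K.bary w x • (w : E n) := by
      conv_lhs => rw [← K.sum_bary_smul x, ← Finset.add_sum_erase _ _ (Finset.mem_univ v), h0,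
        zero_smul, zero_add]
    rw [hx]
    refine (convex_convexHull ℝ _).sum_mem (fun w _ => h w) hs fun w hw => ?_
    exact subset_convexHull ℝ _ (K.mem_face.2 (Finset.ne_of_mem_erase hw))

lemma exists_ne (hn : 0 < n) (v : K.verts) : ∃ w : K.verts, w ≠ v := by
  have : Nontrivial K.verts := by
    rw [← Fintype.one_lt_card_iff_nontrivial, Fintype.card_coe, K.card_verts]
    lia
  exact _root_.exists_ne v

/-- The gradients pair with an edge `v - w` to 1 at `v`, to -1 at `w` and to 0 elsewhere. These
three numbers drive the divergence theorem. -/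
lemma inner_gradVec_edge_self {v w : K.verts} (h : v ≠ w) :
    inner ℝ (K.gradVec v) ((v : E n) - w) = 1 := by
  rw [inner_gradVec_sub, bary_self, bary_ne K h, sub_zero]

lemma inner_gradVec_edge_other {v w : K.verts} (h : v ≠ w) :
    inner ℝ (K.gradVec w) ((v : E n) - w) = -1 := by
  rw [inner_gradVec_sub, bary_self, bary_ne K h.symm, zero_sub]

lemma inner_gradVec_edge_ne {v w i : K.verts} (hv : i ≠ v) (hw : i ≠ w) :
    inner ℝ (K.gradVec i) ((v : E n) - w) = 0 := by
  rw [inner_gradVec_sub, bary_ne K hv, bary_ne K hw, sub_zero]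

lemma gradVec_ne_zero (hn : 0 < n) (v : K.verts) : K.gradVec v ≠ 0 := by
  obtain ⟨w, hw⟩ := K.exists_ne hn v
  intro h
  have := K.inner_gradVec_edge_self hw.symm
  simp [h] at this

lemma normal_eq (v : K.verts) (j : Fin n) :
    K.normal v j = -(‖K.gradVec v‖⁻¹ * K.gradVec v j) := by
  rw [normal, EuclideanSpace.norm_eq]
  simp [gradVec, div_eq_inv_mul]

end Cell

/-! ### Disintegration of the Lebesgue measure along a direction transversal to a hyperplane -/

section Disintegration

variable {n : ℕ}

/-- Moving by `u` raises the product with `a` by one, so the hyperplanes at parameters 0 and 1 are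
`‖a‖⁻¹` apart. Splitting `u` into a part along `a` and a part in the hyperplane reduces the skew
coordinates to orthogonal ones by a shear. -/
lemma measurePreserving_hyperplane_prod (p a u : E n) (hu : inner ℝ a u = 1) :
    MeasurePreserving (fun z : ℝ × (ℝ ∙ a)ᗮ => p + (z.2 : E n) + z.1 • u)
      ((‖a‖ₑ⁻¹ • (volume : Measure ℝ)).prod volume) volume := by
  have ha : a ≠ 0 := by rintro rfl; simp at hu
  have ha' : ‖a‖ ≠ 0 := norm_ne_zero_iff.2 ha
  -- The orthogonal projection of `u` to the line of `a`; its length is `‖a‖⁻¹`.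
  set w : E n := (‖a‖ ^ 2)⁻¹ • a with hw
  have hwu : u - w ∈ (ℝ ∙ a)ᗮ := by
    rw [Submodule.mem_orthogonal_singleton_iff_inner_right, inner_sub_right, hu, hw,
      inner_smul_right, real_inner_self_eq_norm_sq, inv_mul_cancel₀ (by positivity), sub_self]
  have hwm : w ∈ ℝ ∙ a := Submodule.smul_mem _ _ (Submodule.mem_span_singleton_self a)
  set w' : (ℝ ∙ a) := ⟨w, hwm⟩
  set u' : (ℝ ∙ a)ᗮ := ⟨u - w, hwu⟩
  have hw0 : w' ≠ 0 := by
    intro h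
    have : w = 0 := congrArg Subtype.val h
    simp [hw, ha] at this
  have hnw : ‖w'‖ₑ = ‖a‖ₑ⁻¹ := by
    have h1 : ‖w'‖ = ‖a‖⁻¹ := by
      change ‖w‖ = _
      rw [hw, norm_smul, norm_inv, norm_pow, norm_norm]
      field_simp
    rw [← ofReal_norm, h1, ENNReal.ofReal_inv_of_pos (by positivity), ofReal_norm]
  have h1 : MeasurePreserving (fun t : ℝ => t • w') (‖a‖ₑ⁻¹ • volume) volume := by
    refine ⟨by fun_prop, ?_⟩
    have := volume_eq_of_finrank_eq_one (finrank_span_singleton (K := ℝ) ha) hw0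
    rw [Measure.map_smul, ← hnw]
    exact this.symm
  -- The shear: for fixed `t` it is a translation of the hyperplane.
  have h2 : MeasurePreserving (fun z : ℝ × (ℝ ∙ a)ᗮ => (z.1, z.2 + z.1 • u'))
      ((‖a‖ₑ⁻¹ • (volume : Measure ℝ)).prod volume)
      ((‖a‖ₑ⁻¹ • (volume : Measure ℝ)).prod volume) := by
    refine (MeasurePreserving.id _).skew_product (g := fun t y => y + t • u') (by fun_prop) ?_
    exact Filter.Eventually.of_forall fun t => map_add_right_eq_self _ _
  have h3 := h1.prod (MeasurePreserving.id (volume : Measure (ℝ ∙ a)ᗮ))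
  have h4 := ((ℝ ∙ a).measurePreserving_measurableEquivProd p).symm
  have h5 : (Measure.euclideanHausdorffMeasure (Module.finrank ℝ (E n)) : Measure (E n)) =
      volume := InnerProductSpace.euclideanHausdorffMeasure_eq_volume
  rw [h5] at h4
  have h6 := h4.comp (h3.comp h2)
  have h7 : (fun z : ℝ × (ℝ ∙ a)ᗮ => p + (z.2 : E n) + z.1 • u) =
      ((ℝ ∙ a).measurableEquivProd p).symm ∘ Prod.map (fun t => t • w') id ∘
        fun z => (z.1, z.2 + z.1 • u') := by
    funext z
    simp only [Function.comp, Prod.map, Submodule.measurableEquivProd_symm_apply, w', u']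
    simp only [vadd_eq_add, Submodule.coe_add, Submodule.coe_smul, id]
    rw [smul_sub]
    abel
  rw [h7]
  exact h6

/-- Isometric embeddings carry Hausdorff measure to Hausdorff measure restricted to the image, and
on the hyperplane, of dimension `n - 1`, it is Lebesgue measure. -/
lemma map_hyperplane (p a : E n) (ha : a ≠ 0) :
    Measure.map (fun y : (ℝ ∙ a)ᗮ => p + (y : E n)) volume =
      (Measure.euclideanHausdorffMeasure (n - 1)).restrict {x | inner ℝ a (x - p) = 0} := by
  have hf : Isometry (fun y : (ℝ ∙ a)ᗮ => p + (y : E n)) :=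
    (IsometryEquiv.addLeft p).isometry.comp isometry_subtype_coe
  have hr : Module.finrank ℝ (ℝ ∙ a)ᗮ = n - 1 := by
    have h := (ℝ ∙ a).finrank_add_finrank_orthogonal
    rw [finrank_span_singleton ha, finrank_euclideanSpace_fin] at h
    exact Nat.eq_sub_of_add_eq' h
  rw [← InnerProductSpace.euclideanHausdorffMeasure_eq_volume, hr,
    hf.map_euclideanHausdorffMeasure]
  congr 1
  ext x
  simp only [Set.mem_range, Set.mem_ofPred_eq]
  constructor
  · rintro ⟨y, rfl⟩
    rw [add_sub_cancel_left]
    exact Submodule.mem_orthogonal_singleton_iff_inner_right.1 y.2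
  · intro h
    exact ⟨⟨x - p, Submodule.mem_orthogonal_singleton_iff_inner_right.2 h⟩, by simp⟩

lemma measurableEmbedding_hyperplane (p a : E n) :
    MeasurableEmbedding (fun y : (ℝ ∙ a)ᗮ => p + (y : E n)) :=
  (measurableEmbedding_addLeft p).comp
    (MeasurableEmbedding.subtype_coe (Submodule.closed_of_finiteDimensional _).measurableSet)

end Disintegration

end HDG

end

noncomputable section

open scoped Classical
open MeasureTheory MvPolynomial

namespace HDG

/-! ### Evaluation of polynomials -/

section Ev

variable {n : ℕ}

@[simp] lemma ev_zero (x : E n) : ev 0 x = 0 := by simp [ev]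
@[simp] lemma ev_add (p q : Poly n) (x : E n) : ev (p + q) x = ev p x + ev q x := by simp [ev]
@[simp] lemma ev_mul (p q : Poly n) (x : E n) : ev (p * q) x = ev p x * ev q x := by simp [ev]
@[simp] lemma ev_C (c : ℂ) (x : E n) : ev (C c) x = c := by simp [ev]
@[simp] lemma ev_smul (c : ℂ) (p : Poly n) (x : E n) : ev (c • p) x = c * ev p x := by simp [ev]
@[simp] lemma ev_sum {ι : Type*} (s : Finset ι) (p : ι → Poly n) (x : E n) :
    ev (∑ i ∈ s, p i) x = ∑ i ∈ s, ev (p i) x := by simp [ev]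

lemma continuous_ev (p : Poly n) : Continuous (ev p) := by
  unfold ev
  exact (MvPolynomial.continuous_eval p).comp (by fun_prop)

/-- The polynomial with conjugate coefficients. -/
def conjPoly (p : Poly n) : Poly n := MvPolynomial.map (starRingEnd ℂ) p

/-- Points have real coordinates, so conjugation acts on the coefficients only. Products with a
conjugated test function thus remain polynomial. -/
lemma ev_conjPoly (p : Poly n) (x : E n) : ev (conjPoly p) x = (starRingEnd ℂ) (ev p x) := by
  have h : (fun j => ((x j : ℝ) : ℂ)) = (starRingEnd ℂ) ∘ fun j => ((x j : ℝ) : ℂ) := by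
    funext j
    simp
  rw [ev, ev, conjPoly, MvPolynomial.eval_map]
  conv_lhs => rw [h]
  exact MvPolynomial.eval₂_comp (starRingEnd ℂ) _ p |>.symm

lemma pderiv_conjPoly (j : Fin n) (p : Poly n) :
    pderiv j (conjPoly p) = conjPoly (pderiv j p) := pderiv_map

lemma hasDerivAt_ev_line (p : Poly n) (x d : E n) (t : ℝ) :
    HasDerivAt (fun t : ℝ => ev p (x + t • d))
      (∑ j, (d j : ℂ) * ev (pderiv j p) (x + t • d)) t := by
  induction p using MvPolynomial.induction_on with
  | C a => simpa using hasDerivAt_const t a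
  | add p q hp hq =>
    simp only [ev_add, map_add, mul_add, Finset.sum_add_distrib]
    exact hp.add hq
  | mul_X p i hp =>
    have hX : HasDerivAt (fun t : ℝ => ev (X i : Poly n) (x + t • d)) (d i : ℂ) t := by
      have h1 : HasDerivAt (fun t : ℝ => x i + t * d i) (d i) t := by
        simpa using ((hasDerivAt_id t).mul_const (d i)).const_add (x i)
      have h2 := h1.ofReal_comp
      simpa [ev] using h2
    have h := hp.mul hX
    simp only [ev_mul, Derivation.leibniz, pderiv_X, smul_eq_mul, ev_add]
    refine h.congr_deriv ?_
    simp only [mul_add, Finset.sum_add_distrib]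
    rw [Finset.sum_mul]
    refine (add_comm _ _).trans ?_
    congr 1
    · rw [Finset.sum_eq_single i]
      · simp [ev]; ring
      · intro j _ hj
        simp [hj.symm]
      · simp
    · exact Finset.sum_congr rfl fun j _ => by ring

/-- An open set contains a cube around each of its points, and a polynomial that vanishes on a
product of infinite sets is zero. -/
lemma eq_zero_of_ev_eq_zero_on_open {p : Poly n} {U : Set (E n)} (hU : IsOpen U) {x : E n}
    (hx : x ∈ U) (h : ∀ y ∈ U, ev p y = 0) : p = 0 := by
  have hc : Continuous (fun y : Fin n → ℝ => (WithLp.toLp 2 y : E n)) := by fun_prop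
  have hV : IsOpen ((fun y : Fin n → ℝ => (WithLp.toLp 2 y : E n)) ⁻¹' U) := hU.preimage hc
  obtain ⟨ε, hε, hb⟩ := Metric.isOpen_iff.1 hV (WithLp.ofLp x) (by simpa using hx)
  refine funext_set (fun i => ((↑) : ℝ → ℂ) '' Metric.ball (x i) ε) (fun i => ?_) fun y hy => ?_
  · refine Set.Infinite.image Complex.ofReal_injective.injOn ?_
    rw [Real.ball_eq_Ioo]
    exact Set.Ioo_infinite (by linarith)
  · choose z hz hzy using fun i => hy i (Set.mem_univ i)
    have := h (WithLp.toLp 2 z) (hb (by rw [ball_pi _ hε]; exact fun i _ => hz i))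
    simp only [ev, hzy] at this
    simpa using this

end Ev

namespace Cell

variable {n : ℕ} (K : Cell n)

/-! ### The measure on the facets -/

/-- The surface measure of `ℝⁿ`. -/
abbrev surf (n : ℕ) : Measure (E n) := Measure.euclideanHausdorffMeasure (n - 1)

lemma bary_zero_set {v w : K.verts} (h : w ≠ v) :
    {x : E n | inner ℝ (K.gradVec v) (x - w) = 0} = {x | K.bary v x = 0} := by
  ext x
  simp only [Set.mem_ofPred_eq, inner_gradVec_sub, K.bary_ne h.symm, sub_zero]

lemma measurableSet_bary_zero (v : K.verts) : MeasurableSet {x | K.bary v x = 0} :=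
  (isClosed_singleton.preimage (K.continuous_bary v)).measurableSet

lemma measurableSet_facet (v : K.verts) : MeasurableSet (K.facet v) :=
  (K.isCompact_facet v).measurableSet

lemma measurableSet_body : MeasurableSet K.body := K.isCompact_body.measurableSet

lemma facet_subset_zero (v : K.verts) : K.facet v ⊆ {x | K.bary v x = 0} :=
  fun _ hx => (K.mem_facet.1 hx).1

lemma restrict_bary_zero (hn : 0 < n) {v w : K.verts} (h : w ≠ v) :
    (surf n).restrict {x | K.bary v x = 0} =
      Measure.map (fun y : (ℝ ∙ K.gradVec v)ᗮ => (w : E n) + (y : E n)) volume := by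
  rw [map_hyperplane _ _ (K.gradVec_ne_zero hn v), K.bary_zero_set h]

/-- The surface measure is not locally finite on `ℝⁿ`, so compactness alone is not enough; within
the hyperplane of the facet it is Lebesgue measure, which is finite on compact sets. -/
lemma surf_facet_lt_top (hn : 0 < n) (v : K.verts) : surf n (K.facet v) < ⊤ := by
  obtain ⟨w, h⟩ := K.exists_ne hn v
  have h1 : surf n (K.facet v) = (surf n).restrict {x | K.bary v x = 0} (K.facet v) := by
    rw [Measure.restrict_apply (K.measurableSet_facet v),
      Set.inter_eq_left.2 (K.facet_subset_zero v)]
  rw [h1, K.restrict_bary_zero hn h, (measurableEmbedding_hyperplane _ _).map_apply]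
  have hc : Topology.IsClosedEmbedding
      (fun y : (ℝ ∙ K.gradVec v)ᗮ => (w : E n) + (y : E n)) :=
    (Homeomorph.addLeft (w : E n)).isClosedEmbedding.comp
      (Submodule.closed_of_finiteDimensional _).isClosedEmbedding_subtypeVal
  exact (hc.isCompact_preimage (K.isCompact_facet v)).measure_lt_top

/-- Fubini with one coordinate along `u` and the others in the hyperplane of a facet. This version
measures sets in `map_slide`; `integral_lines` serves the divergence theorem. -/
lemma lintegral_lines (hn : 0 < n) (v : K.verts) {u : E n} (hu : inner ℝ (K.gradVec v) u = 1)
    {g : E n → ENNReal} (hg : Measurable g) :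
    ∫⁻ x, g x = ‖K.gradVec v‖ₑ⁻¹ *
      ∫⁻ x in {x | K.bary v x = 0}, (∫⁻ t : ℝ, g (x + t • u)) ∂surf n := by
  obtain ⟨w, h⟩ := K.exists_ne hn v
  have hm := measurePreserving_hyperplane_prod (w : E n) _ u hu
  have h2 := lintegral_prod_symm (μ := ‖K.gradVec v‖ₑ⁻¹ • (volume : Measure ℝ))
    (ν := (volume : Measure (ℝ ∙ K.gradVec v)ᗮ))
    (fun z => g ((w : E n) + (z.2 : E n) + z.1 • u)) (hg.comp hm.measurable).aemeasurable
  rw [K.restrict_bary_zero hn h, (measurableEmbedding_hyperplane _ _).lintegral_map,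
    ← hm.lintegral_comp hg, h2, ← lintegral_const_mul' _ _ (by simp [K.gradVec_ne_zero hn v])]
  refine lintegral_congr fun y => ?_
  rw [lintegral_smul_measure, smul_eq_mul]

lemma integral_lines (hn : 0 < n) (v : K.verts) {u : E n} (hu : inner ℝ (K.gradVec v) u = 1)
    {g : E n → ℂ} (hg : Integrable g) :
    ∫ x, g x = ‖K.gradVec v‖⁻¹ •
      ∫ x in {x | K.bary v x = 0}, (∫ t : ℝ, g (x + t • u)) ∂surf n := by
  obtain ⟨w, h⟩ := K.exists_ne hn v
  have hm := measurePreserving_hyperplane_prod (w : E n) _ u hu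
  have h1 : ∫ x, g x = ∫ z, g ((w : E n) + (z.2 : E n) + z.1 • u)
      ∂((‖K.gradVec v‖ₑ⁻¹ • (volume : Measure ℝ)).prod
        (volume : Measure (ℝ ∙ K.gradVec v)ᗮ)) := by
    conv_lhs => rw [← hm.map_eq]
    exact integral_map hm.measurable.aemeasurable (by rw [hm.map_eq]; exact hg.1)
  have h2 : Integrable (fun z : ℝ × (ℝ ∙ K.gradVec v)ᗮ => g ((w : E n) + (z.2 : E n) + z.1 • u))
      ((‖K.gradVec v‖ₑ⁻¹ • (volume : Measure ℝ)).prod volume) :=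
    hm.integrable_comp_of_integrable hg
  rw [K.restrict_bary_zero hn h, (measurableEmbedding_hyperplane _ _).integral_map, h1,
    integral_prod_symm _ h2, ← integral_smul]
  refine integral_congr_ae (Filter.Eventually.of_forall fun y => ?_)
  simp only [integral_smul_measure]
  congr 1
  simp

/-! ### Sliding along an edge -/

/-- The translation along the edge direction `v - w` that takes the facet opposite to `v` to the
facet opposite to `w`. -/
def slide (v w : K.verts) (x : E n) : E n := x + K.bary w x • ((v : E n) - w)

lemma continuous_slide (v w : K.verts) : Continuous (K.slide v w) := by
  unfold slide
  have := K.continuous_bary w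
  fun_prop

/-- The coordinate of `w` drops by `t` along the line and compensates the displacement: `slide` is a
projection along the edge direction. -/
lemma slide_add_smul {v w : K.verts} (h : v ≠ w) (x : E n) (t : ℝ) :
    K.slide v w (x + t • ((v : E n) - w)) = K.slide v w x := by
  rw [slide, slide, bary_add_smul, inner_gradVec_edge_other K h, add_assoc, ← add_smul]
  congr 2
  ring

/-- On a set `B`, both sides are the volume of the same slanted prism, computed by Fubini once from
the facet opposite to `v` and once from the facet opposite to `w`. In either case a line in the edge
direction meets the prism in parameter length one. -/
lemma map_slide (hn : 0 < n) {v w : K.verts} (h : v ≠ w) :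
    Measure.map (K.slide v w) (‖K.gradVec v‖ₑ⁻¹ • (surf n).restrict (K.facet v)) =
      ‖K.gradVec w‖ₑ⁻¹ • (surf n).restrict (K.facet w) := by
  have hms := (K.continuous_slide v w).measurable
  have hfm : ∀ w, MeasurableSet (K.facet w) := fun w => K.measurableSet_facet w
  ext B hB
  have hSB : MeasurableSet (K.slide v w ⁻¹' B) := hms hB
  rw [Measure.map_apply hms hB]
  simp only [Measure.smul_apply, smul_eq_mul]
  -- The lines through the facet in the edge direction, cut off by `0 ≤ η_v ≤ 1`. Since `η_v + η_w`
  -- and the other coordinates are constant along these lines, their signs confine the base point to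
  -- the facet.
  set P : Set (E n) := {x | (∀ i, i ≠ v → i ≠ w → 0 ≤ K.bary i x) ∧
    0 ≤ K.bary v x + K.bary w x ∧ 0 ≤ K.bary v x ∧ K.bary v x ≤ 1} with hP
  have hPm : MeasurableSet P := by
    have hb := fun i => (K.continuous_bary i).measurable
    refine MeasurableSet.inter ?_ (MeasurableSet.inter ?_ (MeasurableSet.inter ?_ ?_))
    · exact measurableSet_setOfPred.2 (Measurable.forall fun i => Measurable.forall fun _ =>
        Measurable.forall fun _ => measurableSet_setOfPred.1 (measurableSet_le measurable_const (hb i)))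
    · exact measurableSet_le measurable_const ((hb v).add (hb w))
    · exact measurableSet_le measurable_const (hb v)
    · exact measurableSet_le (hb v) measurable_const
  have hg : Measurable ((P ∩ K.slide v w ⁻¹' B).indicator (1 : E n → ENNReal)) :=
    measurable_one.indicator (hPm.inter hSB)
  have hu' : inner ℝ (K.gradVec w) ((w : E n) - v) = 1 := K.inner_gradVec_edge_self h.symm
  have hneg : ∀ (x : E n) (t : ℝ), x + t • ((w : E n) - v) = x + (-t) • ((v : E n) - w) := by
    intro x t
    rw [neg_smul, ← smul_neg, neg_sub]
  have e1 := K.lintegral_lines hn v (K.inner_gradVec_edge_self h) hg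
  have e2 := K.lintegral_lines hn w hu' hg
  rw [e1] at e2
  convert e2 using 2
  · have hz := K.facet_subset_zero v
    rw [Measure.restrict_apply hSB, ← Set.inter_eq_left.2 (Set.inter_subset_right.trans hz),
      ← Measure.restrict_apply (hSB.inter (hfm v)), ← lintegral_indicator_one (hSB.inter (hfm v))]
    refine setLIntegral_congr_fun (K.measurableSet_bary_zero v) fun x hx => ?_
    have hx : K.bary v x = 0 := hx
    -- Starting at `η_v = 0`, the parameter `t` is the value of `η_v`, so the cut is `[0, 1]`.
    have hi : ∀ t : ℝ, (P ∩ K.slide v w ⁻¹' B).indicator (1 : E n → ENNReal)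
        (x + t • ((v : E n) - w)) =
        (K.slide v w ⁻¹' B ∩ K.facet v).indicator 1 x * (Set.Icc 0 1).indicator 1 t := by
      intro t
      have hb : ∀ i, i ≠ v → i ≠ w → K.bary i (x + t • ((v : E n) - w)) = K.bary i x := by
        intro i h1 h2
        rw [bary_add_smul, K.inner_gradVec_edge_ne h1 h2, mul_zero, add_zero]
      have hbv : K.bary v (x + t • ((v : E n) - w)) = t := by
        rw [bary_add_smul, K.inner_gradVec_edge_self h, hx, mul_one, zero_add]
      have hbw : K.bary w (x + t • ((v : E n) - w)) = K.bary w x - t := by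
        rw [bary_add_smul, K.inner_gradVec_edge_other h]
        ring
      have hiff : x + t • ((v : E n) - w) ∈ P ∩ K.slide v w ⁻¹' B ↔
          x ∈ K.slide v w ⁻¹' B ∩ K.facet v ∧ t ∈ Set.Icc (0 : ℝ) 1 := by
        simp only [hP, Set.mem_inter_iff, Set.mem_ofPred_eq, Set.mem_preimage,
          K.slide_add_smul h, hbv, hbw, mem_facet, Set.mem_Icc, hx]
        constructor
        · rintro ⟨⟨h1, h2, h3, h4⟩, h5⟩
          refine ⟨⟨h5, trivial, fun i => ?_⟩, h3, h4⟩
          by_cases hiv : i = v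
          · rw [hiv, hx]
          by_cases hiw : i = w
          · rw [hiw]; linarith
          rw [← hb i hiv hiw]
          exact h1 i hiv hiw
        · rintro ⟨⟨h5, -, h1⟩, h3, h4⟩
          refine ⟨⟨fun i hiv hiw => by rw [hb i hiv hiw]; exact h1 i, ?_, h3, h4⟩, h5⟩
          have := h1 w
          linarith
      by_cases h1 : x ∈ K.slide v w ⁻¹' B ∩ K.facet v <;> by_cases h2 : t ∈ Set.Icc (0 : ℝ) 1 <;>
        simp only [Set.indicator, hiff, h1, h2, and_true, and_false, if_true, if_false,
          Pi.one_apply, mul_one, mul_zero]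
    simp only [hi]
    rw [lintegral_const_mul _ (measurable_one.indicator measurableSet_Icc),
      lintegral_indicator_one measurableSet_Icc]
    simp
  · have hz := K.facet_subset_zero w
    rw [Measure.restrict_apply hB, ← Set.inter_eq_left.2 (Set.inter_subset_right.trans hz),
      ← Measure.restrict_apply (hB.inter (hfm w)), ← lintegral_indicator_one (hB.inter (hfm w))]
    refine setLIntegral_congr_fun (K.measurableSet_bary_zero w) fun x hx => ?_
    have hx : K.bary w x = 0 := hx
    -- From the other facet the direction is reversed and `η_v` equals `η_v(x) - t`: the interval
    -- moves with `x` but keeps length one.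
    have hi : ∀ t : ℝ, (P ∩ K.slide v w ⁻¹' B).indicator (1 : E n → ENNReal)
        (x + t • ((w : E n) - v)) =
        (B ∩ K.facet w).indicator 1 x *
          (Set.Icc (K.bary v x - 1) (K.bary v x)).indicator 1 t := by
      intro t
      rw [hneg]
      have hb : ∀ i, i ≠ v → i ≠ w → K.bary i (x + (-t) • ((v : E n) - w)) = K.bary i x := by
        intro i h1 h2
        rw [bary_add_smul, K.inner_gradVec_edge_ne h1 h2, mul_zero, add_zero]
      have hbv : K.bary v (x + (-t) • ((v : E n) - w)) = K.bary v x - t := by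
        rw [bary_add_smul, K.inner_gradVec_edge_self h]
        ring
      have hbw : K.bary w (x + (-t) • ((v : E n) - w)) = t := by
        rw [bary_add_smul, K.inner_gradVec_edge_other h, hx]
        ring
      have hsl : K.slide v w x = x := by rw [slide, hx, zero_smul, add_zero]
      have hiff : x + (-t) • ((v : E n) - w) ∈ P ∩ K.slide v w ⁻¹' B ↔
          x ∈ B ∩ K.facet w ∧ t ∈ Set.Icc (K.bary v x - 1) (K.bary v x) := by
        simp only [hP, Set.mem_inter_iff, Set.mem_ofPred_eq, Set.mem_preimage,
          K.slide_add_smul h, hbv, hbw, mem_facet, Set.mem_Icc, hx, hsl]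
        constructor
        · rintro ⟨⟨h1, h2, h3, h4⟩, h5⟩
          refine ⟨⟨h5, trivial, fun i => ?_⟩, by linarith, by linarith⟩
          by_cases hiv : i = v
          · rw [hiv]; linarith
          by_cases hiw : i = w
          · rw [hiw, hx]
          rw [← hb i hiv hiw]
          exact h1 i hiv hiw
        · rintro ⟨⟨h5, -, h1⟩, h3, h4⟩
          refine ⟨⟨fun i hiv hiw => by rw [hb i hiv hiw]; exact h1 i, ?_, by linarith,
            by linarith⟩, h5⟩
          have := h1 v
          linarith
      by_cases h1 : x ∈ B ∩ K.facet w <;>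
      by_cases h2 : t ∈ Set.Icc (K.bary v x - 1) (K.bary v x) <;>
        simp only [Set.indicator, hiff, h1, h2, and_true, and_false, if_true, if_false,
          Pi.one_apply, mul_one, mul_zero]
    simp only [hi]
    rw [lintegral_const_mul _ (measurable_one.indicator measurableSet_Icc),
      lintegral_indicator_one measurableSet_Icc]
    simp

end Cell

end HDG

end

noncomputable section

open scoped Classical
open MeasureTheory MvPolynomial

namespace HDG

namespace Cell

variable {n : ℕ} (K : Cell n)

/-! ### The divergence theorem on a simplex -/

/-- Directional derivative of a polynomial, evaluated at a point. -/
def dirDeriv (d : E n) (p : Poly n) (x : E n) : ℂ := ∑ j, (d j : ℂ) * ev (pderiv j p) x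

lemma continuous_dirDeriv (d : E n) (p : Poly n) : Continuous (dirDeriv d p) :=
  continuous_finsetSum _ fun _ _ => continuous_const.mul (continuous_ev _)

lemma integrableOn_body {f : E n → ℂ} (hf : Continuous f) : IntegrableOn f K.body :=
  hf.continuousOn.integrableOn_compact K.isCompact_body

lemma integrableOn_facet (hn : 0 < n) (v : K.verts) {f : E n → ℂ} (hf : Continuous f) :
    IntegrableOn f (K.facet v) (surf n) := by
  have hfin := K.surf_facet_lt_top hn v
  have : IsFiniteMeasure ((surf n).restrict (K.facet v)) := ⟨by simpa using hfin⟩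
  obtain ⟨C, hC⟩ := (K.isCompact_facet v).exists_bound_of_continuousOn hf.continuousOn
  refine Integrable.of_bound hf.aestronglyMeasurable C ?_
  exact (ae_restrict_iff' (K.measurableSet_facet v)).2 (Filter.Eventually.of_forall hC)

/-- On the line through a point `x` of the facet opposite to `v`, the simplex occupies `0 ≤ t ≤
η_w(x)`, and the chord ends at `slide v w x`. The fundamental theorem of calculus evaluates the
inner integral. -/
lemma setIntegral_dirDeriv_slide (hn : 0 < n) {v w : K.verts} (h : v ≠ w) (p : Poly n) :
    ∫ x in K.body, dirDeriv ((v : E n) - (w : E n)) p x =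
      ‖K.gradVec v‖⁻¹ • ∫ x in K.facet v, (ev p (K.slide v w x) - ev p x) ∂surf n := by
  have hu := K.inner_gradVec_edge_self h
  rw [← integral_indicator K.measurableSet_body,
    K.integral_lines hn v hu ((K.integrableOn_body (continuous_dirDeriv _ p)).integrable_indicator
      K.measurableSet_body)]
  congr 1
  rw [← Set.inter_eq_right.2 (K.facet_subset_zero v),
    ← setIntegral_indicator (K.measurableSet_facet v)]
  refine setIntegral_congr_fun (K.measurableSet_bary_zero v) fun x hx => ?_
  have hx : K.bary v x = 0 := hx
  have hb : ∀ (t : ℝ) i, i ≠ v → i ≠ w → K.bary i (x + t • ((v : E n) - w)) = K.bary i x := by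
    intro t i h1 h2
    rw [bary_add_smul, K.inner_gradVec_edge_ne h1 h2, mul_zero, add_zero]
  have hbv : ∀ t : ℝ, K.bary v (x + t • ((v : E n) - w)) = t := by
    intro t
    rw [bary_add_smul, K.inner_gradVec_edge_self h, hx, mul_one, zero_add]
  have hbw : ∀ t : ℝ, K.bary w (x + t • ((v : E n) - w)) = K.bary w x - t := by
    intro t
    rw [bary_add_smul, K.inner_gradVec_edge_other h]
    ring
  by_cases hxf : x ∈ K.facet v
  · have hxb := (K.mem_facet.1 hxf).2
    have hiff : ∀ t : ℝ, x + t • ((v : E n) - w) ∈ K.body ↔ t ∈ Set.Icc 0 (K.bary w x) := by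
      intro t
      rw [mem_body, Set.mem_Icc]
      constructor
      · intro hi
        have h1 := hi v
        have h2 := hi w
        rw [hbv] at h1
        rw [hbw] at h2
        exact ⟨h1, by linarith⟩
      · rintro ⟨h1, h2⟩ i
        by_cases hiv : i = v
        · rw [hiv, hbv]; exact h1
        by_cases hiw : i = w
        · rw [hiw, hbw]; linarith
        rw [hb t i hiv hiw]
        exact hxb i
    have hind : ∀ t : ℝ, K.body.indicator (dirDeriv ((v : E n) - (w : E n)) p) (x + t • ((v : E n) - w)) =
        (Set.Icc 0 (K.bary w x)).indicator
          (fun t => dirDeriv ((v : E n) - (w : E n)) p (x + t • ((v : E n) - w))) t := by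
      intro t
      by_cases ht : t ∈ Set.Icc 0 (K.bary w x)
      · rw [Set.indicator_of_mem ht, Set.indicator_of_mem ((hiff t).2 ht)]
      · rw [Set.indicator_of_notMem ht, Set.indicator_of_notMem (mt (hiff t).1 ht)]
    rw [Set.indicator_of_mem hxf]
    simp only [hind]
    rw [integral_indicator measurableSet_Icc, integral_Icc_eq_integral_Ioc,
      ← intervalIntegral.integral_of_le (hxb w),
      intervalIntegral.integral_eq_sub_of_hasDerivAt (f := fun t => ev p (x + t • ((v : E n) - w)))
        (f' := fun t => dirDeriv ((v : E n) - (w : E n)) p (x + t • ((v : E n) - w)))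
        (fun t _ => hasDerivAt_ev_line p x _ t)]
    · simp [slide]
    · refine Continuous.intervalIntegrable ?_ _ _
      exact (continuous_dirDeriv _ p).comp (by fun_prop)
  · rw [Set.indicator_of_notMem hxf]
    -- A line that starts in the hyperplane outside the facet misses the simplex: meeting it would
    -- make all coordinates of `x` nonnegative.
    have hnot : ∀ t : ℝ, x + t • ((v : E n) - w) ∉ K.body := by
      intro t ht
      apply hxf
      rw [mem_body] at ht
      refine K.mem_facet.2 ⟨hx, fun i => ?_⟩
      have h1 := ht v
      have h2 := ht w
      rw [hbv] at h1
      rw [hbw] at h2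
      by_cases hiv : i = v
      · rw [hiv, hx]
      by_cases hiw : i = w
      · rw [hiw]; linarith
      rw [← hb t i hiv hiw]
      exact ht i
    simp only [Set.indicator_of_notMem (hnot _), integral_zero]

/-- `map_slide` turns the values at the far ends of the chords into an integral over the facet
opposite to `w`, with the weight of that facet. -/
lemma setIntegral_dirDeriv_edge (hn : 0 < n) {v w : K.verts} (h : v ≠ w) (p : Poly n) :
    ∫ x in K.body, dirDeriv ((v : E n) - (w : E n)) p x =
      ‖K.gradVec w‖⁻¹ • (∫ x in K.facet w, ev p x ∂surf n)
        - ‖K.gradVec v‖⁻¹ • ∫ x in K.facet v, ev p x ∂surf n := by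
  have hi := K.integrableOn_facet hn v (continuous_ev p)
  have hi' : IntegrableOn (fun x => ev p (K.slide v w x)) (K.facet v) (surf n) :=
    K.integrableOn_facet hn v ((continuous_ev p).comp (K.continuous_slide v w))
  have e : ∀ u : K.verts, ‖K.gradVec u‖⁻¹ = (‖K.gradVec u‖ₑ⁻¹).toReal := by
    intro u
    simp
  rw [K.setIntegral_dirDeriv_slide hn h, integral_sub hi' hi, smul_sub, e v, e w,
    ← integral_smul_measure, ← integral_smul_measure _ (‖K.gradVec w‖ₑ⁻¹), ← K.map_slide hn h,
    integral_map (K.continuous_slide v w).aemeasurable (continuous_ev p).aestronglyMeasurable]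

/-- The divergence theorem, for one partial derivative of a polynomial. -/
theorem setIntegral_pderiv (hn : 0 < n) (p : Poly n) (j : Fin n) :
    ∫ x in K.body, ev (pderiv j p) x =
      ∑ v, (K.normal v j : ℂ) * ∫ x in K.facet v, ev p x ∂surf n := by
  -- Both sides are linear in the direction of differentiation, so they need to be compared only on
  -- the basis of edges issuing from one vertex.
  let A : E n →ₗ[ℝ] ℂ :=
    { toFun := fun d => ∑ j, (d j : ℂ) * ∫ x in K.body, ev (pderiv j p) x
      map_add' := fun a b => by simp [add_mul, Finset.sum_add_distrib]
      map_smul' := fun c a => by simp [Finset.mul_sum, mul_assoc] }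
  let B : E n →ₗ[ℝ] ℂ :=
    { toFun := fun d => ∑ v, ((inner ℝ (K.gradVec v) d : ℝ) : ℂ) *
        -(((‖K.gradVec v‖⁻¹ : ℝ) : ℂ) * ∫ x in K.facet v, ev p x ∂surf n)
      map_add' := fun a b => by simp only [inner_add_right, Complex.ofReal_add, add_mul,
        Finset.sum_add_distrib]
      map_smul' := fun c a => by
        simp only [inner_smul_right, Complex.ofReal_mul, Finset.smul_sum, RingHom.id_apply,
          Complex.real_smul, mul_assoc] }
  have hA : ∀ d, A d = ∫ x in K.body, dirDeriv d p x := by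
    intro d
    simp only [dirDeriv]
    have hi : ∀ j ∈ Finset.univ, IntegrableOn (fun x => (d j : ℂ) * ev (pderiv j p) x) K.body :=
      fun j _ => K.integrableOn_body (continuous_const.mul (continuous_ev (pderiv j p)))
    rw [integral_finsetSum _ hi]
    simp only [integral_const_mul]
    rfl
  have hne : 0 < Fintype.card K.verts := by rw [Fintype.card_coe, K.card_verts]; lia
  obtain ⟨w⟩ := Fintype.card_pos_iff.1 hne
  have hAB : A = B := by
    refine (K.basis.basisOf w).ext fun v => ?_
    obtain ⟨v, hv⟩ := v
    rw [AffineBasis.basisOf_apply, basis_apply, basis_apply, vsub_eq_sub, hA,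
      K.setIntegral_dirDeriv_edge hn hv p]
    -- The gradients of all but two coordinates are orthogonal to the edge, so two facets
    -- contribute.
    change _ = ∑ u, ((inner ℝ (K.gradVec u) ((v : E n) - w) : ℝ) : ℂ) * _
    rw [← Finset.add_sum_erase _ _ (Finset.mem_univ v),
      ← Finset.add_sum_erase _ _ (Finset.mem_erase.2 ⟨(Ne.symm hv), Finset.mem_univ w⟩),
      Finset.sum_eq_zero, K.inner_gradVec_edge_self hv, K.inner_gradVec_edge_other hv]
    · simp only [Complex.real_smul]
      push_cast
      ring
    · intro i hi
      have h1 := Finset.ne_of_mem_erase hi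
      have h2 := Finset.ne_of_mem_erase (Finset.mem_of_mem_erase hi)
      rw [K.inner_gradVec_edge_ne h2 h1]
      simp
  have h := congrArg (fun f => f (EuclideanSpace.single j (1 : ℝ))) hAB
  simp only [A, B, LinearMap.coe_mk, AddHom.coe_mk] at h
  rw [Finset.sum_eq_single j (by intro i _ hi; simp [hi]) (by simp)] at h
  simp only [PiLp.single_apply, if_true, Complex.ofReal_one, one_mul] at h
  rw [h]
  refine Finset.sum_congr rfl fun v _ => ?_
  rw [K.normal_eq]
  have : inner ℝ (K.gradVec v) (EuclideanSpace.single j (1 : ℝ)) = K.gradVec v j := by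
    simp [EuclideanSpace.inner_single_right]
  rw [this]
  push_cast
  ring

/-! ### Polynomials that vanish almost everywhere -/

lemma exists_bary_pos : ∃ x, ∀ v, 0 < K.bary v x := by
  have h := K.basis.centroid_mem_interior_convexHull
  rw [K.basis.interior_convexHull] at h
  exact ⟨_, h⟩

/-- An interior point is moved along an edge until the coordinate of `v` is used up; the coordinate
of `w` only grows and the others do not change. -/
lemma exists_facet_bary_pos (hn : 0 < n) (v : K.verts) :
    ∃ x, K.bary v x = 0 ∧ ∀ w, w ≠ v → 0 < K.bary w x := by
  obtain ⟨z, hz⟩ := K.exists_bary_pos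
  obtain ⟨w, hw⟩ := K.exists_ne hn v
  refine ⟨z + (-K.bary v z) • ((v : E n) - w), ?_, fun i hi => ?_⟩
  · rw [bary_add_smul, K.inner_gradVec_edge_self hw.symm]
    ring
  · rw [bary_add_smul]
    by_cases hiw : i = w
    · rw [hiw, K.inner_gradVec_edge_other hw.symm]
      have h1 := hz v
      have h2 := hz w
      linarith
    · rw [K.inner_gradVec_edge_ne hi hiw, mul_zero, add_zero]
      exact hz i

lemma eq_zero_of_ae_body {p : Poly n}
    (h : ∀ᵐ x ∂(volume.restrict K.body), ev p x = 0) : p = 0 := by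
  obtain ⟨z, hz⟩ := K.exists_bary_pos
  have hU : IsOpen {x | ∀ v, 0 < K.bary v x} := by
    rw [Set.ofPred_forall]
    exact isOpen_iInter_of_finite fun v => isOpen_lt continuous_const (K.continuous_bary v)
  have hsub : {x | ∀ v, 0 < K.bary v x} ⊆ K.body :=
    fun x hx => K.mem_body.2 fun v => (hx v).le
  have h0 := Measure.eqOn_open_of_ae_eq (f := ev p) (g := fun _ => 0)
    (ae_restrict_of_ae_restrict_of_subset hsub h) hU (continuous_ev p).continuousOn
    continuousOn_const
  exact eq_zero_of_ev_eq_zero_on_open hU hz h0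

/-- In the hyperplane of the facet the measure is Lebesgue measure, which charges nonempty open
sets, so continuity gives vanishing on the relative interior. The other points are limits along
segments towards an interior point. -/
lemma eq_zero_of_ae_facet (hn : 0 < n) (v : K.verts) {f : E n → ℂ} (hf : Continuous f)
    (h : ∀ᵐ x ∂((surf n).restrict (K.facet v)), f x = 0) : ∀ x ∈ K.facet v, f x = 0 := by
  obtain ⟨w, hw⟩ := K.exists_ne hn v
  obtain ⟨c, hc0, hc⟩ := K.exists_facet_bary_pos hn v
  have hφ : Continuous (fun y : (ℝ ∙ K.gradVec v)ᗮ => (w : E n) + (y : E n)) := by fun_prop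
  rw [← Measure.restrict_restrict_of_subset (K.facet_subset_zero v),
    ae_restrict_iff' (K.measurableSet_facet v), K.restrict_bary_zero hn hw,
    (measurableEmbedding_hyperplane _ _).ae_map_iff] at h
  set U : Set (ℝ ∙ K.gradVec v)ᗮ := {y | ∀ i, i ≠ v → 0 < K.bary i ((w : E n) + (y : E n))}
  have hU : IsOpen U := by
    simp only [U, Set.ofPred_forall]
    exact isOpen_iInter_of_finite fun i => isOpen_iInter_of_finite fun _ =>
      isOpen_lt continuous_const ((K.continuous_bary i).comp hφ)
  have h0 : Set.EqOn (fun y : (ℝ ∙ K.gradVec v)ᗮ => f ((w : E n) + (y : E n))) (fun _ => 0) U := by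
    refine Measure.eqOn_open_of_ae_eq (μ := volume) ?_ hU (hf.comp hφ).continuousOn
      continuousOn_const
    rw [Filter.EventuallyEq, ae_restrict_iff' hU.measurableSet]
    filter_upwards [h] with y hy hyU
    refine hy (K.mem_facet.2 ?_)
    have hv : K.bary v ((w : E n) + (y : E n)) = 0 := by
      rw [bary_add, K.bary_ne hw.symm, zero_add]
      exact Submodule.mem_orthogonal_singleton_iff_inner_right.1 y.2
    refine ⟨hv, fun i => ?_⟩
    by_cases hi : i = v
    · rw [hi, hv]
    · exact (hyU i hi).le
  have h1 : ∀ x, K.bary v x = 0 → (∀ i, i ≠ v → 0 < K.bary i x) → f x = 0 := by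
    intro x hx hi
    have hm : x - w ∈ (ℝ ∙ K.gradVec v)ᗮ := by
      rw [Submodule.mem_orthogonal_singleton_iff_inner_right, inner_gradVec_sub, hx,
        K.bary_ne hw.symm, sub_zero]
    have := h0 (x := ⟨x - w, hm⟩) (fun i hiv => by simpa using hi i hiv)
    simpa using this
  intro x hx
  obtain ⟨hx0, hx⟩ := K.mem_facet.1 hx
  have hcl : IsClosed {t : ℝ | f (x + t • (c - x)) = 0} :=
    isClosed_eq (hf.comp (by fun_prop)) continuous_const
  have hsub : Set.Ioo (0 : ℝ) 1 ⊆ {t : ℝ | f (x + t • (c - x)) = 0} := by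
    rintro t ⟨ht0, ht1⟩
    refine h1 _ ?_ fun i hi => ?_
    · rw [bary_add_smul, inner_gradVec_sub, hx0, hc0]
      ring
    · rw [bary_add_smul, inner_gradVec_sub]
      have h2 := hx i
      have h3 := mul_pos ht0 (hc i hi)
      have h4 := mul_nonneg (sub_nonneg.2 ht1.le) h2
      linarith
  have h2 := hcl.closure_subset_iff.2 hsub
  rw [closure_Ioo zero_ne_one] at h2
  have h3 := h2 (Set.left_mem_Icc.2 zero_le_one)
  simpa using h3

end Cell

end HDG

end

noncomputable section

open scoped Classical
open MeasureTheory MvPolynomial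

namespace HDG

namespace Cell

variable {n : ℕ}

/-! ### Faces shared by two elements of a conforming mesh -/

lemma affineMap_eq_sum (K : Cell n) (f : E n →ᵃ[ℝ] ℝ) (x : E n) :
    f x = ∑ i, K.bary i x * f (i : E n) := by
  conv_lhs => rw [← K.basis.affineCombination_coord_eq_self x]
  have h := K.basis.sum_coord_apply_eq_one x
  rw [Finset.map_affineCombination _ _ _ h,
    Finset.affineCombination_eq_linear_combination _ _ _ h]
  rfl

lemma face_injective (K : Cell n) {v w : K.verts} (h : K.face v = K.face w) : v = w := by
  by_contra hne
  have : (v : E n) ∈ K.face w := K.mem_face.2 hne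
  rw [← h] at this
  exact K.mem_face.1 this rfl

lemma bary_eq_zero_of_mem_face (K : Cell n) {v : K.verts} {x : E n} (hx : x ∈ K.face v) :
    K.bary v x = 0 :=
  (K.mem_facet.1 (subset_convexHull ℝ _ hx)).1

/-- An affine function is determined by its values at the vertices of `K`, and `L.bary w` vanishes
at all of them except possibly `v`. -/
lemma bary_proportional {K L : Cell n} {v : K.verts} {w : L.verts} (h : K.face v = L.face w)
    (x : E n) : L.bary w x = L.bary w v * K.bary v x := by
  rw [K.affineMap_eq_sum (L.bary w) x, Finset.sum_eq_single v]
  · ring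
  · intro i _ hi
    rw [L.bary_eq_zero_of_mem_face (h ▸ K.mem_face.2 hi), mul_zero]
  · simp

lemma gradVec_proportional {K L : Cell n} {v : K.verts} {w : L.verts}
    (h : K.face v = L.face w) : L.gradVec w = L.bary w v • K.gradVec v := by
  refine ext_inner_right ℝ fun y => ?_
  have h1 := L.bary_add w 0 y
  have h2 := K.bary_add v 0 y
  rw [bary_proportional h (0 + y), bary_proportional h 0, h2] at h1
  rw [inner_smul_left, RCLike.conj_to_real]
  linarith

lemma eq_of_face_eq_of_mem {K L : Cell n} {v : K.verts} {w : L.verts} (h : K.face v = L.face w)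
    (hv : (v : E n) ∈ L.verts) : K = L := by
  apply Cell.ext
  refine Finset.eq_of_subset_of_card_le (fun x hx => ?_) (by rw [K.card_verts, L.card_verts])
  by_cases hxv : x = v
  · rw [hxv]; exact hv
  · have : x ∈ L.face w := h ▸ (Finset.mem_erase.2 ⟨hxv, hx⟩ : x ∈ K.verts.erase v)
    exact Finset.mem_of_mem_erase this

/-- Were the coordinate positive, points of `K` close to the relative interior of the common face
would lie in `L` too. Conformity would put them into the hull of the common vertices, hence into the
face, where the coordinate of `v` vanishes. -/
lemma bary_opposite_neg (hn : 0 < n) {K L : Cell n} {v : K.verts} {w : L.verts}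
    (h : K.face v = L.face w) (hne : K ≠ L)
    (hc : K.body ∩ L.body ⊆ convexHull ℝ ((K.verts ∩ L.verts : Finset (E n)) : Set (E n))) :
    L.bary w v < 0 := by
  have hvL : (v : E n) ∉ L.verts := fun hv => hne (eq_of_face_eq_of_mem h hv)
  have hc0 : L.bary w v ≠ 0 := by
    intro h0
    have := gradVec_proportional h
    rw [h0, zero_smul] at this
    exact L.gradVec_ne_zero hn w this
  by_contra hpos
  have hpos : 0 < L.bary w v := lt_of_le_of_ne (not_lt.1 hpos) hc0.symm
  obtain ⟨m, hm0, hm⟩ := K.exists_facet_bary_pos hn v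
  -- On the common face both simplices have the same barycentric coordinates.
  have hmL : ∀ j, j ≠ w → 0 < L.bary j m := by
    intro j hj
    have hjK : (j : E n) ∈ K.face v := h ▸ L.mem_face.2 hj
    have hjv : (j : E n) ∈ K.verts := Finset.mem_of_mem_erase hjK
    rw [K.affineMap_eq_sum (L.bary j) m, Finset.sum_eq_single (⟨j, hjv⟩ : K.verts)]
    · change 0 < K.bary ⟨j, hjv⟩ m * L.bary j j
      rw [L.bary_self, mul_one]
      exact hm _ (K.mem_face.1 hjK)
    · intro i _ hi
      by_cases hiv : i = v
      · rw [hiv, hm0, zero_mul]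
      · have hiL : (i : E n) ∈ L.face w := h ▸ K.mem_face.2 hiv
        have : L.bary j i = 0 := L.bary_ne (v := j)
          (w := ⟨i, Finset.mem_of_mem_erase hiL⟩) (fun he => hi (Subtype.ext (congrArg Subtype.val he).symm))
        rw [this, mul_zero]
    · simp
  have hopen : IsOpen {t : ℝ | ∀ j, j ≠ w → 0 < L.bary j (m + t • ((v : E n) - m))} := by
    simp only [Set.ofPred_forall]
    exact isOpen_iInter_of_finite fun j => isOpen_iInter_of_finite fun _ =>
      isOpen_lt continuous_const ((L.continuous_bary j).comp (by fun_prop))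
  obtain ⟨ε, hε, hball⟩ := Metric.isOpen_iff.1 hopen 0 (by simpa using hmL)
  -- Less than `ε`, to keep the other coordinates in `L` positive; at most one, to stay on the
  -- segment from `m` to `v` in `K`.
  set t := min (ε / 2) 1
  have ht0 : 0 < t := lt_min (by linarith) one_pos
  have ht1 : t ≤ 1 := min_le_right _ _
  have htε : t < ε := lt_of_le_of_lt (min_le_left _ _) (by linarith)
  set x := m + t • ((v : E n) - m)
  have hxv : K.bary v x = t := by
    rw [bary_add_smul, inner_gradVec_sub, bary_self, hm0]
    ring
  have hxK : x ∈ K.body := by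
    refine K.mem_body.2 fun i => ?_
    by_cases hi : i = v
    · rw [hi, hxv]; exact ht0.le
    · rw [bary_add_smul, inner_gradVec_sub, K.bary_ne hi]
      have := mul_nonneg (sub_nonneg.2 ht1) (hm i hi).le
      linarith
  have hxL : x ∈ L.body := by
    refine L.mem_body.2 fun j => ?_
    by_cases hj : j = w
    · rw [hj, bary_proportional h, hxv]
      positivity
    · refine (hball ?_ j hj).le
      rw [Metric.mem_ball, Real.dist_eq, sub_zero, abs_of_pos ht0]
      exact htε
  have hsub : ((K.verts ∩ L.verts : Finset (E n)) : Set (E n)) ⊆ (K.face v : Set (E n)) := by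
    intro y hy
    have hy := Finset.mem_inter.1 (Finset.mem_coe.1 hy)
    refine Finset.mem_coe.2 (Finset.mem_erase.2 ⟨fun he => hvL (he ▸ hy.2), hy.1⟩)
  have hxF : x ∈ K.facet v := convexHull_mono hsub (hc ⟨hxK, hxL⟩)
  have := (K.mem_facet.1 hxF).1
  linarith

/-- The two gradients are proportional with a negative factor, so normalizing them gives opposite
unit vectors. -/
lemma normal_opposite (hn : 0 < n) {K L : Cell n} {v : K.verts} {w : L.verts}
    (h : K.face v = L.face w) (hne : K ≠ L)
    (hc : K.body ∩ L.body ⊆ convexHull ℝ ((K.verts ∩ L.verts : Finset (E n)) : Set (E n))) :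
    K.normal v = fun j => -L.normal w j := by
  have hneg := bary_opposite_neg hn h hne hc
  have hK : ‖K.gradVec v‖ ≠ 0 := norm_ne_zero_iff.2 (K.gradVec_ne_zero hn v)
  funext j
  rw [normal_eq, normal_eq, gradVec_proportional h, norm_smul, Real.norm_eq_abs,
    abs_of_neg hneg]
  simp only [PiLp.smul_apply, smul_eq_mul]
  have := hneg.ne
  field_simp

lemma normal_ne_zero (hn : 0 < n) (K : Cell n) (v : K.verts) : K.normal v ≠ 0 := by
  intro h0
  have hK : ‖K.gradVec v‖ ≠ 0 := norm_ne_zero_iff.2 (K.gradVec_ne_zero hn v)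
  apply K.gradVec_ne_zero hn v
  ext j
  have h := congrFun h0 j
  rw [normal_eq] at h
  simpa [hK, K.gradVec_ne_zero hn v] using h

end Cell

/-! ### The two sides of a face in a conforming mesh -/

namespace CoupledMesh

variable {n : ℕ} (M : CoupledMesh n)

lemma normal_opposite (hn : 0 < n) {K L : Cell n} (hK : K ∈ M.TE ∪ M.TA) (hL : L ∈ M.TE ∪ M.TA)
    {v : K.verts} {w : L.verts} (h : K.face v = L.face w) (hne : K ≠ L) :
    K.normal v = fun j => -L.normal w j :=
  Cell.normal_opposite hn h hne (M.conforming K hK L hL)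

/-- Different elements at a common face have opposite normals; with three pairwise different ones a
normal would be its own negative. -/
lemma eq_of_shared_face (hn : 0 < n) {K L N : Cell n} (hK : K ∈ M.TE ∪ M.TA)
    (hL : L ∈ M.TE ∪ M.TA) (hN : N ∈ M.TE ∪ M.TA) {v : K.verts} {w : L.verts} {u : N.verts}
    (hKN : K.face v = N.face u) (hLN : L.face w = N.face u) (h1 : K ≠ N) (h2 : L ≠ N) :
    K = L := by
  by_contra hne
  have e1 := M.normal_opposite hn hK hN hKN h1
  have e2 := M.normal_opposite hn hL hN hLN h2
  have e3 := M.normal_opposite hn hK hL (hKN.trans hLN.symm) hne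
  apply K.normal_ne_zero hn v
  funext j
  have e1 := congrFun e1 j
  have e2 := congrFun e2 j
  have e3 := congrFun e3 j
  simp only [Pi.zero_apply] at *
  linarith

lemma ne_of_mem {K L : Cell n} (hK : K ∈ M.TA) (hL : L ∈ M.TE) : K ≠ L :=
  fun h => Finset.disjoint_left.1 M.disj hL (h ▸ hK)

/-- An integral over the acoustic side of the interface, written on the elastic side. -/
theorem bdryInt_interface_swap (hn : 0 < n) (G : Finset (E n) → (Fin n → ℝ) → E n → ℂ) :
    bdryInt M.TA M.interface (fun K v x => G (K.face v) (K.normal v) x) =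
      bdryInt M.TE M.interface (fun K v x => G (K.face v) (fun j => -K.normal v j) x) := by
  have inA : ∀ K ∈ M.TA, K ∈ M.TE ∪ M.TA := fun K h => Finset.mem_union_right _ h
  have inE : ∀ K ∈ M.TE, K ∈ M.TE ∪ M.TA := fun K h => Finset.mem_union_left _ h
  unfold bdryInt
  rw [Finset.sum_sigma', Finset.sum_sigma', ← Finset.sum_filter, ← Finset.sum_filter]
  -- Each acoustic face on the interface gets an elastic partner. The choice is a bijection because
  -- at most two elements share a face.
  have hex : ∀ a : (Σ K : Cell n, K.verts), a ∈ ((M.TA.sigma fun K => Finset.univ).filter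
      fun a : (Σ K : Cell n, K.verts) => a.1.face a.2 ∈ M.interface) →
      ∃ b : (Σ K : Cell n, K.verts), b.1 ∈ M.TE ∧ a.1.face a.2 = b.1.face b.2 := by
    intro a ha
    obtain ⟨⟨K, hK, v, hv⟩, -⟩ := (Finset.mem_filter.1 ha).2
    exact ⟨⟨K, v⟩, hK, hv⟩
  choose i hiE hif using hex
  refine Finset.sum_bij i ?_ ?_ ?_ ?_
  · intro a ha
    refine Finset.mem_filter.2 ⟨Finset.mem_sigma.2 ⟨hiE a ha, Finset.mem_univ _⟩, ?_⟩
    rw [← hif a ha]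
    exact (Finset.mem_filter.1 ha).2
  · intro a ha b hb hab
    have haA := (Finset.mem_sigma.1 (Finset.mem_filter.1 ha).1).1
    have hbA := (Finset.mem_sigma.1 (Finset.mem_filter.1 hb).1).1
    have h1 := hif a ha
    have h2 := hif b hb
    rw [← hab] at h2
    have hK := M.eq_of_shared_face hn (inA _ haA) (inA _ hbA) (inE _ (hiE a ha)) h1 h2
      (M.ne_of_mem haA (hiE a ha)) (M.ne_of_mem hbA (hiE a ha))
    obtain ⟨K, v⟩ := a
    obtain ⟨L, w⟩ := b
    dsimp only at hK h1 h2
    subst hK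
    rw [K.face_injective (h1.trans h2.symm)]
  · intro b hb
    have hbE := (Finset.mem_sigma.1 (Finset.mem_filter.1 hb).1).1
    have hbi := (Finset.mem_filter.1 hb).2
    obtain ⟨-, K, hK, v, hv⟩ := id hbi
    have ha : (⟨K, v⟩ : Σ K : Cell n, K.verts) ∈ ((M.TA.sigma fun K => Finset.univ).filter
        fun a : (Σ K : Cell n, K.verts) => a.1.face a.2 ∈ M.interface) :=
      Finset.mem_filter.2 ⟨Finset.mem_sigma.2 ⟨hK, Finset.mem_univ _⟩, by rw [← hv]; exact hbi⟩
    refine ⟨_, ha, ?_⟩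
    have h1 := hif _ ha
    have hE := hiE _ ha
    have hKL := M.eq_of_shared_face hn (inE _ hE) (inE _ hbE) (inA _ hK) h1.symm hv
      (M.ne_of_mem hK hE).symm (M.ne_of_mem hK hbE).symm
    obtain ⟨L, w⟩ := b
    generalize i ⟨K, v⟩ ha = c at *
    obtain ⟨N, u⟩ := c
    dsimp only at hKL h1 hv
    subst hKL
    rw [N.face_injective (h1.symm.trans hv.symm)]
  · intro a ha
    have haA := (Finset.mem_sigma.1 (Finset.mem_filter.1 ha).1).1
    dsimp only
    rw [M.normal_opposite hn (inA _ haA) (inE _ (hiE a ha)) (hif a ha)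
      (M.ne_of_mem haA (hiE a ha)), hif a ha]

lemma disjoint_interface_dirichlet {F : Finset (E n)} (h : F ∈ M.interface)
    (h' : F ∈ M.dirichlet) : False :=
  (M.dirichlet_outer F h').2.1 h.1

end CoupledMesh

end HDG

end

noncomputable section

open scoped Classical
open MeasureTheory MvPolynomial

namespace HDG

variable {n : ℕ}

/-! ### Linearity of the integrals over elements and faces -/

/-- The integrand is integrable on every element. -/
def VolIntegrable (T : Finset (Cell n)) (g : Cell n → E n → ℂ) : Prop :=
  ∀ K ∈ T, IntegrableOn (g K) K.body

/-- The integrand is integrable on every face of every element. -/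
def BdryIntegrable (T : Finset (Cell n)) (g : (K : Cell n) → K.verts → E n → ℂ) : Prop :=
  ∀ K ∈ T, ∀ v : K.verts, IntegrableOn (g K v) (K.facet v) (Cell.surf n)

lemma bdryInt_eq (T : Finset (Cell n)) (P : Set (Finset (E n)))
    (g : (K : Cell n) → K.verts → E n → ℂ) :
    bdryInt T P g = ∑ K ∈ T, ∑ v : K.verts,
      if K.face v ∈ P then ∫ x in K.facet v, g K v x ∂(Cell.surf n) else 0 := rfl

section Linearity

variable {T : Finset (Cell n)} {P : Set (Finset (E n))}

lemma volInt_congr {f g : Cell n → E n → ℂ} (h : ∀ K ∈ T, ∀ x ∈ K.body, f K x = g K x) :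
    volInt T f = volInt T g :=
  Finset.sum_congr rfl fun K hK => setIntegral_congr_fun K.measurableSet_body (h K hK)

lemma bdryInt_congr {f g : (K : Cell n) → K.verts → E n → ℂ}
    (h : ∀ K ∈ T, ∀ v : K.verts, K.face v ∈ P → ∀ x ∈ K.facet v, f K v x = g K v x) :
    bdryInt T P f = bdryInt T P g := by
  rw [bdryInt_eq, bdryInt_eq]
  refine Finset.sum_congr rfl fun K hK => Finset.sum_congr rfl fun v _ => ?_
  by_cases hv : K.face v ∈ P
  · rw [if_pos hv, if_pos hv]
    exact setIntegral_congr_fun (K.measurableSet_facet v) (h K hK v hv)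
  · rw [if_neg hv, if_neg hv]

lemma volInt_zero (T : Finset (Cell n)) : volInt T (fun _ _ => 0) = 0 := by simp [volInt]

lemma bdryInt_zero (T : Finset (Cell n)) (P : Set (Finset (E n))) :
    bdryInt T P (fun _ _ _ => 0) = 0 := by simp [bdryInt]

lemma bdryInt_eq_zero {f : (K : Cell n) → K.verts → E n → ℂ}
    (h : ∀ K ∈ T, ∀ v : K.verts, K.face v ∈ P → ∀ x ∈ K.facet v, f K v x = 0) :
    bdryInt T P f = 0 :=
  (bdryInt_congr h).trans (bdryInt_zero T P)

lemma volInt_add {f g : Cell n → E n → ℂ} (hf : VolIntegrable T f) (hg : VolIntegrable T g) :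
    volInt T (fun K x => f K x + g K x) = volInt T f + volInt T g := by
  rw [volInt, volInt, volInt, ← Finset.sum_add_distrib]
  exact Finset.sum_congr rfl fun K hK => integral_add (hf K hK) (hg K hK)

lemma volInt_sum {ι : Type*} (s : Finset ι) {f : ι → Cell n → E n → ℂ}
    (hf : ∀ i ∈ s, VolIntegrable T (f i)) :
    volInt T (fun K x => ∑ i ∈ s, f i K x) = ∑ i ∈ s, volInt T (f i) := by
  simp only [volInt]
  rw [Finset.sum_comm]
  exact Finset.sum_congr rfl fun K hK => integral_finsetSum _ fun i hi => hf i hi K hK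

lemma volInt_const_mul (c : ℂ) (f : Cell n → E n → ℂ) :
    volInt T (fun K x => c * f K x) = c * volInt T f := by
  simp only [volInt, integral_const_mul, Finset.mul_sum]

lemma volInt_conj (f : Cell n → E n → ℂ) :
    volInt T (fun K x => (starRingEnd ℂ) (f K x)) = (starRingEnd ℂ) (volInt T f) := by
  simp only [volInt, integral_conj, map_sum]

lemma bdryInt_add {f g : (K : Cell n) → K.verts → E n → ℂ} (hf : BdryIntegrable T f)
    (hg : BdryIntegrable T g) :
    bdryInt T P (fun K v x => f K v x + g K v x) = bdryInt T P f + bdryInt T P g := by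
  rw [bdryInt_eq, bdryInt_eq, bdryInt_eq, ← Finset.sum_add_distrib]
  refine Finset.sum_congr rfl fun K hK => ?_
  rw [← Finset.sum_add_distrib]
  refine Finset.sum_congr rfl fun v _ => ?_
  split_ifs
  · exact integral_add (hf K hK v) (hg K hK v)
  · simp

lemma bdryInt_const_mul (c : ℂ) (f : (K : Cell n) → K.verts → E n → ℂ) :
    bdryInt T P (fun K v x => c * f K v x) = c * bdryInt T P f := by
  simp only [bdryInt_eq, integral_const_mul, Finset.mul_sum, mul_ite, mul_zero]

lemma bdryInt_conj (f : (K : Cell n) → K.verts → E n → ℂ) :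
    bdryInt T P (fun K v x => (starRingEnd ℂ) (f K v x)) = (starRingEnd ℂ) (bdryInt T P f) := by
  simp only [bdryInt_eq, integral_conj, map_sum, apply_ite (starRingEnd ℂ), map_zero]

lemma bdryInt_sub {f g : (K : Cell n) → K.verts → E n → ℂ} (hf : BdryIntegrable T f)
    (hg : BdryIntegrable T g) :
    bdryInt T P (fun K v x => f K v x - g K v x) = bdryInt T P f - bdryInt T P g := by
  have hg' : BdryIntegrable T (fun K v x => (-1) * g K v x) :=
    fun K hK v => (hg K hK v).const_mul _
  have := bdryInt_add (P := P) hf hg'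
  rw [bdryInt_const_mul] at this
  rw [sub_eq_add_neg, ← neg_one_mul, ← this]
  exact bdryInt_congr fun K _ v _ x _ => by ring

lemma bdryInt_sum {ι : Type*} (s : Finset ι) {f : ι → (K : Cell n) → K.verts → E n → ℂ}
    (hf : ∀ i ∈ s, BdryIntegrable T (f i)) :
    bdryInt T P (fun K v x => ∑ i ∈ s, f i K v x) = ∑ i ∈ s, bdryInt T P (f i) := by
  simp only [bdryInt_eq]
  rw [Finset.sum_comm]
  refine Finset.sum_congr rfl fun K hK => ?_
  rw [Finset.sum_comm]
  refine Finset.sum_congr rfl fun v _ => ?_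
  split_ifs
  · exact integral_finsetSum _ fun i hi => hf i hi K hK v
  · simp

lemma bdryInt_union {Q : Set (Finset (E n))} (h : ∀ F ∈ P, F ∉ Q)
    (f : (K : Cell n) → K.verts → E n → ℂ) :
    bdryInt T (P ∪ Q) f = bdryInt T P f + bdryInt T Q f := by
  rw [bdryInt_eq, bdryInt_eq, bdryInt_eq, ← Finset.sum_add_distrib]
  refine Finset.sum_congr rfl fun K _ => ?_
  rw [← Finset.sum_add_distrib]
  refine Finset.sum_congr rfl fun v _ => ?_
  by_cases h1 : K.face v ∈ P
  · simp [h1, h _ h1]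
  · by_cases h2 : K.face v ∈ Q <;> simp [h1, h2]

lemma bdryInt_univ (P : Set (Finset (E n))) (f : (K : Cell n) → K.verts → E n → ℂ) :
    bdryInt T Set.univ f = bdryInt T P f + bdryInt T Pᶜ f := by
  rw [← Set.union_compl_self P]
  exact bdryInt_union (Q := Pᶜ) (fun F h h' => h' h) f

end Linearity

/-! ### Integrability -/

lemma continuous_conj_comp {X : Type*} [TopologicalSpace X] {f : X → ℂ} (hf : Continuous f) :
    Continuous (fun x => (starRingEnd ℂ) (f x)) := Complex.continuous_conj.comp hf

lemma ContinuousOn.conj_comp {s : Set (E n)} {f : E n → ℂ}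
    (hf : ContinuousOn f s) : ContinuousOn (fun x => (starRingEnd ℂ) (f x)) s :=
  Complex.continuous_conj.comp_continuousOn hf

lemma Cell.integrableOn_facet_of_continuousOn (K : Cell n) (hn : 0 < n) (v : K.verts)
    {f : E n → ℂ} (hf : ContinuousOn f (K.facet v)) :
    IntegrableOn f (K.facet v) (Cell.surf n) := by
  have h1 : IntegrableOn (fun _ => (1 : ℂ)) (K.facet v) (Cell.surf n) :=
    K.integrableOn_facet hn v continuous_const
  simpa using h1.mul_continuousOn hf (K.isCompact_facet v)

/-! ### Integration by parts -/

/-- The divergence theorem is applied to each `q_j w̄`, a polynomial by way of `conjPoly`, and the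
results are summed over `j`. -/
lemma Cell.integral_by_parts (hn : 0 < n) (K : Cell n) (q : Fin n → Poly n) (w : Poly n) :
    (∫ x in K.body, dotC (evV q x) (evV (grad w) x)) +
      (∫ x in K.body, ev (divV q) x * (starRingEnd ℂ) (ev w x)) =
    ∑ v, ∫ x in K.facet v, dotN (evV q x) (K.normal v) * (starRingEnd ℂ) (ev w x)
      ∂(Cell.surf n) := by
  have h : ∀ j, ∫ x in K.body, (ev (q j) x * (starRingEnd ℂ) (ev (pderiv j w) x) +
      ev (pderiv j (q j)) x * (starRingEnd ℂ) (ev w x)) =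
      ∑ v, ∫ x in K.facet v, (K.normal v j : ℂ) * (ev (q j) x * (starRingEnd ℂ) (ev w x))
        ∂(Cell.surf n) := by
    intro j
    have := K.setIntegral_pderiv hn (q j * conjPoly w) j
    simp only [Derivation.leibniz, smul_eq_mul, ev_add, ev_mul, pderiv_conjPoly, ev_conjPoly,
      ← integral_const_mul] at this
    rw [← this]
    congr 1
    funext x
    ring
  have hc := fun p : Poly n => continuous_conj_comp (continuous_ev p)
  have hi : ∀ j ∈ Finset.univ, IntegrableOn (fun x => ev (q j) x *
      (starRingEnd ℂ) (ev (pderiv j w) x) + ev (pderiv j (q j)) x * (starRingEnd ℂ) (ev w x))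
      K.body := fun j _ => K.integrableOn_body
    (((continuous_ev _).mul (hc _)).add ((continuous_ev _).mul (hc _)))
  have h1 : IntegrableOn (fun x => dotC (evV q x) (evV (grad w) x)) K.body :=
    K.integrableOn_body (continuous_finsetSum _ fun j _ => (continuous_ev _).mul (hc _))
  have h2 : IntegrableOn (fun x => ev (divV q) x * (starRingEnd ℂ) (ev w x)) K.body :=
    K.integrableOn_body ((continuous_ev _).mul (hc _))
  rw [← integral_add h1 h2]
  have e : ∀ x, dotC (evV q x) (evV (grad w) x) + ev (divV q) x * (starRingEnd ℂ) (ev w x) =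
      ∑ j, (ev (q j) x * (starRingEnd ℂ) (ev (pderiv j w) x) +
        ev (pderiv j (q j)) x * (starRingEnd ℂ) (ev w x)) := by
    intro x
    rw [Finset.sum_add_distrib, ← Finset.sum_mul, ← ev_sum]
    rfl
  simp only [e]
  rw [integral_finsetSum _ hi, Finset.sum_congr rfl fun j _ => h j, Finset.sum_comm]
  refine Finset.sum_congr rfl fun v _ => ?_
  rw [← integral_finsetSum]
  · congr 1
    funext x
    simp only [dotN, evV, Finset.sum_mul]
    exact Finset.sum_congr rfl fun j _ => by ring
  · intro j _
    exact K.integrableOn_facet hn v (continuous_const.mul ((continuous_ev _).mul (hc _)))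

/-- The identity behind the energy estimate: the two tested equations for a flux `q` and a scalar
`w` with trace `ŵ` leave only the stabilization and the work done on the trace. -/
theorem energy_identity (hn : 0 < n) (T : Finset (Cell n)) (q : Cell n → Fin n → Poly n)
    (w : Cell n → Poly n) (what : Finset (E n) → E n → ℂ) (τ : Cell n → E n → ℂ)
    (hw : ∀ K ∈ T, ∀ v : K.verts, ContinuousOn (what (K.face v)) (K.facet v))
    (hτ : ∀ K ∈ T, ∀ v : K.verts, IntegrableOn (τ K) (K.facet v) (Cell.surf n))
    (fl : (K : Cell n) → K.verts → E n → ℂ)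
    (hfl : fl = fun K v x => dotN (evV (q K) x) (K.normal v) -
      τ K x * (ev (w K) x - what (K.face v) x)) :
    volInt T (fun K x => dotC (evV (q K) x) (evV (grad (w K)) x))
      - bdryInt T Set.univ (fun K v x => fl K v x * (starRingEnd ℂ) (ev (w K) x))
      + (starRingEnd ℂ) (volInt T (fun K x => ev (w K) x * (starRingEnd ℂ) (ev (divV (q K)) x))
        - bdryInt T Set.univ (fun K v x => what (K.face v) x *
            (starRingEnd ℂ) (dotN (evV (q K) x) (K.normal v)))) =
    bdryInt T Set.univ (fun K v x => τ K x * (((ev (w K) x - what (K.face v) x)) *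
        (starRingEnd ℂ) (ev (w K) x - what (K.face v) x)))
      - bdryInt T Set.univ (fun K v x => fl K v x * (starRingEnd ℂ) (what (K.face v) x)) := by
  have hcn : ∀ (K : Cell n) (v : K.verts), Continuous
      (fun x => dotN (evV (q K) x) (K.normal v)) := fun K v =>
    continuous_finsetSum _ fun j _ => (continuous_ev _).mul continuous_const
  have hcd : ∀ K ∈ T, ∀ v : K.verts,
      ContinuousOn (fun x => ev (w K) x - what (K.face v) x) (K.facet v) := fun K hK v =>
    (continuous_ev _).continuousOn.sub (hw K hK v)
  have hflI : ∀ K ∈ T, ∀ v : K.verts, IntegrableOn (fl K v) (K.facet v) (Cell.surf n) := by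
    intro K hK v
    rw [hfl]
    exact (K.integrableOn_facet hn v (hcn K v)).sub
      ((hτ K hK v).mul_continuousOn (hcd K hK v) (K.isCompact_facet v))
  have i0 : BdryIntegrable T (fun K v x => dotN (evV (q K) x) (K.normal v) *
      (starRingEnd ℂ) (ev (w K) x)) := fun K _ v =>
    K.integrableOn_facet hn v ((hcn K v).mul (continuous_conj_comp (continuous_ev _)))
  have i1 : BdryIntegrable T (fun K v x => fl K v x * (starRingEnd ℂ) (ev (w K) x)) :=
    fun K hK v => (hflI K hK v).mul_continuousOn
      (continuous_conj_comp (continuous_ev _)).continuousOn (K.isCompact_facet v)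
  have i2 : BdryIntegrable T (fun K v x => (starRingEnd ℂ) (what (K.face v) x *
      (starRingEnd ℂ) (dotN (evV (q K) x) (K.normal v)))) := fun K hK v =>
    K.integrableOn_facet_of_continuousOn hn v (ContinuousOn.conj_comp
      ((hw K hK v).mul (continuous_conj_comp (hcn K v)).continuousOn))
  have i3 : BdryIntegrable T (fun K v x => τ K x * (((ev (w K) x - what (K.face v) x)) *
        (starRingEnd ℂ) (ev (w K) x - what (K.face v) x))) := fun K hK v =>
    (hτ K hK v).mul_continuousOn ((hcd K hK v).mul (ContinuousOn.conj_comp (hcd K hK v)))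
      (K.isCompact_facet v)
  have i4 : BdryIntegrable T (fun K v x => fl K v x * (starRingEnd ℂ) (what (K.face v) x)) :=
    fun K hK v => (hflI K hK v).mul_continuousOn
      (ContinuousOn.conj_comp (hw K hK v)) (K.isCompact_facet v)
  have hibp : volInt T (fun K x => dotC (evV (q K) x) (evV (grad (w K)) x)) +
      volInt T (fun K x => ev (divV (q K)) x * (starRingEnd ℂ) (ev (w K) x)) =
      bdryInt T Set.univ (fun K v x => dotN (evV (q K) x) (K.normal v) *
        (starRingEnd ℂ) (ev (w K) x)) := by
    simp only [volInt, bdryInt_eq, Set.mem_univ, if_true]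
    rw [← Finset.sum_add_distrib]
    exact Finset.sum_congr rfl fun K _ => K.integral_by_parts hn (q K) (w K)
  have hV : (starRingEnd ℂ) (volInt T (fun K x => ev (w K) x *
      (starRingEnd ℂ) (ev (divV (q K)) x))) =
      volInt T (fun K x => ev (divV (q K)) x * (starRingEnd ℂ) (ev (w K) x)) := by
    rw [← volInt_conj]
    exact volInt_congr fun K _ x _ => by rw [map_mul, Complex.conj_conj, mul_comm]
  rw [map_sub, hV, ← bdryInt_conj, ← bdryInt_sub i3 i4]
  -- Pointwise: since q·n = fl + τ (w - ŵ), the expression q·n (w̄ - conj ŵ) - fl w̄ equals τ |w -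
  -- ŵ|² - fl conj ŵ.
  have key : bdryInt T Set.univ (fun K v x => dotN (evV (q K) x) (K.normal v) *
      (starRingEnd ℂ) (ev (w K) x) - fl K v x * (starRingEnd ℂ) (ev (w K) x) -
      (starRingEnd ℂ) (what (K.face v) x *
        (starRingEnd ℂ) (dotN (evV (q K) x) (K.normal v)))) =
      bdryInt T Set.univ (fun K v x => τ K x * (((ev (w K) x - what (K.face v) x)) *
        (starRingEnd ℂ) (ev (w K) x - what (K.face v) x)) -
        fl K v x * (starRingEnd ℂ) (what (K.face v) x)) := by
    refine bdryInt_congr fun K _ v _ x _ => ?_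
    simp only [hfl, map_mul, map_sub, Complex.conj_conj]
    ring
  have i01 : BdryIntegrable T (fun K v x => dotN (evV (q K) x) (K.normal v) *
      (starRingEnd ℂ) (ev (w K) x) - fl K v x * (starRingEnd ℂ) (ev (w K) x)) :=
    fun K hK v => (i0 K hK v).sub (i1 K hK v)
  rw [← key, bdryInt_sub i01 i2, bdryInt_sub i0 i1, ← hibp]
  ring

end HDG

end

noncomputable section

open scoped Classical
open MeasureTheory MvPolynomial

namespace HDG

variable {n : ℕ}

/-! ### Positivity -/

lemma re_integral_nonneg {α : Type*} [MeasurableSpace α] {μ : Measure α} {f : α → ℂ}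
    (hf : Integrable f μ) (h : ∀ᵐ x ∂μ, 0 ≤ (f x).re) :
    0 ≤ (∫ x, f x ∂μ).re ∧ ((∫ x, f x ∂μ).re = 0 → ∀ᵐ x ∂μ, (f x).re = 0) := by
  have e : (∫ x, f x ∂μ).re = ∫ x, (f x).re ∂μ := (Complex.reCLM.integral_comp_comm hf).symm
  rw [e]
  refine ⟨integral_nonneg_of_ae h, fun h0 => ?_⟩
  exact (integral_eq_zero_iff_of_nonneg_ae h (Complex.reCLM.integrable_comp hf)).1 h0

/-- The integral is handed over as a real number together with its sign and its vanishing criterion,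
which is the form in which it enters the energy balance. -/
lemma volInt_ofReal_nonneg (T : Finset (Cell n)) {r : Cell n → E n → ℝ}
    (hc : ∀ K ∈ T, Continuous (r K)) (h0 : ∀ K ∈ T, ∀ x, 0 ≤ r K x) :
    ∃ R : ℝ, volInt T (fun K x => (r K x : ℂ)) = R ∧ 0 ≤ R ∧
      (R = 0 → ∀ K ∈ T, ∀ᵐ x ∂(volume.restrict K.body), r K x = 0) := by
  refine ⟨∑ K ∈ T, ∫ x in K.body, r K x, ?_, ?_, ?_⟩
  · rw [volInt, Complex.ofReal_sum]
    exact Finset.sum_congr rfl fun K _ => integral_complex_ofReal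
  · exact Finset.sum_nonneg fun K hK => integral_nonneg (h0 K hK)
  · intro h K hK
    rw [Finset.sum_eq_zero_iff_of_nonneg fun K hK => integral_nonneg (h0 K hK)] at h
    exact (integral_eq_zero_iff_of_nonneg (h0 K hK)
      ((hc K hK).continuousOn.integrableOn_compact K.isCompact_body)).1 (h K hK)

/-- A vanishing sum of nonnegative face integrals has vanishing terms. Only real parts are compared
because the stabilization is complex. -/
lemma bdryInt_re_nonneg (T : Finset (Cell n)) {f : (K : Cell n) → K.verts → E n → ℂ}
    (hf : BdryIntegrable T f)
    (h0 : ∀ K ∈ T, ∀ v : K.verts, ∀ᵐ x ∂((Cell.surf n).restrict (K.facet v)), 0 ≤ (f K v x).re) :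
    0 ≤ (bdryInt T Set.univ f).re ∧ ((bdryInt T Set.univ f).re = 0 → ∀ K ∈ T, ∀ v : K.verts,
      ∀ᵐ x ∂((Cell.surf n).restrict (K.facet v)), (f K v x).re = 0) := by
  have e : (bdryInt T Set.univ f).re =
      ∑ K ∈ T, ∑ v : K.verts, (∫ x in K.facet v, f K v x ∂(Cell.surf n)).re := by
    simp only [bdryInt_eq, Set.mem_univ, if_true, Complex.re_sum]
  have hp : ∀ K ∈ T, ∀ v : K.verts, 0 ≤ (∫ x in K.facet v, f K v x ∂(Cell.surf n)).re :=
    fun K hK v => (re_integral_nonneg (hf K hK v) (h0 K hK v)).1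
  have hp' : ∀ K ∈ T, 0 ≤ ∑ v : K.verts, (∫ x in K.facet v, f K v x ∂(Cell.surf n)).re :=
    fun K hK => Finset.sum_nonneg fun v _ => hp K hK v
  rw [e]
  refine ⟨Finset.sum_nonneg hp', fun h K hK v => ?_⟩
  have h1 := (Finset.sum_eq_zero_iff_of_nonneg hp').1 h K hK
  have h2 := (Finset.sum_eq_zero_iff_of_nonneg fun v _ => hp K hK v).1 h1 v (Finset.mem_univ v)
  exact (re_integral_nonneg (hf K hK v) (h0 K hK v)).2 h2

/-- The squared Frobenius norm of a matrix. -/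
def frobSq (A : Matrix (Fin n) (Fin n) ℂ) : ℝ := ∑ i, ∑ j, Complex.normSq (A i j)

lemma frobSq_nonneg (A : Matrix (Fin n) (Fin n) ℂ) : 0 ≤ frobSq A :=
  Finset.sum_nonneg fun _ _ => Finset.sum_nonneg fun _ _ => Complex.normSq_nonneg _

/-- The quadratic form of the inverse of Hooke's tensor. -/
def hookeForm (P : Params n) (A : Matrix (Fin n) (Fin n) ℂ) : ℝ :=
  1 / (2 * P.mu) * frobSq A -
    P.lam / (2 * P.mu * (n * P.lam + 2 * P.mu)) * Complex.normSq A.trace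

lemma frobC_self (A : Matrix (Fin n) (Fin n) ℂ) : frobC A A = (frobSq A : ℂ) := by
  simp only [frobC, frobSq, Complex.ofReal_sum, Complex.mul_conj]

lemma frobC_hookeInv (P : Params n) (A : Matrix (Fin n) (Fin n) ℂ) :
    frobC (hookeInv P A) A = (hookeForm P A : ℂ) := by
  have h1 : ∀ i j, hookeInv P A i j * (starRingEnd ℂ) (A i j) =
      ((1 / (2 * P.mu) : ℝ) : ℂ) * (A i j * (starRingEnd ℂ) (A i j)) -
      (((P.lam / (2 * P.mu * (n * P.lam + 2 * P.mu)) : ℝ) : ℂ) * A.trace) *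
        (if i = j then (starRingEnd ℂ) (A i j) else 0) := by
    intro i j
    simp only [hookeInv, Matrix.sub_apply, Matrix.smul_apply, Matrix.one_apply, smul_eq_mul]
    split_ifs <;> ring
  have h2 : ∑ i, ∑ j, (if i = j then (starRingEnd ℂ) (A i j) else 0) =
      (starRingEnd ℂ) A.trace := by
    simp [Matrix.trace]
  simp only [frobC, h1, Finset.sum_sub_distrib, ← Finset.mul_sum, h2]
  have h3 := frobC_self A
  rw [frobC] at h3
  rw [h3, mul_assoc, Complex.mul_conj, hookeForm, Complex.ofReal_sub, Complex.ofReal_mul,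
    Complex.ofReal_mul]

/-- Cauchy–Schwarz on the `n` diagonal entries. -/
lemma normSq_trace_le (A : Matrix (Fin n) (Fin n) ℂ) :
    Complex.normSq A.trace ≤ n * frobSq A := by
  have h1 : ‖A.trace‖ ≤ ∑ i, ‖A i i‖ := norm_sum_le _ _
  have h2 : (∑ i, ‖A i i‖) ^ 2 ≤ n * ∑ i, ‖A i i‖ ^ 2 := by
    simpa using sq_sum_le_card_mul_sum_sq (s := Finset.univ) (f := fun i => ‖A i i‖)
  have h3 : ∑ i, ‖A i i‖ ^ 2 ≤ frobSq A := by
    refine Finset.sum_le_sum fun i _ => ?_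
    rw [← Complex.normSq_eq_norm_sq]
    exact Finset.single_le_sum (f := fun j => Complex.normSq (A i j))
      (fun j _ => Complex.normSq_nonneg _) (Finset.mem_univ i)
  rw [Complex.normSq_eq_norm_sq]
  calc ‖A.trace‖ ^ 2 ≤ (∑ i, ‖A i i‖) ^ 2 := by gcongr
    _ ≤ n * ∑ i, ‖A i i‖ ^ 2 := h2
    _ ≤ n * frobSq A := by gcongr

/-- For λ ≥ 0 the trace bound leaves 1/(2μ) - nλ/(2μ(nλ+2μ)) = 1/(nλ+2μ), the eigenvalue on
multiples of the identity. For λ ≤ 0 the trace term has the favourable sign and 1/(2μ), the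
eigenvalue on trace-free matrices, remains. -/
lemma exists_le_hookeForm (P : Params n) (hmu : 0 < P.mu) (hlam : 0 < n * P.lam + 2 * P.mu) :
    ∃ m : ℝ, 0 < m ∧ ∀ A, m * frobSq A ≤ hookeForm P A := by
  rcases le_total 0 P.lam with hl | hl
  · refine ⟨1 / (n * P.lam + 2 * P.mu), by positivity, fun A => ?_⟩
    have h := normSq_trace_le A
    have hb : 0 ≤ P.lam / (2 * P.mu * (n * P.lam + 2 * P.mu)) := by positivity
    have e : 1 / (n * P.lam + 2 * P.mu) = 1 / (2 * P.mu) -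
        P.lam / (2 * P.mu * (n * P.lam + 2 * P.mu)) * n := by
      field_simp
      ring
    have := mul_le_mul_of_nonneg_left h hb
    rw [hookeForm, e]
    linarith
  · refine ⟨1 / (2 * P.mu), by positivity, fun A => ?_⟩
    have hb : P.lam / (2 * P.mu * (n * P.lam + 2 * P.mu)) ≤ 0 :=
      div_nonpos_of_nonpos_of_nonneg hl (by positivity)
    have := mul_nonneg (neg_nonneg.2 hb) (Complex.normSq_nonneg A.trace)
    rw [hookeForm]
    linarith

lemma continuous_frobSq_evM (A : MatPoly n) : Continuous (fun x => frobSq (evM A x)) :=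
  continuous_finsetSum _ fun _ _ => continuous_finsetSum _ fun _ _ =>
    Complex.continuous_normSq.comp (continuous_ev _)

lemma continuous_hookeForm_evM (P : Params n) (A : MatPoly n) :
    Continuous (fun x => hookeForm P (evM A x)) := by
  refine (continuous_const.mul (continuous_frobSq_evM A)).sub (continuous_const.mul ?_)
  exact Complex.continuous_normSq.comp (continuous_finsetSum _ fun i _ => continuous_ev (A i i))

lemma eq_zero_of_frobSq_ae (K : Cell n) {A : MatPoly n}
    (h : ∀ᵐ x ∂(volume.restrict K.body), frobSq (evM A x) = 0) : A = 0 := by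
  refine Matrix.ext fun i j => K.eq_zero_of_ae_body ?_
  filter_upwards [h] with x hx
  have h1 := (Finset.sum_eq_zero_iff_of_nonneg fun i _ =>
    Finset.sum_nonneg fun j _ => Complex.normSq_nonneg (evM A x i j)).1 hx i (Finset.mem_univ i)
  have h2 := (Finset.sum_eq_zero_iff_of_nonneg fun j _ =>
    Complex.normSq_nonneg (evM A x i j)).1 h1 j (Finset.mem_univ j)
  exact Complex.normSq_eq_zero.1 h2

/-- The squared Hermitian norm of a vector. -/
def vecSq (a : Fin n → ℂ) : ℝ := ∑ i, Complex.normSq (a i)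

lemma vecSq_nonneg (a : Fin n → ℂ) : 0 ≤ vecSq a :=
  Finset.sum_nonneg fun _ _ => Complex.normSq_nonneg _

lemma dotC_self (a : Fin n → ℂ) : dotC a a = (vecSq a : ℂ) := by
  simp only [dotC, vecSq, Complex.ofReal_sum, Complex.mul_conj]

lemma eq_zero_of_vecSq_eq_zero {a : Fin n → ℂ} (h : vecSq a = 0) (i : Fin n) : a i = 0 :=
  Complex.normSq_eq_zero.1 ((Finset.sum_eq_zero_iff_of_nonneg fun i _ =>
    Complex.normSq_nonneg (a i)).1 h i (Finset.mem_univ i))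

lemma continuous_vecSq_evV (a : Fin n → Poly n) : Continuous (fun x => vecSq (evV a x)) :=
  continuous_finsetSum _ fun _ _ => Complex.continuous_normSq.comp (continuous_ev _)

lemma eq_zero_of_vecSq_ae (K : Cell n) {a : Fin n → Poly n}
    (h : ∀ᵐ x ∂(volume.restrict K.body), vecSq (evV a x) = 0) : a = 0 := by
  funext i
  refine K.eq_zero_of_ae_body ?_
  filter_upwards [h] with x hx
  exact eq_zero_of_vecSq_eq_zero hx i

/-! ### The energy identity for vector-valued unknowns -/

lemma bdryIntegrable_mul_conj {T : Finset (Cell n)} {f g : (K : Cell n) → K.verts → E n → ℂ}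
    (hf : BdryIntegrable T f) (hg : ∀ K ∈ T, ∀ v : K.verts, ContinuousOn (g K v) (K.facet v)) :
    BdryIntegrable T (fun K v x => f K v x * (starRingEnd ℂ) (g K v x)) := fun K hK v =>
  (hf K hK v).mul_continuousOn (ContinuousOn.conj_comp (hg K hK v)) (K.isCompact_facet v)

lemma continuous_dotN_evV (q : Fin n → Poly n) (ν : Fin n → ℝ) :
    Continuous (fun x => dotN (evV q x) ν) :=
  continuous_finsetSum _ fun _ _ => (continuous_ev _).mul continuous_const

lemma bdryIntegrable_flux (hn : 0 < n) {T : Finset (Cell n)} (q : Cell n → Fin n → Poly n)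
    (w : Cell n → Poly n) {what : Finset (E n) → E n → ℂ} {τ : Cell n → E n → ℂ}
    (hw : ∀ K ∈ T, ∀ v : K.verts, ContinuousOn (what (K.face v)) (K.facet v))
    (hτ : ∀ K ∈ T, ∀ v : K.verts, IntegrableOn (τ K) (K.facet v) (Cell.surf n)) :
    BdryIntegrable T (fun K v x => dotN (evV (q K) x) (K.normal v) -
      τ K x * (ev (w K) x - what (K.face v) x)) := fun K hK v =>
  (K.integrableOn_facet hn v (continuous_dotN_evV _ _)).sub
    ((hτ K hK v).mul_continuousOn ((continuous_ev _).continuousOn.sub (hw K hK v))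
      (K.isCompact_facet v))

/-- The stabilization acts on each component separately, so the scalar identity can be applied to
each row of the stress with the matching component of the displacement, and summed. -/
theorem energy_identity_vector (hn : 0 < n) (T : Finset (Cell n)) (S : Cell n → MatPoly n)
    (u : Cell n → Fin n → Poly n) (uhat : Finset (E n) → Fin n → E n → ℂ) (τ : Cell n → E n → ℂ)
    (hw : ∀ K ∈ T, ∀ v : K.verts, ∀ i, ContinuousOn (uhat (K.face v) i) (K.facet v))
    (hτ : ∀ K ∈ T, ∀ v : K.verts, IntegrableOn (τ K) (K.facet v) (Cell.surf n))
    (fl : (K : Cell n) → K.verts → E n → Fin n → ℂ)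
    (hfl : fl = fun K v x i => mulN (evM (S K) x) (K.normal v) i -
      τ K x * (ev (u K i) x - uhat (K.face v) i x)) :
    volInt T (fun K x => frobC (evM (S K) x) (evM (gradV (u K)) x))
      - bdryInt T Set.univ (fun K v x => dotC (fl K v x) (evV (u K) x))
      + (starRingEnd ℂ) (volInt T (fun K x => dotC (evV (u K) x) (evV (divM (S K)) x))
        - bdryInt T Set.univ (fun K v x => dotC (fun i => uhat (K.face v) i x)
            (mulN (evM (S K) x) (K.normal v)))) =
    bdryInt T Set.univ (fun K v x => τ K x *
        (vecSq (fun i => ev (u K i) x - uhat (K.face v) i x) : ℂ))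
      - bdryInt T Set.univ (fun K v x => dotC (fl K v x) (fun i => uhat (K.face v) i x)) := by
  have hw' : ∀ i, ∀ K ∈ T, ∀ v : K.verts, ContinuousOn (uhat (K.face v) i) (K.facet v) :=
    fun i K hK v => hw K hK v i
  have hI : ∀ i, BdryIntegrable T (fun K v x => fl K v x i) := fun i => by
    rw [hfl]
    exact bdryIntegrable_flux hn (fun K => S K i) (fun K => u K i)
      (what := fun F => uhat F i) (hw' i) hτ
  have hc : ∀ p : Poly n, Continuous fun x => (starRingEnd ℂ) (ev p x) :=
    fun p => continuous_conj_comp (continuous_ev p)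
  have id := Finset.sum_congr (rfl : (Finset.univ : Finset (Fin n)) = Finset.univ) fun i _ =>
    energy_identity hn T (fun K => S K i) (fun K => u K i) (fun F => uhat F i) τ (hw' i) hτ
      (fun K v x => fl K v x i) (by rw [hfl]; rfl)
  simp only [Finset.sum_add_distrib, Finset.sum_sub_distrib, ← map_sum] at id
  rw [← volInt_sum, ← volInt_sum, ← bdryInt_sum, ← bdryInt_sum, ← bdryInt_sum,
    ← bdryInt_sum] at id
  · have e : ∀ (K : Cell n) (v : K.verts) (x : E n),
        τ K x * (vecSq (fun i => ev (u K i) x - uhat (K.face v) i x) : ℂ) =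
        ∑ i, τ K x * ((ev (u K i) x - uhat (K.face v) i x) *
          (starRingEnd ℂ) (ev (u K i) x - uhat (K.face v) i x)) := by
      intro K v x
      rw [← dotC_self, dotC, Finset.mul_sum]
    simp only [e]
    exact id
  · exact fun i _ => bdryIntegrable_mul_conj (hI i) (hw' i)
  · intro i _ K hK v
    have hcd := (continuous_ev (u K i)).continuousOn.sub (hw K hK v i)
    exact (hτ K hK v).mul_continuousOn (hcd.mul (ContinuousOn.conj_comp hcd))
      (K.isCompact_facet v)
  · exact fun i _ K hK v => K.integrableOn_facet_of_continuousOn hn v ((hw K hK v i).mul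
      (continuous_conj_comp (continuous_dotN_evV _ _)).continuousOn)
  · exact fun i _ => bdryIntegrable_mul_conj (hI i) fun K _ v => (continuous_ev _).continuousOn
  · exact fun i _ K hK => K.integrableOn_body ((continuous_ev _).mul (hc _))
  · exact fun i _ K hK => K.integrableOn_body
      (continuous_finsetSum _ fun _ _ => (continuous_ev _).mul (hc _))

end HDG

end

noncomputable section

open scoped Classical
open MeasureTheory MvPolynomial

namespace HDG

variable {n : ℕ}

/-! ### Vanishing arguments -/

section Zero

variable (x : E n)

@[simp] lemma evM_zero : evM (0 : MatPoly n) x = 0 := by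
  ext i j
  exact ev_zero x

@[simp] lemma evV_zero : evV (0 : Fin n → Poly n) x = fun _ => 0 := by
  funext i
  exact ev_zero x

@[simp] lemma hookeInv_zero (P : Params n) : hookeInv P 0 = 0 := by simp [hookeInv]

@[simp] lemma frobC_zero_left (A : Matrix (Fin n) (Fin n) ℂ) : frobC 0 A = 0 := by simp [frobC]

@[simp] lemma frobC_zero_right (A : Matrix (Fin n) (Fin n) ℂ) : frobC A 0 = 0 := by simp [frobC]

@[simp] lemma dotC_zero_left (a : Fin n → ℂ) : dotC (fun _ => 0) a = 0 := by simp [dotC]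

@[simp] lemma dotC_zero_right (a : Fin n → ℂ) : dotC a (fun _ => 0) = 0 := by simp [dotC]

@[simp] lemma mulN_zero (ν : Fin n → ℝ) : mulN 0 ν = fun _ => 0 := by
  funext i
  simp [mulN]

@[simp] lemma dotN_zero (ν : Fin n → ℝ) : dotN (fun _ => 0) ν = 0 := by simp [dotN]

@[simp] lemma grad_zero : grad (0 : Poly n) = 0 := by
  funext j
  simp [grad]

@[simp] lemma gradV_zero : gradV (0 : Fin n → Poly n) = 0 := by
  ext i j : 2
  simp [gradV]

@[simp] lemma divV_zero : divV (0 : Fin n → Poly n) = 0 := by simp [divV]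

@[simp] lemma divM_zero : divM (0 : MatPoly n) = 0 := by
  funext i
  simp [divM]

lemma facePoly_zero (s : Set (E n)) : s.indicator (ev (0 : Poly n)) = 0 := by
  have : ev (0 : Poly n) = fun _ => 0 := funext ev_zero
  rw [this]
  exact Set.indicator_zero _ _

end Zero

/-! ### Uniqueness -/

/-- Vanishing data. -/
def zeroData (n : ℕ) : Data n := ⟨0, 0, 0, 0, 0, 0⟩

lemma IsFacePoly.continuousOn {k : ℕ} {F : Finset (E n)} {ξ : E n → ℂ} (h : IsFacePoly k F ξ) :
    ContinuousOn ξ (convexHull ℝ (F : Set (E n))) := by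
  obtain ⟨p, -, rfl⟩ := h
  exact (continuous_ev p).continuousOn.congr fun x hx => Set.indicator_of_mem hx _

lemma IsFacePoly.eq_zero (hn : 0 < n) {k : ℕ} (K : Cell n) (v : K.verts) {ξ : E n → ℂ}
    (h : IsFacePoly k (K.face v) ξ)
    (h0 : ∀ᵐ x ∂((Cell.surf n).restrict (K.facet v)), ξ x = 0) : ξ = 0 := by
  obtain ⟨p, -, rfl⟩ := h
  have h1 : ∀ᵐ x ∂((Cell.surf n).restrict (K.facet v)), ev p x = 0 := by
    filter_upwards [h0, ae_restrict_mem (K.measurableSet_facet v)] with x hx hxF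
    exact (Set.indicator_of_mem hxF _).symm.trans hx
  have h2 := K.eq_zero_of_ae_facet hn v (continuous_ev p) h1
  funext x
  by_cases hx : x ∈ K.facet v
  · exact (Set.indicator_of_mem hx _).trans (h2 x hx)
  · exact Set.indicator_of_notMem hx _

lemma face_mem_faces {T : Finset (Cell n)} {K : Cell n} (hK : K ∈ T) (v : K.verts) :
    K.face v ∈ faces T := ⟨K, hK, v, rfl⟩

/-- Makes the rotation admissible as a test function in the constitutive equation. -/
lemma skewK_le_stressK (k : ℕ) (K : Cell n) : skewK n k ≤ stressK n k K :=
  le_trans (show skewK n k ≤ polyMK n k from fun _ h i j => h.1 i j) le_sup_left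

/-- Vanishing of the trace from vanishing of the dissipation by the stabilization. -/
lemma ae_eq_zero_of_weighted {α : Type*} [MeasurableSpace α] {μ : Measure α} {s : ℂ} {τ : α → ℂ}
    {r : α → ℝ} (hτ : ∀ᵐ x ∂μ, 0 < (s * (starRingEnd ℂ) (τ x)).re)
    (h : ∀ᵐ x ∂μ, ((starRingEnd ℂ) s * (τ x * (r x : ℂ))).re = 0) : ∀ᵐ x ∂μ, r x = 0 := by
  filter_upwards [hτ, h] with x h1 h2
  have e : ((starRingEnd ℂ) s * (τ x * (r x : ℂ))).re =
      (s * (starRingEnd ℂ) (τ x)).re * r x := by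
    simp only [Complex.mul_re, Complex.mul_im, Complex.conj_re, Complex.conj_im,
      Complex.ofReal_re, Complex.ofReal_im]
    ring
  rw [e] at h2
  exact (mul_eq_zero.1 h2).resolve_left h1.ne'

/-- Re(s̄ τ) = Re(s τ̄): the assumption on the stabilization is the sign of its contribution once
the balance is multiplied by s̄. -/
lemma weighted_nonneg {α : Type*} [MeasurableSpace α] {μ : Measure α} {s : ℂ} {τ : α → ℂ}
    {r : α → ℝ} (hτ : ∀ᵐ x ∂μ, 0 < (s * (starRingEnd ℂ) (τ x)).re) (hr : ∀ x, 0 ≤ r x) :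
    ∀ᵐ x ∂μ, 0 ≤ ((starRingEnd ℂ) s * (τ x * (r x : ℂ))).re := by
  filter_upwards [hτ] with x h1
  have e : ((starRingEnd ℂ) s * (τ x * (r x : ℂ))).re =
      (s * (starRingEnd ℂ) (τ x)).re * r x := by
    simp only [Complex.mul_re, Complex.mul_im, Complex.conj_re, Complex.conj_im,
      Complex.ofReal_re, Complex.ofReal_im]
    ring
  rw [e]
  exact mul_nonneg h1.le (hr x)

variable {M : CoupledMesh n} {k : ℕ} {P : Params n} {U : Fields n}

/-- The homogeneous Dirichlet equation, tested with the trace itself, is the vanishing of the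
integral of |v̂|² over the Dirichlet faces. -/
lemma potTrace_dirichlet_eq_zero (hn : 0 < n) (h : IsSolution M k P (zeroData n) U) {K : Cell n}
    (hK : K ∈ M.TA) {v : K.verts} (hv : K.face v ∈ M.dirichlet) :
    U.potTrace (K.face v) = 0 := by
  have hw : ∀ K ∈ M.TA, ∀ v : K.verts, ContinuousOn (U.potTrace (K.face v)) (K.facet v) :=
    fun K hK v => (h.mem.potTrace_mem _ (face_mem_faces hK v)).continuousOn
  have hdir := h.dirichletBC U h.mem
  simp only [zeroData, Pi.zero_apply, zero_mul, bdryInt_zero] at hdir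
  -- Cut off outside the Dirichlet faces, so that the criterion for integrals over all faces
  -- applies.
  set f : (K : Cell n) → K.verts → E n → ℂ := fun K v x =>
    if K.face v ∈ M.dirichlet then
      U.potTrace (K.face v) x * (starRingEnd ℂ) (U.potTrace (K.face v) x) else 0 with hf
  have e : bdryInt M.TA Set.univ f = 0 := by
    rw [bdryInt_univ M.dirichlet, ← hdir]
    have e1 : bdryInt M.TA M.dirichletᶜ f = 0 :=
      bdryInt_eq_zero fun K _ v hv x _ => if_neg hv
    rw [e1, add_zero]
    exact bdryInt_congr fun K _ v hv x _ => if_pos hv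
  have hfI : BdryIntegrable M.TA f := by
    intro K hK v
    refine K.integrableOn_facet_of_continuousOn hn v ?_
    by_cases hv : K.face v ∈ M.dirichlet
    · simp only [hf, if_pos hv]
      exact (hw K hK v).mul (ContinuousOn.conj_comp (hw K hK v))
    · simp only [hf, if_neg hv]
      exact continuousOn_const
  have hf0 : ∀ K ∈ M.TA, ∀ v : K.verts, ∀ᵐ x ∂((Cell.surf n).restrict (K.facet v)),
      0 ≤ (f K v x).re := by
    refine fun K _ v => Filter.Eventually.of_forall fun x => ?_
    simp only [hf, Complex.mul_conj]
    split_ifs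
    · exact Complex.normSq_nonneg _
    · exact le_rfl
  have h0 := (bdryInt_re_nonneg M.TA hfI hf0).2 (by rw [e]; rfl) K hK v
  refine IsFacePoly.eq_zero hn K v (h.mem.potTrace_mem _ (face_mem_faces hK v)) ?_
  filter_upwards [h0] with x hx
  simp only [hf, if_pos hv, Complex.mul_conj, Complex.ofReal_re] at hx
  exact Complex.normSq_eq_zero.1 hx

/-- The acoustic energy balance. -/
lemma acoustic_balance (hn : 0 < n) (htauA : StabAdmissible M.TA P.s P.tauA)
    (h : IsSolution M k P (zeroData n) U) :
    (starRingEnd ℂ) (volInt M.TA (fun K x => dotC (evV (U.vel K) x) (evV (U.vel K) x)))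
    + bdryInt M.TA Set.univ (fun K v x => P.tauA K x *
        (Complex.normSq (ev (U.pot K) x - U.potTrace (K.face v) x) : ℂ))
    + (P.s / P.c) ^ 2 * volInt M.TA (fun K x => ev (U.pot K) x * (starRingEnd ℂ) (ev (U.pot K) x))
    - P.s * bdryInt M.TE M.interface (fun K v x => dotN (fun i => U.dispTrace (K.face v) i x)
        (K.normal v) * (starRingEnd ℂ) (U.potTrace (K.face v) x)) = 0 := by
  have hw : ∀ K ∈ M.TA, ∀ v : K.verts, ContinuousOn (U.potTrace (K.face v)) (K.facet v) :=
    fun K hK v => (h.mem.potTrace_mem _ (face_mem_faces hK v)).continuousOn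
  have hτ : ∀ K ∈ M.TA, ∀ v : K.verts, IntegrableOn (P.tauA K) (K.facet v) (Cell.surf n) :=
    fun K hK v => (htauA K hK v).1
  have id := energy_identity hn M.TA U.vel U.pot U.potTrace P.tauA hw hτ (acFlux P U) rfl
  simp only [Complex.mul_conj] at id
  have hv := congrArg (starRingEnd ℂ) (h.velocity U h.mem)
  have hwv := h.wave U h.mem
  have hcont := h.acContinuity U h.mem
  have hdir := h.dirichletBC U h.mem
  have hkin := h.kinematic U h.mem
  simp only [zeroData, Pi.zero_apply, zero_mul, volInt_zero, bdryInt_zero] at hwv hcont hdir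
  have hkin0 : bdryInt M.TA M.interface (fun K v x => dotN ((zeroData n).gradVinc x) (K.normal v) *
          (starRingEnd ℂ) (U.potTrace (K.face v) x)) = 0 :=
    bdryInt_eq_zero fun K _ v _ x _ => by simp [zeroData, dotN]
  rw [hkin0, neg_zero, sub_eq_zero] at hkin
  -- No equation controls the flux on Dirichlet faces; the trace it is paired with vanishes instead.
  have hD : bdryInt M.TA M.dirichlet (fun K v x => acFlux P U K v x *
      (starRingEnd ℂ) (U.potTrace (K.face v) x)) = 0 :=
    bdryInt_eq_zero fun K hK v hv x _ => by
      rw [potTrace_dirichlet_eq_zero hn h hK hv]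
      simp
  -- The flux does work on the trace only on the interface, where the kinematic condition expresses
  -- it through the elastic trace.
  have hsplit : bdryInt M.TA Set.univ (fun K v x => acFlux P U K v x *
      (starRingEnd ℂ) (U.potTrace (K.face v) x)) =
      P.s * bdryInt M.TE M.interface (fun K v x => dotN (fun i => U.dispTrace (K.face v) i x)
        (K.normal v) * (starRingEnd ℂ) (U.potTrace (K.face v) x)) := by
    rw [bdryInt_univ (M.interface ∪ M.dirichlet), hcont,
      bdryInt_union (fun F h1 h2 => M.disjoint_interface_dirichlet h1 h2), hD, hkin, add_zero,
      add_zero, ← bdryInt_const_mul]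
    exact bdryInt_congr fun K _ v _ x _ => by ring
  rw [hsplit] at id
  simp only [map_sub, map_add, map_zero] at hv id
  linear_combination hv + hwv - id

/-- The elastic energy balance. -/
lemma elastic_balance (hn : 0 < n) (htauE : StabAdmissible M.TE P.s P.tauE)
    (h : IsSolution M k P (zeroData n) U) :
    (starRingEnd ℂ) (volInt M.TE (fun K x => frobC (hookeInv P (evM (U.stress K) x))
      (evM (U.stress K) x)))
    + bdryInt M.TE Set.univ (fun K v x => P.tauE K x *
        (vecSq (fun i => ev (U.disp K i) x - U.dispTrace (K.face v) i x) : ℂ))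
    + P.rhoE * P.s ^ 2 * volInt M.TE (fun K x => dotC (evV (U.disp K) x) (evV (U.disp K) x))
    + P.rhoF * P.s * (starRingEnd ℂ) (bdryInt M.TE M.interface
        (fun K v x => dotN (fun i => U.dispTrace (K.face v) i x)
        (K.normal v) * (starRingEnd ℂ) (U.potTrace (K.face v) x))) = 0 := by
  have hw : ∀ K ∈ M.TE, ∀ v : K.verts, ∀ i,
      ContinuousOn (U.dispTrace (K.face v) i) (K.facet v) :=
    fun K hK v i => (h.mem.dispTrace_mem _ (face_mem_faces hK v) i).continuousOn
  have hτ : ∀ K ∈ M.TE, ∀ v : K.verts, IntegrableOn (P.tauE K) (K.facet v) (Cell.surf n) :=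
    fun K hK v => (htauE K hK v).1
  have id := energy_identity_vector hn M.TE U.stress U.disp U.dispTrace P.tauE hw hτ
    (elFlux P U) rfl
  have hv := congrArg (starRingEnd ℂ) (h.hooke U h.mem)
  have hwv := h.momentum U h.mem
  have hsym := h.symmetry U h.mem
  have hcont := h.elContinuity U h.mem
  have hdyn := h.dynamic U h.mem
  have hwv0 : volInt M.TE (fun K x => dotC ((zeroData n).fE x) (evV (U.disp K) x)) = 0 :=
    (volInt_congr fun K _ x _ => by simp [zeroData, dotC]).trans (volInt_zero _)
  have hdyn0 : bdryInt M.TA M.interface (fun K v x => dotC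
        (fun i => (zeroData n).vinc x * (K.normal v i : ℂ))
        (fun i => U.dispTrace (K.face v) i x)) = 0 :=
    bdryInt_eq_zero fun K _ v _ x _ => by simp [zeroData, dotC]
  -- The weak symmetry of the stress, tested with the rotation.
  have hrot : volInt M.TE (fun K x => frobC (evM (U.rot K) x) (evM (U.stress K) x)) = 0 := by
    have e : volInt M.TE (fun K x => frobC (evM (U.rot K) x) (evM (U.stress K) x)) =
        (starRingEnd ℂ) (volInt M.TE
          (fun K x => frobC (evM (U.stress K) x) (evM (U.rot K) x))) := by
      rw [← volInt_conj]
      refine volInt_congr fun K _ x _ => ?_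
      simp only [frobC, map_sum, map_mul, Complex.conj_conj]
      exact Finset.sum_congr rfl fun i _ => Finset.sum_congr rfl fun j _ => mul_comm _ _
    rw [e, hsym, map_zero]
  rw [hwv0] at hwv
  rw [hdyn0, mul_zero] at hdyn
  rw [hrot] at hv
  -- The dynamic condition is integrated on the acoustic side. Passing to the elastic side, n_A =
  -- -n_E gives the sign that later cancels the coupling term of the acoustic balance.
  have hswap : bdryInt M.TA M.interface (fun K v x => dotC
        (fun i => P.rhoF * P.s * U.potTrace (K.face v) x * (K.normal v i : ℂ))
        (fun i => U.dispTrace (K.face v) i x)) =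
      -(P.rhoF * P.s * (starRingEnd ℂ) (bdryInt M.TE M.interface
        (fun K v x => dotN (fun i => U.dispTrace (K.face v) i x)
        (K.normal v) * (starRingEnd ℂ) (U.potTrace (K.face v) x)))) := by
    have := M.bdryInt_interface_swap hn (fun F ν x => dotC
        (fun i => P.rhoF * P.s * U.potTrace F x * (ν i : ℂ)) (fun i => U.dispTrace F i x))
    rw [this, ← bdryInt_conj, ← neg_mul, ← bdryInt_const_mul]
    refine bdryInt_congr fun K _ v _ x _ => ?_
    simp only [dotC, dotN, map_mul, map_sum, Complex.conj_conj, Complex.conj_ofReal,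
      Finset.sum_mul, Finset.mul_sum]
    refine Finset.sum_congr rfl fun i _ => ?_
    push_cast
    ring
  have hsplit : bdryInt M.TE Set.univ (fun K v x => dotC (elFlux P U K v x)
      (fun i => U.dispTrace (K.face v) i x)) =
      -(P.rhoF * P.s * (starRingEnd ℂ) (bdryInt M.TE M.interface
        (fun K v x => dotN (fun i => U.dispTrace (K.face v) i x)
        (K.normal v) * (starRingEnd ℂ) (U.potTrace (K.face v) x)))) := by
    rw [bdryInt_univ M.interface, hcont, add_zero, ← hswap]
    linear_combination -hdyn
  rw [hsplit] at id
  simp only [map_sub, map_add, map_zero] at hv id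
  linear_combination hv + hwv - id

/-- The scheme with vanishing data has only the trivial solution. -/
theorem eq_zero_of_homogeneous (hn : 0 < n) (hmu : 0 < P.mu) (hlam : 0 < n * P.lam + 2 * P.mu)
    (hrhoE : 0 < P.rhoE) (hrhoF : 0 < P.rhoF) (hc : 0 < P.c) (hs : 0 < P.s.re)
    (htauA : StabAdmissible M.TA P.s P.tauA) (htauE : StabAdmissible M.TE P.s P.tauE)
    (h : IsSolution M k P (zeroData n) U) : U = ⟨0, 0, 0, 0, 0, 0, 0⟩ := by
  have hA := acoustic_balance hn htauA h
  have hE := elastic_balance hn htauE h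
  have hwE : ∀ K ∈ M.TE, ∀ v : K.verts, ∀ i,
      ContinuousOn (U.dispTrace (K.face v) i) (K.facet v) :=
    fun K hK v i => (h.mem.dispTrace_mem _ (face_mem_faces hK v) i).continuousOn
  have hwA : ∀ K ∈ M.TA, ∀ v : K.verts, ContinuousOn (U.potTrace (K.face v)) (K.facet v) :=
    fun K hK v => (h.mem.potTrace_mem _ (face_mem_faces hK v)).continuousOn
  obtain ⟨m, hm, hform⟩ := exists_le_hookeForm P hmu hlam
  have hform0 : ∀ A, 0 ≤ hookeForm P A := fun A =>
    le_trans (mul_nonneg hm.le (frobSq_nonneg A)) (hform A)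
  obtain ⟨RH, eH, pH, zH⟩ := volInt_ofReal_nonneg M.TE
    (r := fun K x => hookeForm P (evM (U.stress K) x))
    (fun K _ => continuous_hookeForm_evM P _) (fun K _ x => hform0 _)
  obtain ⟨RU, eU, pU, zU⟩ := volInt_ofReal_nonneg M.TE (r := fun K x => vecSq (evV (U.disp K) x))
    (fun K _ => continuous_vecSq_evV _) (fun K _ x => vecSq_nonneg _)
  obtain ⟨RQ, eQ, pQ, zQ⟩ := volInt_ofReal_nonneg M.TA (r := fun K x => vecSq (evV (U.vel K) x))
    (fun K _ => continuous_vecSq_evV _) (fun K _ x => vecSq_nonneg _)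
  obtain ⟨RV, eV, pV, zV⟩ := volInt_ofReal_nonneg M.TA
    (r := fun K x => Complex.normSq (ev (U.pot K) x))
    (fun K _ => Complex.continuous_normSq.comp (continuous_ev _))
    (fun K _ x => Complex.normSq_nonneg _)
  simp only [frobC_hookeInv, dotC_self, eH, eU] at hE
  simp only [dotC_self, Complex.mul_conj, eQ, eV] at hA
  set rE : (K : Cell n) → K.verts → E n → ℝ := fun K v x =>
    vecSq (fun i => ev (U.disp K i) x - U.dispTrace (K.face v) i x) with hrE
  set rA : (K : Cell n) → K.verts → E n → ℝ := fun K v x =>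
    Complex.normSq (ev (U.pot K) x - U.potTrace (K.face v) x) with hrA
  have cE : ∀ K ∈ M.TE, ∀ v : K.verts,
      ContinuousOn (fun x => ((rE K v x : ℝ) : ℂ)) (K.facet v) := fun K hK v =>
    Complex.continuous_ofReal.comp_continuousOn (continuousOn_finsetSum _ fun i _ =>
      Complex.continuous_normSq.comp_continuousOn
        ((continuous_ev _).continuousOn.sub (hwE K hK v i)))
  have cA : ∀ K ∈ M.TA, ∀ v : K.verts,
      ContinuousOn (fun x => ((rA K v x : ℝ) : ℂ)) (K.facet v) := fun K hK v =>
    Complex.continuous_ofReal.comp_continuousOn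
      (Complex.continuous_normSq.comp_continuousOn
        ((continuous_ev _).continuousOn.sub (hwA K hK v)))
  have iE : BdryIntegrable M.TE
      (fun K v x => (starRingEnd ℂ) P.s * (P.tauE K x * (rE K v x : ℂ))) := fun K hK v =>
    ((htauE K hK v).1.mul_continuousOn (cE K hK v) (K.isCompact_facet v)).const_mul _
  have iA : BdryIntegrable M.TA
      (fun K v x => (starRingEnd ℂ) P.s * (P.tauA K x * (rA K v x : ℂ))) := fun K hK v =>
    ((htauA K hK v).1.mul_continuousOn (cA K hK v) (K.isCompact_facet v)).const_mul _
  obtain ⟨pDE, zDE⟩ := bdryInt_re_nonneg M.TE iE fun K hK v =>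
    weighted_nonneg (htauE K hK v).2 fun x => vecSq_nonneg _
  obtain ⟨pDA, zDA⟩ := bdryInt_re_nonneg M.TA iA fun K hK v =>
    weighted_nonneg (htauA K hK v).2 fun x => Complex.normSq_nonneg _
  rw [bdryInt_const_mul] at pDE zDE pDA zDA
  set DE := bdryInt M.TE Set.univ (fun K v x => P.tauE K x * (rE K v x : ℂ))
  set DA := bdryInt M.TA Set.univ (fun K v x => P.tauA K x * (rA K v x : ℂ))
  set Y := bdryInt M.TE M.interface (fun K v x => dotN (fun i => U.dispTrace (K.face v) i x)
        (K.normal v) * (starRingEnd ℂ) (U.potTrace (K.face v) x))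
  have hA' := congrArg (starRingEnd ℂ) hA
  simp only [map_add, map_sub, map_mul, map_pow, map_div₀, Complex.conj_ofReal, map_zero] at hA' hE
  -- s̄ times the elastic balance plus ρ_f s times the conjugate of the acoustic one. With these
  -- factors the interface terms are ±ρ_f |s|² Ȳ, and since s̄ s² = s |s|² all other terms have
  -- nonnegative real part.
  have hsum : (starRingEnd ℂ) P.s * RH + (starRingEnd ℂ) P.s * DE +
      P.rhoE * P.s * Complex.normSq P.s * RU + P.rhoF * (P.s * RQ) +
      P.rhoF * (starRingEnd ℂ) ((starRingEnd ℂ) P.s * DA) +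
      P.rhoF * ((starRingEnd ℂ) P.s * Complex.normSq P.s * (1 / P.c ^ 2 : ℝ) * RV) = 0 := by
    rw [← Complex.mul_conj]
    simp only [map_mul, Complex.conj_conj]
    push_cast
    linear_combination (starRingEnd ℂ) P.s * hE + P.rhoF * P.s * hA'
  have hre := congrArg Complex.re hsum
  have hns : 0 < Complex.normSq P.s := Complex.normSq_pos.2 fun h0 => by simp [h0] at hs
  have e1 : ((starRingEnd ℂ) P.s * RH).re = P.s.re * RH := by simp
  have e2 : (P.rhoE * P.s * Complex.normSq P.s * RU).re =
      P.rhoE * Complex.normSq P.s * P.s.re * RU := by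
    simp only [Complex.mul_re, Complex.mul_im, Complex.ofReal_re, Complex.ofReal_im]
    ring
  have e3 : (P.rhoF * (P.s * RQ)).re = P.rhoF * P.s.re * RQ := by
    simp only [Complex.mul_re, Complex.ofReal_re, Complex.ofReal_im]
    ring
  have e4 : (P.rhoF * (starRingEnd ℂ) ((starRingEnd ℂ) P.s * DA)).re =
      P.rhoF * ((starRingEnd ℂ) P.s * DA).re := by
    rw [Complex.re_ofReal_mul, Complex.conj_re]
  have e5 : (P.rhoF * ((starRingEnd ℂ) P.s * Complex.normSq P.s * (1 / P.c ^ 2 : ℝ) * RV)).re =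
      P.rhoF * Complex.normSq P.s * (1 / P.c ^ 2) * P.s.re * RV := by
    simp only [Complex.mul_re, Complex.mul_im, Complex.ofReal_re, Complex.ofReal_im,
      Complex.conj_re]
    ring
  simp only [Complex.add_re, e1, e2, e3, e4, e5, Complex.zero_re] at hre
  have k1 : 0 < P.rhoE * Complex.normSq P.s * P.s.re := by positivity
  have k2 : 0 < P.rhoF * P.s.re := by positivity
  have k3 : 0 < P.rhoF * Complex.normSq P.s * (1 / P.c ^ 2) * P.s.re := by positivity
  have q1 := mul_nonneg hs.le pH
  have q2 := mul_nonneg k1.le pU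
  have q3 := mul_nonneg k2.le pQ
  have q4 := mul_nonneg hrhoF.le pDA
  have q5 := mul_nonneg k3.le pV
  have zH := zH ((mul_eq_zero.1 (show P.s.re * RH = 0 by linarith)).resolve_left hs.ne')
  have zU := zU ((mul_eq_zero.1 (show _ * RU = 0 by linarith)).resolve_left k1.ne')
  have zQ := zQ ((mul_eq_zero.1 (show _ * RQ = 0 by linarith)).resolve_left k2.ne')
  have zV := zV ((mul_eq_zero.1 (show _ * RV = 0 by linarith)).resolve_left k3.ne')
  have zDE := zDE (by linarith)
  have zDA := zDA ((mul_eq_zero.1 (show P.rhoF * ((starRingEnd ℂ) P.s * DA).re = 0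
    by linarith)).resolve_left hrhoF.ne')
  have sStress : U.stress = 0 := by
    funext K
    by_cases hK : K ∈ M.TE
    · refine eq_zero_of_frobSq_ae K ?_
      filter_upwards [zH K hK] with x hx
      have h1 := hform (evM (U.stress K) x)
      rw [hx] at h1
      have h2 := frobSq_nonneg (evM (U.stress K) x)
      nlinarith
    · exact h.mem.stress_zero K hK
  have sDisp : U.disp = 0 := by
    funext K
    by_cases hK : K ∈ M.TE
    · exact eq_zero_of_vecSq_ae K (zU K hK)
    · exact h.mem.disp_zero K hK
  have sVel : U.vel = 0 := by
    funext K
    by_cases hK : K ∈ M.TA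
    · exact eq_zero_of_vecSq_ae K (zQ K hK)
    · exact h.mem.vel_zero K hK
  have sPot : U.pot = 0 := by
    funext K
    by_cases hK : K ∈ M.TA
    · refine K.eq_zero_of_ae_body ?_
      filter_upwards [zV K hK] with x hx
      exact Complex.normSq_eq_zero.1 hx
    · exact h.mem.pot_zero K hK
  -- With vanishing displacement the jump is -û, and the positive weight makes it vanish almost
  -- everywhere on each face.
  have sDT : U.dispTrace = 0 := by
    funext F
    by_cases hF : F ∈ faces M.TE
    · obtain ⟨K, hK, v, rfl⟩ := hF
      funext i
      refine IsFacePoly.eq_zero hn K v (h.mem.dispTrace_mem _ (face_mem_faces hK v) i) ?_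
      filter_upwards [ae_eq_zero_of_weighted (htauE K hK v).2 (zDE K hK v)] with x hx
      simpa [sDisp] using eq_zero_of_vecSq_eq_zero hx i
    · exact h.mem.dispTrace_zero F hF
  have sPT : U.potTrace = 0 := by
    funext F
    by_cases hF : F ∈ faces M.TA
    · obtain ⟨K, hK, v, rfl⟩ := hF
      refine IsFacePoly.eq_zero hn K v (h.mem.potTrace_mem _ (face_mem_faces hK v)) ?_
      filter_upwards [ae_eq_zero_of_weighted (htauA K hK v).2 (zDA K hK v)] with x hx
      have := Complex.normSq_eq_zero.1 hx
      simpa [sPot] using this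
    · exact h.mem.potTrace_zero F hF
  -- The constitutive equation has become (γ, τ) = 0, and τ = γ is an admissible choice.
  have sRot : U.rot = 0 := by
    have hin : InSpace M k ⟨U.rot, 0, 0, 0, 0, 0, 0⟩ :=
      { stress_mem := fun K hK => skewK_le_stressK k K (h.mem.rot_mem K hK)
        stress_zero := h.mem.rot_zero
        disp_mem := fun _ _ => zero_mem _
        disp_zero := fun _ _ => rfl
        rot_mem := fun _ _ => zero_mem _
        rot_zero := fun _ _ => rfl
        dispTrace_mem := fun _ _ _ => ⟨0, zero_mem _, (facePoly_zero _).symm⟩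
        dispTrace_zero := fun _ _ => rfl
        vel_mem := fun _ _ => zero_mem _
        vel_zero := fun _ _ => rfl
        pot_mem := fun _ _ => zero_mem _
        pot_zero := fun _ _ => rfl
        potTrace_mem := fun _ _ => ⟨0, zero_mem _, (facePoly_zero _).symm⟩
        potTrace_zero := fun _ _ => rfl }
    have hk := h.hooke _ hin
    simp only [sStress, sDisp, sDT, Pi.zero_apply, evM_zero, evV_zero, hookeInv_zero,
      frobC_zero_left, dotC_zero_left, volInt_zero, bdryInt_zero, zero_add, sub_zero] at hk
    obtain ⟨R, eR, -, zR⟩ := volInt_ofReal_nonneg M.TE (r := fun K x => frobSq (evM (U.rot K) x))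
      (fun K _ => continuous_frobSq_evM _) (fun K _ x => frobSq_nonneg _)
    have eR' : (R : ℂ) = 0 := by
      rw [← eR, ← hk]
      exact volInt_congr fun K _ x _ => (frobC_self _).symm
    funext K
    by_cases hK : K ∈ M.TE
    · exact eq_zero_of_frobSq_ae K (zR (by exact_mod_cast eR') K hK)
    · exact h.mem.rot_zero K hK
  exact Fields.ext sStress sDisp sRot sDT sVel sPot sPT

end HDG

end

noncomputable section

open scoped Classical
open MeasureTheory MvPolynomial

namespace HDG

variable {n : ℕ}

/-! ### The discrete space as a finite-dimensional vector space -/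

namespace Fields

/-- The components of a tuple of fields. -/
def equivProd : Fields n ≃ (Cell n → MatPoly n) × (Cell n → Fin n → Poly n) ×
    (Cell n → MatPoly n) × (Finset (E n) → Fin n → E n → ℂ) × (Cell n → Fin n → Poly n) ×
    (Cell n → Poly n) × (Finset (E n) → E n → ℂ) where
  toFun U := (U.stress, U.disp, U.rot, U.dispTrace, U.vel, U.pot, U.potTrace)
  invFun p := ⟨p.1, p.2.1, p.2.2.1, p.2.2.2.1, p.2.2.2.2.1, p.2.2.2.2.2.1, p.2.2.2.2.2.2⟩
  left_inv _ := rfl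
  right_inv _ := rfl

instance : AddCommGroup (Fields n) := equivProd.addCommGroup

instance : Module ℂ (Fields n) := equivProd.module ℂ

variable (U V : Fields n) (c : ℂ)

@[simp] lemma add_stress : (U + V).stress = U.stress + V.stress := rfl
@[simp] lemma add_disp : (U + V).disp = U.disp + V.disp := rfl
@[simp] lemma add_rot : (U + V).rot = U.rot + V.rot := rfl
@[simp] lemma add_dispTrace : (U + V).dispTrace = U.dispTrace + V.dispTrace := rfl
@[simp] lemma add_vel : (U + V).vel = U.vel + V.vel := rfl
@[simp] lemma add_pot : (U + V).pot = U.pot + V.pot := rfl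
@[simp] lemma add_potTrace : (U + V).potTrace = U.potTrace + V.potTrace := rfl
@[simp] lemma smul_stress : (c • U).stress = c • U.stress := rfl
@[simp] lemma smul_disp : (c • U).disp = c • U.disp := rfl
@[simp] lemma smul_rot : (c • U).rot = c • U.rot := rfl
@[simp] lemma smul_dispTrace : (c • U).dispTrace = c • U.dispTrace := rfl
@[simp] lemma smul_vel : (c • U).vel = c • U.vel := rfl
@[simp] lemma smul_pot : (c • U).pot = c • U.pot := rfl
@[simp] lemma smul_potTrace : (c • U).potTrace = c • U.potTrace := rfl

end Fields

/-- Families of vectors with members in prescribed subspaces for the indices in `s`, and zero for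
the others. -/
def famSpace {ι V : Type*} [AddCommGroup V] [Module ℂ V] (s : Set ι) (W : ι → Submodule ℂ V) :
    Submodule ℂ (ι → V) where
  carrier := {f | (∀ i ∈ s, f i ∈ W i) ∧ ∀ i ∉ s, f i = 0}
  add_mem' ha hb := ⟨fun i hi => add_mem (ha.1 i hi) (hb.1 i hi), fun i hi => by
    rw [Pi.add_apply, ha.2 i hi, hb.2 i hi, add_zero]⟩
  zero_mem' := ⟨fun _ _ => zero_mem _, fun _ _ => rfl⟩
  smul_mem' c _ h := ⟨fun i hi => Submodule.smul_mem _ c (h.1 i hi), fun i hi => by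
    rw [Pi.smul_apply, h.2 i hi, smul_zero]⟩

/-- Families are indexed by all simplices or faces of `ℝⁿ`; being zero outside a finite set, they
are determined by finitely many members. -/
lemma finite_famSpace {ι V : Type*} [AddCommGroup V] [Module ℂ V] {s : Set ι} (hs : s.Finite)
    (W : ι → Submodule ℂ V) (hW : ∀ i, Module.Finite ℂ (W i)) :
    Module.Finite ℂ (famSpace s W) := by
  have := hs.to_subtype
  let f : famSpace s W →ₗ[ℂ] ((i : s) → W i) :=
    { toFun := fun g i => ⟨g.1 i, g.2.1 i i.2⟩
      map_add' := fun _ _ => rfl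
      map_smul' := fun _ _ => rfl }
  refine Module.Finite.of_injective f fun g h hgh => Subtype.ext (funext fun i => ?_)
  by_cases hi : i ∈ s
  · exact congrArg Subtype.val (congrFun hgh ⟨i, hi⟩)
  · rw [g.2.2 i hi, h.2.2 i hi]

instance finite_polyK (k : ℕ) : Module.Finite ℂ (polyK n k) :=
  inferInstanceAs (Module.Finite ℂ (restrictTotalDegree (Fin n) ℂ k))

instance finite_polyVK (k : ℕ) : Module.Finite ℂ (polyVK n k) := by
  have := finite_famSpace (Set.finite_univ : (Set.univ : Set (Fin n)).Finite)
    (fun _ => polyK n k) fun _ => inferInstance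
  exact Submodule.finiteDimensional_of_le
    (show polyVK n k ≤ famSpace Set.univ (fun _ => polyK n k) from
      fun f hf => ⟨fun i _ => hf i, fun i hi => (hi trivial).elim⟩)

instance finite_polyMK (k : ℕ) : Module.Finite ℂ (polyMK n k) := by
  have := finite_famSpace (Set.finite_univ : (Set.univ : Set (Fin n)).Finite)
    (fun _ => polyVK n k) fun _ => inferInstance
  let f : polyMK n k →ₗ[ℂ] famSpace (Set.univ : Set (Fin n)) (fun _ => polyVK n k) :=
    { toFun := fun A => ⟨fun i j => A.1 i j, fun i _ j => A.2 i j, fun i hi => (hi trivial).elim⟩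
      map_add' := fun _ _ => rfl
      map_smul' := fun _ _ => rfl }
  exact Module.Finite.of_injective f fun A B h => by
    have h' := congrArg Subtype.val h
    exact Subtype.ext h'

instance finite_skewK (k : ℕ) : Module.Finite ℂ (skewK n k) :=
  Submodule.finiteDimensional_of_le (show skewK n k ≤ polyMK n k from fun _ h i j => h.1 i j)

instance finite_bubbleSpace (k : ℕ) (K : Cell n) : Module.Finite ℂ (bubbleSpace n k K) := by
  match n, K with
  | 0, _ => exact inferInstanceAs (Module.Finite ℂ (⊥ : Submodule ℂ (MatPoly 0)))
  | 1, _ => exact inferInstanceAs (Module.Finite ℂ (⊥ : Submodule ℂ (MatPoly 1)))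
  | 2, K => exact inferInstanceAs (Module.Finite ℂ ((skewK 2 k).map (bubbleMap2 K)))
  | 3, K => exact inferInstanceAs (Module.Finite ℂ ((skewK 3 k).map (bubbleMap3 K)))
  | n + 4, _ => exact inferInstanceAs (Module.Finite ℂ (⊥ : Submodule ℂ (MatPoly (n + 4))))

instance finite_stressK (k : ℕ) (K : Cell n) : Module.Finite ℂ (stressK n k K) := by
  unfold stressK
  infer_instance

/-- Polynomials on a face, extended by zero. -/
def facePolyK (k : ℕ) (F : Finset (E n)) : Submodule ℂ (E n → ℂ) :=
  (polyK n k).map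
    ({ toFun := fun p => (convexHull ℝ (F : Set (E n))).indicator (ev p)
       map_add' := fun p q => by
        funext x
        by_cases hx : x ∈ convexHull ℝ (F : Set (E n)) <;> simp [hx]
       map_smul' := fun c p => by
        funext x
        by_cases hx : x ∈ convexHull ℝ (F : Set (E n)) <;> simp [hx] } : Poly n →ₗ[ℂ] E n → ℂ)

lemma mem_facePolyK {k : ℕ} {F : Finset (E n)} {ξ : E n → ℂ} :
    ξ ∈ facePolyK k F ↔ IsFacePoly k F ξ :=
  ⟨fun ⟨p, hp, e⟩ => ⟨p, hp, e.symm⟩, fun ⟨p, hp, e⟩ => ⟨p, hp, e.symm⟩⟩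

instance finite_facePolyK (k : ℕ) (F : Finset (E n)) : Module.Finite ℂ (facePolyK k F) := by
  unfold facePolyK
  infer_instance

lemma finite_faces (T : Finset (Cell n)) : (faces T).Finite := by
  have : faces T = ⋃ K ∈ T, Set.range K.face := by
    ext F
    simp [faces, eq_comm]
  rw [this]
  exact T.finite_toSet.biUnion fun K _ => Set.finite_range _

/-- The product of the seven discrete spaces. -/
def discreteSpace (M : CoupledMesh n) (k : ℕ) : Submodule ℂ (Fields n) where
  carrier := {U | InSpace M k U}
  add_mem' := by
    intro U V hU hV
    exact
    { stress_mem := fun K hK => add_mem (hU.stress_mem K hK) (hV.stress_mem K hK)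
      stress_zero := fun K hK => by simp [hU.stress_zero K hK, hV.stress_zero K hK]
      disp_mem := fun K hK => add_mem (hU.disp_mem K hK) (hV.disp_mem K hK)
      disp_zero := fun K hK => by simp [hU.disp_zero K hK, hV.disp_zero K hK]
      rot_mem := fun K hK => add_mem (hU.rot_mem K hK) (hV.rot_mem K hK)
      rot_zero := fun K hK => by simp [hU.rot_zero K hK, hV.rot_zero K hK]
      dispTrace_mem := fun F hF i => mem_facePolyK.1 (add_mem
        (mem_facePolyK.2 (hU.dispTrace_mem F hF i)) (mem_facePolyK.2 (hV.dispTrace_mem F hF i)))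
      dispTrace_zero := fun F hF => by simp [hU.dispTrace_zero F hF, hV.dispTrace_zero F hF]
      vel_mem := fun K hK => add_mem (hU.vel_mem K hK) (hV.vel_mem K hK)
      vel_zero := fun K hK => by simp [hU.vel_zero K hK, hV.vel_zero K hK]
      pot_mem := fun K hK => add_mem (hU.pot_mem K hK) (hV.pot_mem K hK)
      pot_zero := fun K hK => by simp [hU.pot_zero K hK, hV.pot_zero K hK]
      potTrace_mem := fun F hF => mem_facePolyK.1 (add_mem
        (mem_facePolyK.2 (hU.potTrace_mem F hF)) (mem_facePolyK.2 (hV.potTrace_mem F hF)))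
      potTrace_zero := fun F hF => by simp [hU.potTrace_zero F hF, hV.potTrace_zero F hF] }
  zero_mem' :=
    { stress_mem := fun _ _ => zero_mem _
      stress_zero := fun _ _ => rfl
      disp_mem := fun _ _ => zero_mem _
      disp_zero := fun _ _ => rfl
      rot_mem := fun _ _ => zero_mem _
      rot_zero := fun _ _ => rfl
      dispTrace_mem := fun _ _ _ => mem_facePolyK.1 (zero_mem _)
      dispTrace_zero := fun _ _ => rfl
      vel_mem := fun _ _ => zero_mem _
      vel_zero := fun _ _ => rfl
      pot_mem := fun _ _ => zero_mem _
      pot_zero := fun _ _ => rfl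
      potTrace_mem := fun _ _ => mem_facePolyK.1 (zero_mem _)
      potTrace_zero := fun _ _ => rfl }
  smul_mem' := by
    intro c U hU
    exact
    { stress_mem := fun K hK => Submodule.smul_mem _ c (hU.stress_mem K hK)
      stress_zero := fun K hK => by simp [hU.stress_zero K hK]
      disp_mem := fun K hK => Submodule.smul_mem _ c (hU.disp_mem K hK)
      disp_zero := fun K hK => by simp [hU.disp_zero K hK]
      rot_mem := fun K hK => Submodule.smul_mem _ c (hU.rot_mem K hK)
      rot_zero := fun K hK => by simp [hU.rot_zero K hK]
      dispTrace_mem := fun F hF i => mem_facePolyK.1 (Submodule.smul_mem _ c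
        (mem_facePolyK.2 (hU.dispTrace_mem F hF i)))
      dispTrace_zero := fun F hF => by simp [hU.dispTrace_zero F hF]
      vel_mem := fun K hK => Submodule.smul_mem _ c (hU.vel_mem K hK)
      vel_zero := fun K hK => by simp [hU.vel_zero K hK]
      pot_mem := fun K hK => Submodule.smul_mem _ c (hU.pot_mem K hK)
      pot_zero := fun K hK => by simp [hU.pot_zero K hK]
      potTrace_mem := fun F hF => mem_facePolyK.1 (Submodule.smul_mem _ c
        (mem_facePolyK.2 (hU.potTrace_mem F hF)))
      potTrace_zero := fun F hF => by simp [hU.potTrace_zero F hF] }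

set_option synthInstance.maxHeartbeats 200000 in
instance finite_discreteSpace (M : CoupledMesh n) (k : ℕ) :
    Module.Finite ℂ (discreteSpace M k) := by
  have hE := M.TE.finite_toSet
  have hA := M.TA.finite_toSet
  have h1 := finite_famSpace hE (stressK n k) fun _ => inferInstance
  have h2 := finite_famSpace hE (fun _ => polyVK n k) fun _ => inferInstance
  have h3 := finite_famSpace hE (fun _ => skewK n k) fun _ => inferInstance
  have h4 := finite_famSpace (finite_faces M.TE)
    (fun F => famSpace (Set.univ : Set (Fin n)) fun _ => facePolyK k F)
    fun F => finite_famSpace Set.finite_univ _ fun _ => inferInstance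
  have h5 := finite_famSpace hA (fun _ => polyVK n k) fun _ => inferInstance
  have h6 := finite_famSpace hA (fun _ => polyK n k) fun _ => inferInstance
  have h7 := finite_famSpace (finite_faces M.TA) (fun F => facePolyK k F) fun _ => inferInstance
  let f : discreteSpace M k →ₗ[ℂ]
      famSpace (M.TE : Set (Cell n)) (stressK n k) ×
      famSpace (M.TE : Set (Cell n)) (fun _ => polyVK n k) ×
      famSpace (M.TE : Set (Cell n)) (fun _ => skewK n k) ×
      famSpace (faces M.TE) (fun F => famSpace (Set.univ : Set (Fin n)) fun _ => facePolyK k F) ×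
      famSpace (M.TA : Set (Cell n)) (fun _ => polyVK n k) ×
      famSpace (M.TA : Set (Cell n)) (fun _ => polyK n k) ×
      famSpace (faces M.TA) (fun F => facePolyK k F) :=
    { toFun := fun U =>
        (⟨U.1.stress, U.2.stress_mem, U.2.stress_zero⟩, ⟨U.1.disp, U.2.disp_mem, U.2.disp_zero⟩,
          ⟨U.1.rot, U.2.rot_mem, U.2.rot_zero⟩,
          ⟨U.1.dispTrace, fun F hF => ⟨fun i _ => mem_facePolyK.2 (U.2.dispTrace_mem F hF i),
            fun i hi => (hi trivial).elim⟩, U.2.dispTrace_zero⟩,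
          ⟨U.1.vel, U.2.vel_mem, U.2.vel_zero⟩, ⟨U.1.pot, U.2.pot_mem, U.2.pot_zero⟩,
          ⟨U.1.potTrace, fun F hF => mem_facePolyK.2 (U.2.potTrace_mem F hF),
            U.2.potTrace_zero⟩)
      map_add' := fun _ _ => rfl
      map_smul' := fun _ _ => rfl }
  refine Module.Finite.of_injective f fun U V h => ?_
  have e1 : U.1.stress = V.1.stress := congrArg (fun z => z.1.1) h
  have e2 : U.1.disp = V.1.disp := congrArg (fun z => z.2.1.1) h
  have e3 : U.1.rot = V.1.rot := congrArg (fun z => z.2.2.1.1) h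
  have e4 : U.1.dispTrace = V.1.dispTrace := congrArg (fun z => z.2.2.2.1.1) h
  have e5 : U.1.vel = V.1.vel := congrArg (fun z => z.2.2.2.2.1.1) h
  have e6 : U.1.pot = V.1.pot := congrArg (fun z => z.2.2.2.2.2.1.1) h
  have e7 : U.1.potTrace = V.1.potTrace := congrArg (fun z => z.2.2.2.2.2.2.1) h
  exact Subtype.ext (Fields.ext e1 e2 e3 e4 e5 e6 e7)

/-! ### Semilinear functionals -/

/-- A functional that is semilinear on a subspace. -/
structure IsSemilin (σ : ℂ →+* ℂ) (S : Submodule ℂ (Fields n)) (f : Fields n → ℂ) : Prop where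
  add : ∀ U ∈ S, ∀ V ∈ S, f (U + V) = f U + f V
  smul : ∀ (c : ℂ), ∀ U ∈ S, f (c • U) = σ c * f U

namespace IsSemilin

variable {σ : ℂ →+* ℂ} {S : Submodule ℂ (Fields n)} {f g : Fields n → ℂ}

lemma add' (hf : IsSemilin σ S f) (hg : IsSemilin σ S g) : IsSemilin σ S fun U => f U + g U :=
  ⟨fun U hU V hV => by rw [hf.add U hU V hV, hg.add U hU V hV]; ring,
    fun c U hU => by rw [hf.smul c U hU, hg.smul c U hU]; ring⟩

lemma const_mul (a : ℂ) (hf : IsSemilin σ S f) : IsSemilin σ S fun U => a * f U :=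
  ⟨fun U hU V hV => by rw [hf.add U hU V hV]; ring, fun c U hU => by rw [hf.smul c U hU]; ring⟩

lemma mul_const (a : ℂ) (hf : IsSemilin σ S f) : IsSemilin σ S fun U => f U * a :=
  ⟨fun U hU V hV => by rw [hf.add U hU V hV]; ring, fun c U hU => by rw [hf.smul c U hU]; ring⟩

lemma sub (hf : IsSemilin σ S f) (hg : IsSemilin σ S g) : IsSemilin σ S fun U => f U - g U :=
  ⟨fun U hU V hV => by rw [hf.add U hU V hV, hg.add U hU V hV]; ring,
    fun c U hU => by rw [hf.smul c U hU, hg.smul c U hU]; ring⟩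

lemma neg (hf : IsSemilin σ S f) : IsSemilin σ S fun U => -f U :=
  ⟨fun U hU V hV => by rw [hf.add U hU V hV]; ring, fun c U hU => by rw [hf.smul c U hU]; ring⟩

lemma zero : IsSemilin σ S fun _ => 0 := ⟨fun _ _ _ _ => by ring, fun _ _ _ => by ring⟩

lemma sum {ι : Type*} (s : Finset ι) {f : ι → Fields n → ℂ} (hf : ∀ i ∈ s, IsSemilin σ S (f i)) :
    IsSemilin σ S fun U => ∑ i ∈ s, f i U :=
  ⟨fun U hU V hV => by
    rw [← Finset.sum_add_distrib]
    exact Finset.sum_congr rfl fun i hi => (hf i hi).add U hU V hV,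
  fun c U hU => by
    rw [Finset.mul_sum]
    exact Finset.sum_congr rfl fun i hi => (hf i hi).smul c U hU⟩

lemma conj (hf : IsSemilin (RingHom.id ℂ) S f) :
    IsSemilin (starRingEnd ℂ) S fun U => (starRingEnd ℂ) (f U) :=
  ⟨fun U hU V hV => by rw [hf.add U hU V hV, map_add],
    fun c U hU => by rw [hf.smul c U hU, map_mul]; rfl⟩

/-- Additivity of the integral needs integrability, which only members of `S` provide; hence the
notion of semilinearity on a subspace. -/
lemma volInt {T : Finset (Cell n)} {g : Fields n → Cell n → E n → ℂ}
    (hl : ∀ K ∈ T, ∀ x, IsSemilin σ S fun U => g U K x)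
    (hi : ∀ U ∈ S, VolIntegrable T (g U)) : IsSemilin σ S fun U => volInt T (g U) :=
  ⟨fun U hU V hV => by
    rw [← volInt_add (hi U hU) (hi V hV)]
    exact volInt_congr fun K hK x _ => (hl K hK x).add U hU V hV,
  fun c U hU => by
    rw [← volInt_const_mul]
    exact volInt_congr fun K hK x _ => (hl K hK x).smul c U hU⟩

/-- Integrability is required on the faces in `P` only, because boundary data are square integrable
only on their own part of the boundary. -/
lemma bdryInt {T : Finset (Cell n)} {P : Set (Finset (E n))}
    {g : Fields n → (K : Cell n) → K.verts → E n → ℂ}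
    (hl : ∀ K ∈ T, ∀ (v : K.verts) x, IsSemilin σ S fun U => g U K v x)
    (hi : ∀ U ∈ S, ∀ K ∈ T, ∀ v : K.verts, K.face v ∈ P →
      IntegrableOn (g U K v) (K.facet v) (Cell.surf n)) :
    IsSemilin σ S fun U => bdryInt T P (g U) := by
  refine IsSemilin.sum _ fun K hK => IsSemilin.sum _ fun v _ => ?_
  by_cases hv : K.face v ∈ P
  · simp only [if_pos hv]
    refine ⟨fun U hU V hV => ?_, fun c U hU => ?_⟩
    · refine Eq.trans ?_ (integral_add (hi U hU K hK v hv) (hi V hV K hK v hv))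
      exact integral_congr_ae (Filter.Eventually.of_forall fun x => (hl K hK v x).add U hU V hV)
    · rw [← integral_const_mul]
      exact integral_congr_ae (Filter.Eventually.of_forall fun x => (hl K hK v x).smul c U hU)
  · simp only [if_neg hv]
    exact IsSemilin.zero

/-- A conjugate-linear functional on a subspace is determined by its values on a basis. -/
lemma eq_of_basis {ι : Type*} (b : Module.Basis ι ℂ S) (hf : IsSemilin (starRingEnd ℂ) S f)
    (hg : IsSemilin (starRingEnd ℂ) S g) (h : ∀ i, f (b i) = g (b i)) : ∀ U ∈ S, f U = g U := by
  -- Conjugation makes the functional linear, and linear maps that agree on a basis are equal.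
  let L : ∀ f : Fields n → ℂ, IsSemilin (starRingEnd ℂ) S f → (S →ₗ[ℂ] ℂ) := fun f hf =>
    { toFun := fun U => (starRingEnd ℂ) (f U)
      map_add' := fun U V => by
        rw [Submodule.coe_add, hf.add U U.2 V V.2, map_add]
      map_smul' := fun c U => by
        rw [Submodule.coe_smul, hf.smul c U U.2, map_mul, Complex.conj_conj]
        rfl }
  have e : L f hf = L g hg := b.ext fun i => congrArg (starRingEnd ℂ) (h i)
  intro U hU
  exact (starRingEnd ℂ).injective (congrArg (fun l : S →ₗ[ℂ] ℂ => l ⟨U, hU⟩) e)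

end IsSemilin

/-- A form that is linear in the first and conjugate linear in the second argument. -/
structure IsSesq (S : Submodule ℂ (Fields n)) (b : Fields n → Fields n → ℂ) : Prop where
  left : ∀ V ∈ S, IsSemilin (RingHom.id ℂ) S fun U => b U V
  right : ∀ U ∈ S, IsSemilin (starRingEnd ℂ) S fun V => b U V

namespace IsSesq

variable {S : Submodule ℂ (Fields n)} {b c : Fields n → Fields n → ℂ}

lemma add (hb : IsSesq S b) (hc : IsSesq S c) : IsSesq S fun U V => b U V + c U V :=
  ⟨fun V hV => (hb.left V hV).add' (hc.left V hV),
    fun U hU => (hb.right U hU).add' (hc.right U hU)⟩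

lemma sub (hb : IsSesq S b) (hc : IsSesq S c) : IsSesq S fun U V => b U V - c U V :=
  ⟨fun V hV => (hb.left V hV).sub (hc.left V hV), fun U hU => (hb.right U hU).sub (hc.right U hU)⟩

lemma neg (hb : IsSesq S b) : IsSesq S fun U V => -b U V :=
  ⟨fun V hV => (hb.left V hV).neg, fun U hU => (hb.right U hU).neg⟩

lemma const_mul (a : ℂ) (hb : IsSesq S b) : IsSesq S fun U V => a * b U V :=
  ⟨fun V hV => (hb.left V hV).const_mul a, fun U hU => (hb.right U hU).const_mul a⟩

/-- A square system with only the trivial homogeneous solution is solvable. -/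
theorem exists_solution [Module.Finite ℂ S] (hb : IsSesq S b)
    (h0 : ∀ U ∈ S, (∀ V ∈ S, b U V = 0) → U = 0) {l : Fields n → ℂ}
    (hl : IsSemilin (starRingEnd ℂ) S l) : ∃ U ∈ S, ∀ V ∈ S, b U V = l V := by
  let e := Module.finBasis ℂ S
  -- Testing with a basis of the trial space gives as many equations as unknowns, so injectivity
  -- yields surjectivity.
  let Θ : S →ₗ[ℂ] (Fin (Module.finrank ℂ S) → ℂ) :=
    { toFun := fun U i => b U (e i)
      map_add' := fun U V => funext fun i => (hb.left _ (e i).2).add U U.2 V V.2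
      map_smul' := fun c U => funext fun i => (hb.left _ (e i).2).smul c U U.2 }
  have hinj : Function.Injective Θ := by
    rw [← LinearMap.ker_eq_bot, LinearMap.ker_eq_bot']
    intro U hU
    refine Subtype.ext (h0 U U.2 ?_)
    exact (hb.right U U.2).eq_of_basis e IsSemilin.zero fun i => congrFun hU i
  have hsurj : Function.Surjective Θ :=
    (LinearMap.injective_iff_surjective_of_finrank_eq_finrank (by simp)).1 hinj
  obtain ⟨U, hU⟩ := hsurj fun i => l (e i)
  exact ⟨U, U.2, (hb.right U U.2).eq_of_basis e hl fun i => congrFun hU i⟩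

end IsSesq

end HDG

end

noncomputable section

open scoped Classical
open MeasureTheory MvPolynomial

namespace HDG

variable {n : ℕ}

/-! ### The scheme as one variational equation -/

section Forms

variable (M : CoupledMesh n) (P : Params n) (d : Data n) (U T : Fields n)

/-- Left-hand side of the constitutive equation of the elastic solid. -/
def constitutiveForm : ℂ :=
  volInt M.TE (fun K x => frobC (hookeInv P (evM (U.stress K) x)) (evM (T.stress K) x))
    + volInt M.TE (fun K x => dotC (evV (U.disp K) x) (evV (divM (T.stress K)) x))
    + volInt M.TE (fun K x => frobC (evM (U.rot K) x) (evM (T.stress K) x))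
    - bdryInt M.TE Set.univ (fun K v x => dotC (fun i => U.dispTrace (K.face v) i x)
        (mulN (evM (T.stress K) x) (K.normal v)))

/-- Left-hand side of the balance of momentum. -/
def momentumForm : ℂ :=
  volInt M.TE (fun K x => frobC (evM (U.stress K) x) (evM (gradV (T.disp K)) x))
    - bdryInt M.TE Set.univ (fun K v x => dotC (elFlux P U K v x) (evV (T.disp K) x))
    + P.rhoE * P.s ^ 2 * volInt M.TE (fun K x => dotC (evV (U.disp K) x) (evV (T.disp K) x))

/-- Left-hand side of the weak symmetry of the stress. -/
def symmetryForm : ℂ :=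
  volInt M.TE (fun K x => frobC (evM (U.stress K) x) (evM (T.rot K) x))

/-- The elastic flux tested on a set of faces. -/
def elFluxForm (Q : Set (Finset (E n))) : ℂ :=
  bdryInt M.TE Q (fun K v x => dotC (elFlux P U K v x) (fun i => T.dispTrace (K.face v) i x))

/-- Left-hand side of the definition of the acoustic velocity. -/
def velocityForm : ℂ :=
  volInt M.TA (fun K x => dotC (evV (U.vel K) x) (evV (T.vel K) x))
    + volInt M.TA (fun K x => ev (U.pot K) x * (starRingEnd ℂ) (ev (divV (T.vel K)) x))
    - bdryInt M.TA Set.univ (fun K v x => U.potTrace (K.face v) x *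
        (starRingEnd ℂ) (dotN (evV (T.vel K) x) (K.normal v)))

/-- Left-hand side of the acoustic wave equation. -/
def waveForm : ℂ :=
  volInt M.TA (fun K x => dotC (evV (U.vel K) x) (evV (grad (T.pot K)) x))
    - bdryInt M.TA Set.univ (fun K v x => acFlux P U K v x * (starRingEnd ℂ) (ev (T.pot K) x))
    + (P.s / P.c) ^ 2 * volInt M.TA (fun K x => ev (U.pot K) x * (starRingEnd ℂ) (ev (T.pot K) x))

/-- The acoustic flux tested on a set of faces. -/
def acFluxForm (Q : Set (Finset (E n))) : ℂ :=
  bdryInt M.TA Q (fun K v x => acFlux P U K v x * (starRingEnd ℂ) (T.potTrace (K.face v) x))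

/-- Left-hand side of the Dirichlet condition. -/
def dirichletForm : ℂ :=
  bdryInt M.TA M.dirichlet (fun K v x => U.potTrace (K.face v) x *
      (starRingEnd ℂ) (T.potTrace (K.face v) x))

/-- The elastic contribution to the kinematic coupling condition. -/
def kinematicForm : ℂ :=
  bdryInt M.TE M.interface (fun K v x =>
    P.s * dotN (fun i => U.dispTrace (K.face v) i x) (K.normal v) *
      (starRingEnd ℂ) (T.potTrace (K.face v) x))

/-- The acoustic contribution to the dynamic coupling condition. -/
def dynamicForm : ℂ :=
  bdryInt M.TA M.interface (fun K v x => dotC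
    (fun i => P.rhoF * P.s * U.potTrace (K.face v) x * (K.normal v i : ℂ))
    (fun i => T.dispTrace (K.face v) i x))

/-- The sum of the left-hand sides of all equations. -/
def schemeForm : ℂ :=
  constitutiveForm M P U T + momentumForm M P U T + symmetryForm M U T
    + elFluxForm M P U T M.interfaceᶜ + velocityForm M U T + waveForm M P U T
    + acFluxForm M P U T (M.interface ∪ M.dirichlet)ᶜ + dirichletForm M U T
    + (acFluxForm M P U T M.interface - kinematicForm M P U T)
    + (-elFluxForm M P U T M.interface + dynamicForm M P U T)

/-- The elastic source. -/
def elSource : ℂ := volInt M.TE (fun K x => dotC (d.fE x) (evV (T.disp K) x))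

/-- The acoustic source. -/
def acSource : ℂ := volInt M.TA (fun K x => d.fA x * (starRingEnd ℂ) (ev (T.pot K) x))

/-- A scalar boundary datum tested on a set of faces. -/
def boundarySource (g : E n → ℂ) (Q : Set (Finset (E n))) : ℂ :=
  bdryInt M.TA Q (fun K v x => g x * (starRingEnd ℂ) (T.potTrace (K.face v) x))

/-- The normal derivative of the incident field, tested on the interface. -/
def kinematicSource : ℂ :=
  bdryInt M.TA M.interface (fun K v x => dotN (d.gradVinc x) (K.normal v) *
    (starRingEnd ℂ) (T.potTrace (K.face v) x))

/-- The pressure of the incident field, tested on the interface. -/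
def dynamicSource : ℂ :=
  bdryInt M.TA M.interface (fun K v x => dotC
    (fun i => d.vinc x * (K.normal v i : ℂ)) (fun i => T.dispTrace (K.face v) i x))

/-- The sum of the right-hand sides of all equations. -/
def schemeSource : ℂ :=
  elSource M d T + acSource M d T + boundarySource M T d.gN M.neumann
    + boundarySource M T d.gD M.dirichlet + -kinematicSource M d T
    + -(P.rhoF * P.s) * dynamicSource M d T

end Forms

/-! ### Sesquilinearity of the form -/

section Sesquilinear

variable {S : Submodule ℂ (Fields n)} {T : Finset (Cell n)}

/-- A functional that is linear on a subspace. -/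
abbrev IsLin (S : Submodule ℂ (Fields n)) (f : Fields n → ℂ) : Prop :=
  IsSemilin (RingHom.id ℂ) S f

namespace IsSesq

/-- All integrands of the scheme are sums of such products, which reduces sesquilinearity to
pointwise linearity of the factors and integrability of the products. -/
lemma mul_conj {f g : Fields n → ℂ} (hf : IsLin S f) (hg : IsLin S g) :
    IsSesq S fun U V => f U * (starRingEnd ℂ) (g V) :=
  ⟨fun _ _ => hf.mul_const _, fun _ _ => hg.conj.const_mul _⟩

lemma sum {ι : Type*} (s : Finset ι) {b : ι → Fields n → Fields n → ℂ}
    (hb : ∀ i, IsSesq S (b i)) : IsSesq S fun U V => ∑ i ∈ s, b i U V :=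
  ⟨fun V hV => IsSemilin.sum s fun i _ => (hb i).left V hV,
    fun U hU => IsSemilin.sum s fun i _ => (hb i).right U hU⟩

lemma dotC {f g : Fields n → Fin n → ℂ} (hf : ∀ i, IsLin S fun U => f U i)
    (hg : ∀ i, IsLin S fun U => g U i) : IsSesq S fun U V => dotC (f U) (g V) :=
  IsSesq.sum _ fun i => mul_conj (hf i) (hg i)

lemma frobC {f g : Fields n → Matrix (Fin n) (Fin n) ℂ} (hf : ∀ i j, IsLin S fun U => f U i j)
    (hg : ∀ i j, IsLin S fun U => g U i j) : IsSesq S fun U V => frobC (f U) (g V) :=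
  IsSesq.sum _ fun i => IsSesq.sum _ fun j => mul_conj (hf i j) (hg i j)

lemma volInt {g : Fields n → Fields n → Cell n → E n → ℂ}
    (hl : ∀ K x, IsSesq S fun U V => g U V K x)
    (hi : ∀ U ∈ S, ∀ V ∈ S, ∀ K ∈ T, Continuous (g U V K)) :
    IsSesq S fun U V => volInt T (g U V) :=
  ⟨fun V hV => IsSemilin.volInt (fun K _ x => (hl K x).left V hV)
    fun U hU K hK => K.integrableOn_body (hi U hU V hV K hK),
  fun U hU => IsSemilin.volInt (fun K _ x => (hl K x).right U hU)
    fun V hV K hK => K.integrableOn_body (hi U hU V hV K hK)⟩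

lemma bdryInt {P : Set (Finset (E n))} {g : Fields n → Fields n → (K : Cell n) → K.verts → E n → ℂ}
    (hl : ∀ (K : Cell n) (v : K.verts) x, IsSesq S fun U V => g U V K v x)
    (hi : ∀ U ∈ S, ∀ V ∈ S, BdryIntegrable T (g U V)) :
    IsSesq S fun U V => bdryInt T P (g U V) :=
  ⟨fun V hV => IsSemilin.bdryInt (fun K _ v x => (hl K v x).left V hV)
    fun U hU K hK v _ => hi U hU V hV K hK v,
  fun U hU => IsSemilin.bdryInt (fun K _ v x => (hl K v x).right U hU)
    fun V hV K hK v _ => hi U hU V hV K hK v⟩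

end IsSesq

/-! ### Pointwise linear dependence on the fields -/

section Pointwise

variable (K : Cell n) (v : K.verts) (x : E n) (i j : Fin n) (F : Finset (E n)) (P : Params n)

lemma isLin_stress : IsLin S fun U => evM (U.stress K) x i j :=
  ⟨fun U _ V _ => by simp [evM], fun c U _ => by simp [evM]⟩

lemma isLin_disp : IsLin S fun U => evV (U.disp K) x i :=
  ⟨fun U _ V _ => by simp [evV], fun c U _ => by simp [evV]⟩

lemma isLin_rot : IsLin S fun U => evM (U.rot K) x i j :=
  ⟨fun U _ V _ => by simp [evM], fun c U _ => by simp [evM]⟩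

lemma isLin_dispTrace : IsLin S fun U => U.dispTrace F i x :=
  ⟨fun U _ V _ => by simp, fun c U _ => by simp⟩

lemma isLin_vel : IsLin S fun U => evV (U.vel K) x i :=
  ⟨fun U _ V _ => by simp [evV], fun c U _ => by simp [evV]⟩

lemma isLin_pot : IsLin S fun U => ev (U.pot K) x :=
  ⟨fun U _ V _ => by simp, fun c U _ => by simp⟩

lemma isLin_potTrace : IsLin S fun U => U.potTrace F x :=
  ⟨fun U _ V _ => by simp, fun c U _ => by simp⟩

lemma isLin_divM_stress : IsLin S fun U => evV (divM (U.stress K)) x i :=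
  ⟨fun U _ V _ => by simp [evV, divM, Finset.sum_add_distrib],
    fun c U _ => by simp [evV, divM, Finset.mul_sum]⟩

lemma isLin_gradV_disp : IsLin S fun U => evM (gradV (U.disp K)) x i j :=
  ⟨fun U _ V _ => by simp [evM, gradV], fun c U _ => by simp [evM, gradV]⟩

lemma isLin_divV_vel : IsLin S fun U => ev (divV (U.vel K)) x :=
  ⟨fun U _ V _ => by simp [divV, Finset.sum_add_distrib],
    fun c U _ => by simp [divV, Finset.mul_sum]⟩

lemma isLin_grad_pot : IsLin S fun U => evV (grad (U.pot K)) x i :=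
  ⟨fun U _ V _ => by simp [evV, grad], fun c U _ => by simp [evV, grad]⟩

lemma IsLin.dotN {f : Fields n → Fin n → ℂ} (hf : ∀ i, IsLin S fun U => f U i) (ν : Fin n → ℝ) :
    IsLin S fun U => dotN (f U) ν :=
  IsSemilin.sum _ fun i _ => (hf i).mul_const _

lemma IsLin.mulN {f : Fields n → Matrix (Fin n) (Fin n) ℂ}
    (hf : ∀ i j, IsLin S fun U => f U i j) (ν : Fin n → ℝ) (i : Fin n) :
    IsLin S fun U => mulN (f U) ν i :=
  IsSemilin.sum _ fun j _ => (hf i j).mul_const _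

lemma isLin_hookeInv : IsLin S fun U => hookeInv P (evM (U.stress K) x) i j := by
  simp only [hookeInv, Matrix.sub_apply, Matrix.smul_apply, smul_eq_mul, Matrix.trace,
    Matrix.diag_apply]
  exact ((isLin_stress K x i j).const_mul _).sub
    (((IsSemilin.sum _ fun i _ => isLin_stress K x i i).const_mul _).mul_const _)

lemma isLin_elFlux : IsLin S fun U => elFlux P U K v x i :=
  (IsLin.mulN (isLin_stress K x) _ i).sub
    (((isLin_disp K x i).sub (isLin_dispTrace x i _)).const_mul _)

lemma isLin_acFlux : IsLin S fun U => acFlux P U K v x :=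
  (IsLin.dotN (isLin_vel K x) _).sub (((isLin_pot K x).sub (isLin_potTrace x _)).const_mul _)

end Pointwise

/-! ### Continuity and integrability of the integrands -/

section Continuity

lemma continuous_dotC {f g : E n → Fin n → ℂ} (hf : ∀ i, Continuous fun x => f x i)
    (hg : ∀ i, Continuous fun x => g x i) : Continuous fun x => dotC (f x) (g x) :=
  continuous_finsetSum _ fun i _ => (hf i).mul (continuous_conj_comp (hg i))

lemma continuous_frobC {f g : E n → Matrix (Fin n) (Fin n) ℂ}
    (hf : ∀ i j, Continuous fun x => f x i j) (hg : ∀ i j, Continuous fun x => g x i j) :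
    Continuous fun x => frobC (f x) (g x) :=
  continuous_finsetSum _ fun i _ => continuous_finsetSum _ fun j _ =>
    (hf i j).mul (continuous_conj_comp (hg i j))

lemma continuous_hookeInv_evM (P : Params n) (A : MatPoly n) (i j : Fin n) :
    Continuous fun x => hookeInv P (evM A x) i j := by
  simp only [hookeInv, Matrix.sub_apply, Matrix.smul_apply, smul_eq_mul, Matrix.trace,
    Matrix.diag_apply]
  exact (continuous_const.mul (continuous_ev _)).sub
    ((continuous_const.mul (continuous_finsetSum _ fun i _ => continuous_ev _)).mul
      continuous_const)

lemma bdryIntegrable_dotC {f g : (K : Cell n) → K.verts → E n → Fin n → ℂ}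
    (hf : ∀ i, BdryIntegrable T fun K v x => f K v x i)
    (hg : ∀ i, ∀ K ∈ T, ∀ v : K.verts, ContinuousOn (fun x => g K v x i) (K.facet v)) :
    BdryIntegrable T fun K v x => dotC (f K v x) (g K v x) := fun K hK v =>
  integrable_finsetSum _ fun i _ => bdryIntegrable_mul_conj (hf i) (hg i) K hK v

variable {M : CoupledMesh n} {k : ℕ} {P : Params n} {U : Fields n}

/-- Faces outside the elastic mesh are included, where the trace is zero: the coupling terms
evaluate displacement traces on faces of acoustic elements. -/
lemma InSpace.continuousOn_dispTrace (h : InSpace M k U) (F : Finset (E n)) (i : Fin n) :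
    ContinuousOn (fun x => U.dispTrace F i x) (convexHull ℝ (F : Set (E n))) := by
  by_cases hF : F ∈ faces M.TE
  · exact (h.dispTrace_mem F hF i).continuousOn
  · rw [h.dispTrace_zero F hF]
    exact continuousOn_const

lemma InSpace.continuousOn_potTrace (h : InSpace M k U) (F : Finset (E n)) :
    ContinuousOn (fun x => U.potTrace F x) (convexHull ℝ (F : Set (E n))) := by
  by_cases hF : F ∈ faces M.TA
  · exact (h.potTrace_mem F hF).continuousOn
  · rw [h.potTrace_zero F hF]
    exact continuousOn_const

/-- The stabilization is merely integrable; the jump it multiplies is continuous on a compact face,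
hence bounded. -/
lemma InSpace.bdryIntegrable_elFlux (hn : 0 < n) (h : InSpace M k U)
    (htauE : StabAdmissible M.TE P.s P.tauE) (i : Fin n) :
    BdryIntegrable M.TE fun K v x => elFlux P U K v x i :=
  bdryIntegrable_flux hn (fun K => U.stress K i) (fun K => U.disp K i)
    (what := fun F x => U.dispTrace F i x) (fun _ _ _ => h.continuousOn_dispTrace _ i)
    fun K hK v => (htauE K hK v).1

lemma InSpace.bdryIntegrable_acFlux (hn : 0 < n) (h : InSpace M k U)
    (htauA : StabAdmissible M.TA P.s P.tauA) :
    BdryIntegrable M.TA fun K v x => acFlux P U K v x :=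
  bdryIntegrable_flux hn U.vel U.pot (fun _ _ _ => h.continuousOn_potTrace _)
    fun K hK v => (htauA K hK v).1

end Continuity

variable {M : CoupledMesh n} {k : ℕ} {P : Params n}

/-- Element integrands are continuous on compact sets; in face integrands one factor is integrable
and the conjugated one continuous. The other forms follow the same pattern. -/
lemma isSesq_constitutiveForm (hn : 0 < n) : IsSesq (discreteSpace M k) (constitutiveForm M P) := by
  refine (((IsSesq.volInt (fun K x => .frobC (isLin_hookeInv K x · · P) (isLin_stress K x)) ?_).add
    (IsSesq.volInt (fun K x => .dotC (isLin_disp K x) (isLin_divM_stress K x)) ?_)).add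
    (IsSesq.volInt (fun K x => .frobC (isLin_rot K x) (isLin_stress K x)) ?_)).sub
    (IsSesq.bdryInt (fun K v x => .dotC (isLin_dispTrace x · (K.face v))
      (IsLin.mulN (isLin_stress K x) _)) ?_)
  · exact fun U _ V _ K _ => continuous_frobC (continuous_hookeInv_evM P _)
      fun i j => continuous_ev _
  · exact fun U _ V _ K _ => continuous_dotC (fun i => continuous_ev _) fun i => continuous_ev _
  · exact fun U _ V _ K _ => continuous_frobC (fun i j => continuous_ev _)
      fun i j => continuous_ev _
  · exact fun U hU V _ => bdryIntegrable_dotC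
      (fun i K _ v => K.integrableOn_facet_of_continuousOn hn v
        (InSpace.continuousOn_dispTrace hU _ i))
      fun i K _ v => (continuous_dotN_evV (V.stress K i) _).continuousOn

lemma isSesq_momentumForm (hn : 0 < n) (htauE : StabAdmissible M.TE P.s P.tauE) :
    IsSesq (discreteSpace M k) (momentumForm M P) := by
  refine ((IsSesq.volInt (fun K x => .frobC (isLin_stress K x) (isLin_gradV_disp K x)) ?_).sub
    (IsSesq.bdryInt (fun K v x => .dotC (isLin_elFlux K v x · P) (isLin_disp K x)) ?_)).add
    ((IsSesq.volInt (fun K x => .dotC (isLin_disp K x) (isLin_disp K x)) ?_).const_mul _)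
  · exact fun U _ V _ K _ => continuous_frobC (fun i j => continuous_ev _)
      fun i j => continuous_ev _
  · exact fun U hU V _ => bdryIntegrable_dotC (InSpace.bdryIntegrable_elFlux hn hU htauE)
      fun i K _ v => (continuous_ev _).continuousOn
  · exact fun U _ V _ K _ => continuous_dotC (fun i => continuous_ev _) fun i => continuous_ev _

lemma isSesq_symmetryForm : IsSesq (discreteSpace M k) (symmetryForm M) :=
  IsSesq.volInt (fun K x => .frobC (isLin_stress K x) (isLin_rot K x)) fun _ _ _ _ _ _ =>
    continuous_frobC (fun _ _ => continuous_ev _) fun _ _ => continuous_ev _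

lemma isSesq_elFluxForm (hn : 0 < n) (htauE : StabAdmissible M.TE P.s P.tauE)
    (Q : Set (Finset (E n))) : IsSesq (discreteSpace M k) (elFluxForm M P · · Q) :=
  IsSesq.bdryInt (fun K v x => .dotC (isLin_elFlux K v x · P) (isLin_dispTrace x · _))
    fun _ hU _ hV => bdryIntegrable_dotC (InSpace.bdryIntegrable_elFlux hn hU htauE)
      fun i _ _ _ => InSpace.continuousOn_dispTrace hV _ i

lemma isSesq_velocityForm (hn : 0 < n) : IsSesq (discreteSpace M k) (velocityForm M) := by
  refine ((IsSesq.volInt (fun K x => .dotC (isLin_vel K x) (isLin_vel K x)) ?_).add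
    (IsSesq.volInt (fun K x => .mul_conj (isLin_pot K x) (isLin_divV_vel K x)) ?_)).sub
    (IsSesq.bdryInt (fun K v x => .mul_conj (isLin_potTrace x _)
      (IsLin.dotN (isLin_vel K x) _)) ?_)
  · exact fun U _ V _ K _ => continuous_dotC (fun i => continuous_ev _) fun i => continuous_ev _
  · exact fun U _ V _ K _ => (continuous_ev _).mul (continuous_conj_comp (continuous_ev _))
  · exact fun U hU V _ => bdryIntegrable_mul_conj
      (fun K _ v => K.integrableOn_facet_of_continuousOn hn v
        (InSpace.continuousOn_potTrace hU _))
      fun K _ v => (continuous_dotN_evV (V.vel K) _).continuousOn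

lemma isSesq_waveForm (hn : 0 < n) (htauA : StabAdmissible M.TA P.s P.tauA) :
    IsSesq (discreteSpace M k) (waveForm M P) := by
  refine ((IsSesq.volInt (fun K x => .dotC (isLin_vel K x) (isLin_grad_pot K x)) ?_).sub
    (IsSesq.bdryInt (fun K v x => .mul_conj (isLin_acFlux K v x P) (isLin_pot K x)) ?_)).add
    ((IsSesq.volInt (fun K x => .mul_conj (isLin_pot K x) (isLin_pot K x)) ?_).const_mul _)
  · exact fun U _ V _ K _ => continuous_dotC (fun i => continuous_ev _) fun i => continuous_ev _
  · exact fun U hU V _ => bdryIntegrable_mul_conj (InSpace.bdryIntegrable_acFlux hn hU htauA)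
      fun K _ v => (continuous_ev _).continuousOn
  · exact fun U _ V _ K _ => (continuous_ev _).mul (continuous_conj_comp (continuous_ev _))

lemma isSesq_acFluxForm (hn : 0 < n) (htauA : StabAdmissible M.TA P.s P.tauA)
    (Q : Set (Finset (E n))) : IsSesq (discreteSpace M k) (acFluxForm M P · · Q) :=
  IsSesq.bdryInt (fun K v x => .mul_conj (isLin_acFlux K v x P) (isLin_potTrace x _))
    fun _ hU _ hV => bdryIntegrable_mul_conj (InSpace.bdryIntegrable_acFlux hn hU htauA)
      fun _ _ _ => InSpace.continuousOn_potTrace hV _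

lemma isSesq_dirichletForm (hn : 0 < n) : IsSesq (discreteSpace M k) (dirichletForm M) :=
  IsSesq.bdryInt (fun _ _ x => .mul_conj (isLin_potTrace x _) (isLin_potTrace x _))
    fun _ hU _ hV => bdryIntegrable_mul_conj
      (fun K _ v => K.integrableOn_facet_of_continuousOn hn v (InSpace.continuousOn_potTrace hU _))
      fun _ _ _ => InSpace.continuousOn_potTrace hV _

lemma isSesq_kinematicForm (hn : 0 < n) : IsSesq (discreteSpace M k) (kinematicForm M P) :=
  IsSesq.bdryInt (fun K v x => .mul_conj
      ((IsLin.dotN (isLin_dispTrace x · (K.face v)) (K.normal v)).const_mul P.s)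
      (isLin_potTrace x _))
    fun _ hU _ hV => bdryIntegrable_mul_conj
      (fun K _ v => K.integrableOn_facet_of_continuousOn hn v (continuousOn_const.mul
        (continuousOn_finsetSum _ fun i _ =>
          (InSpace.continuousOn_dispTrace hU _ i).mul continuousOn_const)))
      fun _ _ _ => InSpace.continuousOn_potTrace hV _

lemma isSesq_dynamicForm (hn : 0 < n) : IsSesq (discreteSpace M k) (dynamicForm M P) :=
  IsSesq.bdryInt (fun K v x => .dotC
      (fun _ => ((isLin_potTrace x (K.face v)).const_mul _).mul_const _)
      (isLin_dispTrace x · _))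
    fun _ hU _ hV => bdryIntegrable_dotC
      (fun _ K _ v => K.integrableOn_facet_of_continuousOn hn v ((continuousOn_const.mul
        (InSpace.continuousOn_potTrace hU _)).mul continuousOn_const))
      fun i _ _ _ => InSpace.continuousOn_dispTrace hV _ i

lemma isSesq_schemeForm (hn : 0 < n) (htauA : StabAdmissible M.TA P.s P.tauA)
    (htauE : StabAdmissible M.TE P.s P.tauE) :
    IsSesq (discreteSpace M k) (schemeForm M P) :=
  (((((((((isSesq_constitutiveForm hn).add (isSesq_momentumForm hn htauE)).add isSesq_symmetryForm).add
    (isSesq_elFluxForm hn htauE _)).add (isSesq_velocityForm hn)).add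
    (isSesq_waveForm hn htauA)).add (isSesq_acFluxForm hn htauA _)).add
    (isSesq_dirichletForm hn)).add
    ((isSesq_acFluxForm hn htauA _).sub (isSesq_kinematicForm hn))).add
    ((isSesq_elFluxForm hn htauE _).neg.add (isSesq_dynamicForm hn))

/-! ### Semilinearity of the right-hand side -/

variable {d : Data n}

/-- On a set of finite measure, square integrable functions are integrable. -/
lemma _root_.MeasureTheory.MemLp.integrableOn_subset {α F : Type*} [MeasurableSpace α]
    [NormedAddCommGroup F] {μ : Measure α} {f : α → F} {s t : Set α}
    (h : MemLp f 2 (μ.restrict t)) (hst : s ⊆ t) (hs : μ s < ⊤) : IntegrableOn f s μ := by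
  have : IsFiniteMeasure (μ.restrict s) := ⟨by rwa [Measure.restrict_apply_univ]⟩
  exact (h.mono_measure (Measure.restrict_mono hst le_rfl)).integrable one_le_two

lemma isSemilin_elSource (hd : d.SquareIntegrable M) :
    IsSemilin (starRingEnd ℂ) (discreteSpace M k) (elSource M d) := by
  refine IsSemilin.volInt (fun K _ x => IsSemilin.sum _ fun i _ =>
    (isLin_disp K x i).conj.const_mul _) fun U _ K hK => ?_
  have h := hd.fE.integrableOn_subset (Set.subset_biUnion_of_mem (u := Cell.body) hK)
    K.isCompact_body.measure_lt_top
  exact integrable_finsetSum _ fun i _ => IntegrableOn.mul_continuousOn (h.eval i)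
    (continuous_conj_comp (continuous_ev _)).continuousOn K.isCompact_body

lemma isSemilin_acSource (hd : d.SquareIntegrable M) :
    IsSemilin (starRingEnd ℂ) (discreteSpace M k) (acSource M d) := by
  refine IsSemilin.volInt (fun K _ x => (isLin_pot K x).conj.const_mul _) fun U _ K hK => ?_
  have h := hd.fA.integrableOn_subset (Set.subset_biUnion_of_mem (u := Cell.body) hK)
    K.isCompact_body.measure_lt_top
  exact h.mul_continuousOn (continuous_conj_comp (continuous_ev _)).continuousOn K.isCompact_body

lemma facet_subset_surface {Q : Set (Finset (E n))} {K : Cell n} {v : K.verts}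
    (h : K.face v ∈ Q) : K.facet v ⊆ surface Q :=
  Set.subset_biUnion_of_mem (u := fun F : Finset (E n) => convexHull ℝ (F : Set (E n))) h

lemma isSemilin_boundarySource (hn : 0 < n) {g : E n → ℂ} {Q : Set (Finset (E n))}
    (hg : MemLp g 2 ((Cell.surf n).restrict (surface Q))) :
    IsSemilin (starRingEnd ℂ) (discreteSpace M k) (boundarySource M · g Q) :=
  IsSemilin.bdryInt (fun _ _ _ x => (isLin_potTrace x _).conj.const_mul _) fun _ hU K _ v hv =>
    (hg.integrableOn_subset (facet_subset_surface hv) (K.surf_facet_lt_top hn v)).mul_continuousOn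
      (ContinuousOn.conj_comp (InSpace.continuousOn_potTrace hU _)) (K.isCompact_facet v)

lemma isSemilin_kinematicSource (hn : 0 < n) (hd : d.SquareIntegrable M) :
    IsSemilin (starRingEnd ℂ) (discreteSpace M k) (kinematicSource M d) := by
  refine IsSemilin.bdryInt (fun K _ v x => (isLin_potTrace x _).conj.const_mul _)
    fun U hU K _ v hv => ?_
  have h := hd.gradVinc.integrableOn_subset (facet_subset_surface hv) (K.surf_facet_lt_top hn v)
  refine IntegrableOn.mul_continuousOn ?_
    (ContinuousOn.conj_comp (InSpace.continuousOn_potTrace hU _)) (K.isCompact_facet v)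
  exact integrable_finsetSum _ fun i _ => (h.eval i).mul_const _

lemma isSemilin_dynamicSource (hn : 0 < n) (hd : d.SquareIntegrable M) :
    IsSemilin (starRingEnd ℂ) (discreteSpace M k) (dynamicSource M d) := by
  refine IsSemilin.bdryInt (fun K _ v x => IsSemilin.sum _ fun i _ =>
    (isLin_dispTrace x i _).conj.const_mul _) fun U hU K _ v hv => ?_
  have h := hd.vinc.integrableOn_subset (facet_subset_surface hv) (K.surf_facet_lt_top hn v)
  exact integrable_finsetSum _ fun i _ => IntegrableOn.mul_continuousOn (h.mul_const _)
    (ContinuousOn.conj_comp (InSpace.continuousOn_dispTrace hU _ i)) (K.isCompact_facet v)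

lemma isSemilin_schemeSource (hn : 0 < n) (hd : d.SquareIntegrable M) :
    IsSemilin (starRingEnd ℂ) (discreteSpace M k) (schemeSource M P d) :=
  (((((isSemilin_elSource hd).add' (isSemilin_acSource hd)).add'
    (isSemilin_boundarySource hn hd.gN)).add' (isSemilin_boundarySource hn hd.gD)).add'
    (isSemilin_kinematicSource hn hd).neg).add' ((isSemilin_dynamicSource hn hd).const_mul _)

end Sesquilinear

end HDG

end

noncomputable section

open scoped Classical
open MeasureTheory MvPolynomial

namespace HDG

variable {n : ℕ} {M : CoupledMesh n} {k : ℕ} {P : Params n} {d : Data n}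

/-! ### Equivalence of the scheme with the variational equation -/

/-- Restriction of a family of face functions to a set of faces, extended by zero. -/
def faceMask {ι β : Type*} [Zero β] (Q : Set ι) (f : ι → β) : ι → β :=
  fun F => if F ∈ Q then f F else 0

lemma faceMask_mem {ι β : Type*} [Zero β] {Q : Set ι} {f : ι → β} {F : ι} (h : F ∈ Q) :
    faceMask Q f F = f F := if_pos h

lemma faceMask_notMem {ι β : Type*} [Zero β] {Q : Set ι} {f : ι → β} {F : ι} (h : F ∉ Q) :
    faceMask Q f F = 0 := if_neg h

namespace InSpace

variable {T : Fields n}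

lemma of_stress (h : InSpace M k T) : InSpace M k ⟨T.stress, 0, 0, 0, 0, 0, 0⟩ :=
  { (discreteSpace M k).zero_mem with
    stress_mem := h.stress_mem
    stress_zero := h.stress_zero }

lemma of_disp (h : InSpace M k T) : InSpace M k ⟨0, T.disp, 0, 0, 0, 0, 0⟩ :=
  { (discreteSpace M k).zero_mem with
    disp_mem := h.disp_mem
    disp_zero := h.disp_zero }

lemma of_rot (h : InSpace M k T) : InSpace M k ⟨0, 0, T.rot, 0, 0, 0, 0⟩ :=
  { (discreteSpace M k).zero_mem with
    rot_mem := h.rot_mem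
    rot_zero := h.rot_zero }

lemma of_vel (h : InSpace M k T) : InSpace M k ⟨0, 0, 0, 0, T.vel, 0, 0⟩ :=
  { (discreteSpace M k).zero_mem with
    vel_mem := h.vel_mem
    vel_zero := h.vel_zero }

lemma of_pot (h : InSpace M k T) : InSpace M k ⟨0, 0, 0, 0, 0, T.pot, 0⟩ :=
  { (discreteSpace M k).zero_mem with
    pot_mem := h.pot_mem
    pot_zero := h.pot_zero }

/-- Traces on different faces are independent of each other, so cutting a trace off to a set of
faces does not leave the space. -/
lemma of_dispTrace (h : InSpace M k T) (Q : Set (Finset (E n))) :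
    InSpace M k ⟨0, 0, 0, faceMask Q T.dispTrace, 0, 0, 0⟩ :=
  { (discreteSpace M k).zero_mem with
    dispTrace_mem := fun F hF i => by
      by_cases hQ : F ∈ Q
      · simpa only [faceMask_mem hQ] using h.dispTrace_mem F hF i
      · simp only [faceMask_notMem hQ]
        exact (discreteSpace M k).zero_mem.dispTrace_mem F hF i
    dispTrace_zero := fun F hF => by
      by_cases hQ : F ∈ Q
      · simpa only [faceMask_mem hQ] using h.dispTrace_zero F hF
      · exact faceMask_notMem hQ }

lemma of_potTrace (h : InSpace M k T) (Q : Set (Finset (E n))) :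
    InSpace M k ⟨0, 0, 0, 0, 0, 0, faceMask Q T.potTrace⟩ :=
  { (discreteSpace M k).zero_mem with
    potTrace_mem := fun F hF => by
      by_cases hQ : F ∈ Q
      · simpa only [faceMask_mem hQ] using h.potTrace_mem F hF
      · simp only [faceMask_notMem hQ]
        exact (discreteSpace M k).zero_mem.potTrace_mem F hF
    potTrace_zero := fun F hF => by
      by_cases hQ : F ∈ Q
      · simpa only [faceMask_mem hQ] using h.potTrace_zero F hF
      · exact faceMask_notMem hQ }

end InSpace

/-- The Neumann datum belongs to the equation tested outside the interface and the Dirichlet faces;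
masking a test trace to those faces therefore leaves its term unchanged. -/
lemma neumann_subset : M.neumann ⊆ (M.interface ∪ M.dirichlet)ᶜ := by
  rintro F ⟨h1, h2⟩ (h | h)
  · exact h1.2.1 h.1
  · exact h2 h

/-! ### Forms and sources tested with a masked trace -/

section Masks

variable (U T : Fields n) {Q R : Set (Finset (E n))}


lemma elFluxForm_mask (h : Q ⊆ R) :
    elFluxForm M P U ⟨0, 0, 0, faceMask R T.dispTrace, 0, 0, 0⟩ Q = elFluxForm M P U T Q :=
  bdryInt_congr fun K _ v hv x _ => by simp only [faceMask_mem (h hv)]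

lemma elFluxForm_mask_disjoint (h : ∀ F ∈ Q, F ∉ R) :
    elFluxForm M P U ⟨0, 0, 0, faceMask R T.dispTrace, 0, 0, 0⟩ Q = 0 :=
  bdryInt_eq_zero fun K _ v hv x _ => by simp [faceMask_notMem (h _ hv)]

lemma dynamicForm_mask (h : M.interface ⊆ R) :
    dynamicForm M P U ⟨0, 0, 0, faceMask R T.dispTrace, 0, 0, 0⟩ = dynamicForm M P U T :=
  bdryInt_congr fun K _ v hv x _ => by simp only [faceMask_mem (h hv)]

lemma dynamicForm_mask_disjoint (h : ∀ F ∈ M.interface, F ∉ R) :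
    dynamicForm M P U ⟨0, 0, 0, faceMask R T.dispTrace, 0, 0, 0⟩ = 0 :=
  bdryInt_eq_zero fun K _ v hv x _ => by simp [faceMask_notMem (h _ hv)]

lemma dynamicSource_mask (h : M.interface ⊆ R) :
    dynamicSource M d ⟨0, 0, 0, faceMask R T.dispTrace, 0, 0, 0⟩ = dynamicSource M d T :=
  bdryInt_congr fun K _ v hv x _ => by simp only [faceMask_mem (h hv)]

lemma dynamicSource_mask_disjoint (h : ∀ F ∈ M.interface, F ∉ R) :
    dynamicSource M d ⟨0, 0, 0, faceMask R T.dispTrace, 0, 0, 0⟩ = 0 :=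
  bdryInt_eq_zero fun K _ v hv x _ => by simp [faceMask_notMem (h _ hv)]

lemma acFluxForm_mask (h : Q ⊆ R) :
    acFluxForm M P U ⟨0, 0, 0, 0, 0, 0, faceMask R T.potTrace⟩ Q = acFluxForm M P U T Q :=
  bdryInt_congr fun K _ v hv x _ => by simp only [faceMask_mem (h hv)]

lemma acFluxForm_mask_disjoint (h : ∀ F ∈ Q, F ∉ R) :
    acFluxForm M P U ⟨0, 0, 0, 0, 0, 0, faceMask R T.potTrace⟩ Q = 0 :=
  bdryInt_eq_zero fun K _ v hv x _ => by simp [faceMask_notMem (h _ hv)]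

lemma dirichletForm_mask (h : M.dirichlet ⊆ R) :
    dirichletForm M U ⟨0, 0, 0, 0, 0, 0, faceMask R T.potTrace⟩ = dirichletForm M U T :=
  bdryInt_congr fun K _ v hv x _ => by simp only [faceMask_mem (h hv)]

lemma dirichletForm_mask_disjoint (h : ∀ F ∈ M.dirichlet, F ∉ R) :
    dirichletForm M U ⟨0, 0, 0, 0, 0, 0, faceMask R T.potTrace⟩ = 0 :=
  bdryInt_eq_zero fun K _ v hv x _ => by simp [faceMask_notMem (h _ hv)]

lemma kinematicForm_mask (h : M.interface ⊆ R) :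
    kinematicForm M P U ⟨0, 0, 0, 0, 0, 0, faceMask R T.potTrace⟩ = kinematicForm M P U T :=
  bdryInt_congr fun K _ v hv x _ => by simp only [faceMask_mem (h hv)]

lemma kinematicForm_mask_disjoint (h : ∀ F ∈ M.interface, F ∉ R) :
    kinematicForm M P U ⟨0, 0, 0, 0, 0, 0, faceMask R T.potTrace⟩ = 0 :=
  bdryInt_eq_zero fun K _ v hv x _ => by simp [faceMask_notMem (h _ hv)]

lemma boundarySource_mask (g : E n → ℂ) (h : Q ⊆ R) :
    boundarySource M ⟨0, 0, 0, 0, 0, 0, faceMask R T.potTrace⟩ g Q = boundarySource M T g Q :=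
  bdryInt_congr fun K _ v hv x _ => by simp only [faceMask_mem (h hv)]

lemma boundarySource_mask_disjoint (g : E n → ℂ) (h : ∀ F ∈ Q, F ∉ R) :
    boundarySource M ⟨0, 0, 0, 0, 0, 0, faceMask R T.potTrace⟩ g Q = 0 :=
  bdryInt_eq_zero fun K _ v hv x _ => by simp [faceMask_notMem (h _ hv)]

lemma kinematicSource_mask (h : M.interface ⊆ R) :
    kinematicSource M d ⟨0, 0, 0, 0, 0, 0, faceMask R T.potTrace⟩ = kinematicSource M d T :=
  bdryInt_congr fun K _ v hv x _ => by simp only [faceMask_mem (h hv)]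

lemma kinematicSource_mask_disjoint (h : ∀ F ∈ M.interface, F ∉ R) :
    kinematicSource M d ⟨0, 0, 0, 0, 0, 0, faceMask R T.potTrace⟩ = 0 :=
  bdryInt_eq_zero fun K _ v hv x _ => by simp [faceMask_notMem (h _ hv)]

end Masks


/-! ### Test tuples with a single nonzero component -/

section Components

variable (U : Fields n)

lemma schemeForm_stress (f : Cell n → MatPoly n) :
    schemeForm M P U ⟨f, 0, 0, 0, 0, 0, 0⟩ = constitutiveForm M P U ⟨f, 0, 0, 0, 0, 0, 0⟩ := by
  simp [schemeForm, momentumForm, symmetryForm, elFluxForm, velocityForm, waveForm, acFluxForm,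
    dirichletForm, kinematicForm, dynamicForm, volInt_zero, bdryInt_zero]

lemma schemeForm_disp (f : Cell n → Fin n → Poly n) :
    schemeForm M P U ⟨0, f, 0, 0, 0, 0, 0⟩ = momentumForm M P U ⟨0, f, 0, 0, 0, 0, 0⟩ := by
  simp [schemeForm, constitutiveForm, symmetryForm, elFluxForm, velocityForm, waveForm, acFluxForm,
    dirichletForm, kinematicForm, dynamicForm, volInt_zero, bdryInt_zero]

lemma schemeForm_rot (f : Cell n → MatPoly n) :
    schemeForm M P U ⟨0, 0, f, 0, 0, 0, 0⟩ = symmetryForm M U ⟨0, 0, f, 0, 0, 0, 0⟩ := by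
  simp [schemeForm, constitutiveForm, momentumForm, elFluxForm, velocityForm, waveForm, acFluxForm,
    dirichletForm, kinematicForm, dynamicForm, volInt_zero, bdryInt_zero]

lemma schemeForm_dispTrace (f : Finset (E n) → Fin n → E n → ℂ) :
    schemeForm M P U ⟨0, 0, 0, f, 0, 0, 0⟩ =
      elFluxForm M P U ⟨0, 0, 0, f, 0, 0, 0⟩ M.interfaceᶜ +
      (-elFluxForm M P U ⟨0, 0, 0, f, 0, 0, 0⟩ M.interface +
        dynamicForm M P U ⟨0, 0, 0, f, 0, 0, 0⟩) := by
  simp [schemeForm, constitutiveForm, momentumForm, symmetryForm, velocityForm, waveForm,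
    acFluxForm, dirichletForm, kinematicForm, volInt_zero, bdryInt_zero]

lemma schemeForm_vel (f : Cell n → Fin n → Poly n) :
    schemeForm M P U ⟨0, 0, 0, 0, f, 0, 0⟩ = velocityForm M U ⟨0, 0, 0, 0, f, 0, 0⟩ := by
  simp [schemeForm, constitutiveForm, momentumForm, symmetryForm, elFluxForm, waveForm, acFluxForm,
    dirichletForm, kinematicForm, dynamicForm, volInt_zero, bdryInt_zero]

lemma schemeForm_pot (f : Cell n → Poly n) :
    schemeForm M P U ⟨0, 0, 0, 0, 0, f, 0⟩ = waveForm M P U ⟨0, 0, 0, 0, 0, f, 0⟩ := by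
  simp [schemeForm, constitutiveForm, momentumForm, symmetryForm, elFluxForm, velocityForm,
    acFluxForm, dirichletForm, kinematicForm, dynamicForm, volInt_zero, bdryInt_zero]

lemma schemeForm_potTrace (f : Finset (E n) → E n → ℂ) :
    schemeForm M P U ⟨0, 0, 0, 0, 0, 0, f⟩ =
      acFluxForm M P U ⟨0, 0, 0, 0, 0, 0, f⟩ (M.interface ∪ M.dirichlet)ᶜ +
      dirichletForm M U ⟨0, 0, 0, 0, 0, 0, f⟩ +
      (acFluxForm M P U ⟨0, 0, 0, 0, 0, 0, f⟩ M.interface -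
        kinematicForm M P U ⟨0, 0, 0, 0, 0, 0, f⟩) := by
  simp [schemeForm, constitutiveForm, momentumForm, symmetryForm, elFluxForm, velocityForm,
    waveForm, dynamicForm, volInt_zero, bdryInt_zero]

lemma schemeSource_stress (f : Cell n → MatPoly n) :
    schemeSource M P d ⟨f, 0, 0, 0, 0, 0, 0⟩ = 0 := by
  simp [schemeSource, elSource, acSource, boundarySource, kinematicSource, dynamicSource,
    volInt_zero, bdryInt_zero]

lemma schemeSource_disp (f : Cell n → Fin n → Poly n) :
    schemeSource M P d ⟨0, f, 0, 0, 0, 0, 0⟩ = elSource M d ⟨0, f, 0, 0, 0, 0, 0⟩ := by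
  simp [schemeSource, acSource, boundarySource, kinematicSource, dynamicSource,
    volInt_zero, bdryInt_zero]

lemma schemeSource_rot (f : Cell n → MatPoly n) :
    schemeSource M P d ⟨0, 0, f, 0, 0, 0, 0⟩ = 0 := by
  simp [schemeSource, elSource, acSource, boundarySource, kinematicSource, dynamicSource,
    volInt_zero, bdryInt_zero]

lemma schemeSource_dispTrace (f : Finset (E n) → Fin n → E n → ℂ) :
    schemeSource M P d ⟨0, 0, 0, f, 0, 0, 0⟩ =
      -(P.rhoF * P.s) * dynamicSource M d ⟨0, 0, 0, f, 0, 0, 0⟩ := by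
  simp [schemeSource, elSource, acSource, boundarySource, kinematicSource,
    volInt_zero, bdryInt_zero]

lemma schemeSource_vel (f : Cell n → Fin n → Poly n) :
    schemeSource M P d ⟨0, 0, 0, 0, f, 0, 0⟩ = 0 := by
  simp [schemeSource, elSource, acSource, boundarySource, kinematicSource, dynamicSource,
    volInt_zero, bdryInt_zero]

lemma schemeSource_pot (f : Cell n → Poly n) :
    schemeSource M P d ⟨0, 0, 0, 0, 0, f, 0⟩ = acSource M d ⟨0, 0, 0, 0, 0, f, 0⟩ := by
  simp [schemeSource, elSource, boundarySource, kinematicSource, dynamicSource,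
    volInt_zero, bdryInt_zero]

lemma schemeSource_potTrace (f : Finset (E n) → E n → ℂ) :
    schemeSource M P d ⟨0, 0, 0, 0, 0, 0, f⟩ =
      boundarySource M ⟨0, 0, 0, 0, 0, 0, f⟩ d.gN M.neumann +
      boundarySource M ⟨0, 0, 0, 0, 0, 0, f⟩ d.gD M.dirichlet +
      -kinematicSource M d ⟨0, 0, 0, 0, 0, 0, f⟩ := by
  simp [schemeSource, elSource, acSource, dynamicSource, volInt_zero, bdryInt_zero]

end Components

lemma schemeSource_zeroData (T : Fields n) : schemeSource M P (zeroData n) T = 0 := by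
  have e : (0 : Fin n → ℂ) = fun _ => 0 := rfl
  simp [schemeSource, elSource, acSource, boundarySource, kinematicSource, dynamicSource, zeroData,
    volInt_zero, bdryInt_zero, e]

/-- The scheme amounts to one equation that is tested with the product space. -/
theorem isSolution_iff {U : Fields n} : IsSolution M k P d U ↔
    U ∈ discreteSpace M k ∧ ∀ T ∈ discreteSpace M k,
      schemeForm M P U T = schemeSource M P d T := by
  constructor
  · intro h
    refine ⟨h.mem, fun T hT => ?_⟩
    have e1 : constitutiveForm M P U T = 0 := h.hooke T hT
    have e2 : momentumForm M P U T = elSource M d T := h.momentum T hT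
    have e3 : symmetryForm M U T = 0 := h.symmetry T hT
    have e4 : elFluxForm M P U T M.interfaceᶜ = 0 := h.elContinuity T hT
    have e5 : velocityForm M U T = 0 := h.velocity T hT
    have e6 : waveForm M P U T = acSource M d T := h.wave T hT
    have e7 : acFluxForm M P U T (M.interface ∪ M.dirichlet)ᶜ =
      boundarySource M T d.gN M.neumann := h.acContinuity T hT
    have e8 : dirichletForm M U T = boundarySource M T d.gD M.dirichlet := h.dirichletBC T hT
    have e9 : acFluxForm M P U T M.interface - kinematicForm M P U T =
      -kinematicSource M d T := h.kinematic T hT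
    have e10 : -elFluxForm M P U T M.interface + dynamicForm M P U T =
      -(P.rhoF * P.s) * dynamicSource M d T := h.dynamic T hT
    rw [schemeForm, schemeSource, e1, e2, e3, e4, e5, e6, e7, e8, e9, e10]
    ring
  · rintro ⟨hU, h⟩
    -- A displacement trace occurs in two equations (on and off the interface), a potential trace in
    -- three (interface, Dirichlet faces, all others). These classes are disjoint, so a mask to one
    -- of them removes the other equations.
    have hΓ : ∀ F ∈ M.interface, F ∉ M.interfaceᶜ := fun F hF hF' => hF' hF
    have hΓD : ∀ F ∈ M.interface, F ∉ M.dirichlet := fun F => M.disjoint_interface_dirichlet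
    have hDΓ : ∀ F ∈ M.dirichlet, F ∉ M.interface := fun F hF hF' => hΓD F hF' hF
    have hΓu : ∀ F ∈ M.interface, F ∉ (M.interface ∪ M.dirichlet)ᶜ := fun F hF hF' => hF' (.inl hF)
    have hDu : ∀ F ∈ M.dirichlet, F ∉ (M.interface ∪ M.dirichlet)ᶜ := fun F hF hF' => hF' (.inr hF)
    have huΓ : ∀ F ∈ (M.interface ∪ M.dirichlet)ᶜ, F ∉ M.interface := fun F hF hF' => hF (.inl hF')
    have huD : ∀ F ∈ (M.interface ∪ M.dirichlet)ᶜ, F ∉ M.dirichlet := fun F hF hF' => hF (.inr hF')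
    have hNΓ : ∀ F ∈ M.neumann, F ∉ M.interface := fun F hF => huΓ F (neumann_subset hF)
    have hND : ∀ F ∈ M.neumann, F ∉ M.dirichlet := fun F hF => hF.2
    exact
    { mem := hU
      hooke := fun T hT => by
        have := h _ hT.of_stress
        rwa [schemeForm_stress, schemeSource_stress] at this
      momentum := fun T hT => by
        have := h _ hT.of_disp
        rwa [schemeForm_disp, schemeSource_disp] at this
      symmetry := fun T hT => by
        have := h _ hT.of_rot
        rwa [schemeForm_rot, schemeSource_rot] at this
      elContinuity := fun T hT => by
        have := h _ (hT.of_dispTrace M.interfaceᶜ)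
        rwa [schemeForm_dispTrace, schemeSource_dispTrace, elFluxForm_mask U T subset_rfl,
          elFluxForm_mask_disjoint U T hΓ, dynamicForm_mask_disjoint U T hΓ,
          dynamicSource_mask_disjoint T hΓ, neg_zero, add_zero, add_zero, mul_zero] at this
      velocity := fun T hT => by
        have := h _ hT.of_vel
        rwa [schemeForm_vel, schemeSource_vel] at this
      wave := fun T hT => by
        have := h _ hT.of_pot
        rwa [schemeForm_pot, schemeSource_pot] at this
      acContinuity := fun T hT => by
        have := h _ (hT.of_potTrace (M.interface ∪ M.dirichlet)ᶜ)
        rwa [schemeForm_potTrace, schemeSource_potTrace, acFluxForm_mask U T subset_rfl,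
          dirichletForm_mask_disjoint U T hDu, acFluxForm_mask_disjoint U T hΓu,
          kinematicForm_mask_disjoint U T hΓu, boundarySource_mask T _ neumann_subset,
          boundarySource_mask_disjoint T _ hDu, kinematicSource_mask_disjoint T hΓu, neg_zero,
          sub_zero, add_zero, add_zero, add_zero, add_zero] at this
      dirichletBC := fun T hT => by
        have := h _ (hT.of_potTrace M.dirichlet)
        rwa [schemeForm_potTrace, schemeSource_potTrace, acFluxForm_mask_disjoint U T huD,
          dirichletForm_mask U T subset_rfl, acFluxForm_mask_disjoint U T hΓD,
          kinematicForm_mask_disjoint U T hΓD, boundarySource_mask_disjoint T _ hND,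
          boundarySource_mask T _ subset_rfl, kinematicSource_mask_disjoint T hΓD, neg_zero,
          sub_zero, add_zero, add_zero, zero_add, zero_add] at this
      kinematic := fun T hT => by
        have := h _ (hT.of_potTrace M.interface)
        rwa [schemeForm_potTrace, schemeSource_potTrace, acFluxForm_mask_disjoint U T huΓ,
          dirichletForm_mask_disjoint U T hDΓ, acFluxForm_mask U T subset_rfl,
          kinematicForm_mask U T subset_rfl, boundarySource_mask_disjoint T _ hNΓ,
          boundarySource_mask_disjoint T _ hDΓ, kinematicSource_mask T subset_rfl,
          zero_add, zero_add, zero_add] at this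
      dynamic := fun T hT => by
        have := h _ (hT.of_dispTrace M.interface)
        rwa [schemeForm_dispTrace, schemeSource_dispTrace,
          elFluxForm_mask_disjoint U T (Q := M.interfaceᶜ) (fun _ hF => hF),
          elFluxForm_mask U T subset_rfl, dynamicForm_mask U T subset_rfl,
          dynamicSource_mask T subset_rfl, zero_add] at this }

end HDG

end

/-! ### Existence and uniqueness -/

theorem theorem4p1 (n : ℕ) (hn : n = 2 ∨ n = 3) (k : ℕ) (M : HDG.CoupledMesh n)
    (P : HDG.Params n)
    (hmu : 0 < P.mu) (hlam : 0 < n * P.lam + 2 * P.mu)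
    (hrhoE : 0 < P.rhoE) (hrhoF : 0 < P.rhoF) (hc : 0 < P.c) (hs : 0 < P.s.re)
    (htauA : HDG.StabAdmissible M.TA P.s P.tauA)
    (htauE : HDG.StabAdmissible M.TE P.s P.tauE)
    (d : HDG.Data n) (hd : d.SquareIntegrable M) :
    ∃! U : HDG.Fields n, HDG.IsSolution M k P d U := by
  have hn0 : 0 < n := by omega
  have hb := HDG.isSesq_schemeForm (k := k) hn0 htauA htauE
  have h0 : ∀ U ∈ HDG.discreteSpace M k,
      (∀ T ∈ HDG.discreteSpace M k, HDG.schemeForm M P U T = 0) → U = 0 := fun U hU h =>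
    HDG.eq_zero_of_homogeneous hn0 hmu hlam hrhoE hrhoF hc hs htauA htauE
      (HDG.isSolution_iff.2 ⟨hU, fun T hT => by rw [h T hT, HDG.schemeSource_zeroData]⟩)
  obtain ⟨U, hU, h⟩ := hb.exists_solution h0 (HDG.isSemilin_schemeSource hn0 hd)
  refine ⟨U, HDG.isSolution_iff.2 ⟨hU, h⟩, fun V hV => sub_eq_zero.1 ?_⟩
  obtain ⟨hV, h'⟩ := HDG.isSolution_iff.1 hV
  -- The difference of two solutions, written as V + (-1) U, solves the homogeneous scheme.
  refine h0 _ (sub_mem hV hU) fun T hT => ?_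
  rw [sub_eq_add_neg, ← neg_one_smul ℂ, (hb.left T hT).add V hV _ (Submodule.smul_mem _ _ hU),
    (hb.left T hT).smul _ U hU, h T hT, h' T hT, RingHom.id_apply]
  ring
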